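/- Let $\mathbb{R}_+=(0,\infty)$ and, for $\Omega\in\{\mathbb{R},\mathbb{R}_+\}$ with Lebesgue measure $|\cdot|$, let $X(\Omega)$ be one of the following spaces of (a.e. classes of) measurable functions $f:\Omega\to\mathbb{C}$ of finite norm: (a) the Lorentz space $L^{p,q}(\Omega)$ with $1<p,q<\infty$ and norm $\|f\|=\big(\int_0^\infty (t^{1/p}f^{**}(t))^q\,\frac{dt}{t}\big)^{1/q}$, where $f^{**}(t)=\frac1t\int_0^t f^*(s)\,ds$ and $f^*(t)=\inf\{\lambda\ge 0: |\{x\in\Omega:|f(x)|>\lambda\}|\le t\}$ (with $\inf\emptyset=\infty$); (b) the Orlicz space $L^\Phi(\Omega)$ with norm $\|f\|=\inf\{\lambda>0:\int_\Omega\Phi(|f(x)|/\lambda)\,dx\le1\}$, where $\Phi(x)=\int_0^x\varphi(t)\,dt$ for a non-decreasing left-continuous $\varphi:[0,\infty)\to[0,\infty]$ with $\varphi(0)=0$ and $\lim_{t\to\infty}\varphi(t)=\infty$ that is not identically $\infty$ on $(0,\infty)$, and where $L^\Phi(\mathbb{R}_+)$ is assumed to be reflexive; (c) the variable Lebesgue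 space $L^{p(\cdot)}(\Omega)$ with norm $\|f\|=\inf\{\lambda>0:\int_\Omega|f(x)/\lambda|^{p(x)}\,dx\le1\}$, where $p(\cdot):\mathbb{R}\to[1,\infty]$ is measurable and a.e. finite, $1<\operatorname{ess\,inf}p\le\operatorname{ess\,sup}p<\infty$, and the Hardy–Littlewood maximal operator $(Mf)(x)=\sup_{I\ni x}\frac1{|I|}\int_I|f(t)|\,dt$ (supremum over bounded intervals $I$) is bounded on $L^{p(\cdot)}(\mathbb{R})$. Let $F$ be the Fourier transform on $L^2(\mathbb{R})$ normalized by $(Ff)(\xi)=\int_{\mathbb{R}}f(x)e^{i\xi x}\,dx$ for $f \in L^1(\mathbb{R})\cap L^2(\mathbb{R})$. A function $a\in L^\infty(\mathbb{R})$ is a Fourier multiplier on $X(\mathbb{R})$ if $f\mapsto F^{-1}(a\cdot Ff)$ maps $L^2(\mathbb{R})\cap X(\mathbb{R})$ into $X(\mathbb{R})$ and extends to a bounded linear operator $W^0(a)$ on $X(\mathbb{R})$. The Wiener–Hopf operator with such a symbol $a$ is $W(a)=r_+W^0(a)\ell_+$ on $X(\mathbb{R}_+)$, where $r_+:X(\mathbb{R})\to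 X(\mathbb{R}_+)$ is the restriction and $\ell_+:X(\mathbb{R}_+)\to X(\mathbb{R})$ is the extension by zero. For $n\in\mathbb{Z}$ put $r_n(\xi)=\big(\frac{\xi-i}{\xi+i}\big)^n$, $\xi\in\mathbb{R}$. Then every $r_k$, $k\in\mathbb{Z}$, is a Fourier multiplier on $X(\mathbb{R})$, the function $\psi_0(x)=\sqrt2\,e^{-x}$, $x\in\mathbb{R}_+$, belongs to $X(\mathbb{R}_+)$, and, with $\psi_k=W(r_k)\psi_0$ for $k\ge1$, for every integer $n\ge0$ $$\operatorname{Ker}W(r_{-n})=\operatorname{span}\{\psi_k:k=0,1,\dots,n-1\}\subset X(\mathbb{R}_+)$$ (the span being $\{0\}$ for $n=0$). -/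

import Mathlib

open MeasureTheory Set Filter Topology
open scoped ENNReal NNReal FourierTransform

noncomputable section

namespace WH

/-! ### Normed spaces of measurable functions on the line -/

/-- Lebesgue measure on `ℝ₊ = (0, ∞)`. -/
abbrev volPos : Measure ℝ := volume.restrict (Ioi (0 : ℝ))

/-- A norm with values in `[0, ∞]` on the a.e. classes of complex measurable functions. -/
structure FunNorm (μ : Measure ℝ) where
  rho : (ℝ →ₘ[μ] ℂ) → ℝ≥0∞
  add_le : ∀ f g : ℝ →ₘ[μ] ℂ, rho (f + g) ≤ rho f + rho g
  smul_le : ∀ (c : ℂ) (f : ℝ →ₘ[μ] ℂ), rho (c • f) ≤ ‖c‖ₑ * rho f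
  eq_zero : ∀ f : ℝ →ₘ[μ] ℂ, rho f = 0 → f = 0

namespace FunNorm

variable {μ : Measure ℝ}

theorem rho_zero (N : FunNorm μ) : N.rho 0 = 0 := by
  have h := N.smul_le 0 0
  have h0 : (0 : ℂ) • (0 : ℝ →ₘ[μ] ℂ) = 0 := zero_smul ℂ (0 : ℝ →ₘ[μ] ℂ)
  rw [h0] at h
  simpa using h

/-- The functions of finite norm. -/
def submodule (N : FunNorm μ) : Submodule ℂ (ℝ →ₘ[μ] ℂ) where
  carrier := {f | N.rho f < ∞}
  zero_mem' := by simp [N.rho_zero]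
  add_mem' := fun {f g} hf hg =>
    lt_of_le_of_lt (N.add_le f g) (ENNReal.add_lt_top.2 ⟨hf, hg⟩)
  smul_mem' := fun c f hf =>
    lt_of_le_of_lt (N.smul_le c f) (ENNReal.mul_lt_top enorm_lt_top hf)

/-- The function space of a norm, as a normed space. -/
def Space (N : FunNorm μ) : Type := N.submodule

instance (N : FunNorm μ) : AddCommGroup N.Space :=
  inferInstanceAs (AddCommGroup N.submodule)

instance (N : FunNorm μ) : Module ℂ N.Space :=
  inferInstanceAs (Module ℂ N.submodule)

/-- The a.e. class underlying an element of the space. -/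
def incl (N : FunNorm μ) : N.Space →ₗ[ℂ] (ℝ →ₘ[μ] ℂ) := N.submodule.subtype

theorem incl_injective (N : FunNorm μ) : Function.Injective N.incl :=
  Subtype.val_injective

theorem rho_incl_lt_top (N : FunNorm μ) (f : N.Space) : N.rho (N.incl f) < ∞ := f.2

/-- A function of finite norm as an element of the space. -/
def toSpace (N : FunNorm μ) (f : ℝ →ₘ[μ] ℂ) (hf : N.rho f < ∞) : N.Space := ⟨f, hf⟩

@[simp]
theorem incl_toSpace (N : FunNorm μ) (f : ℝ →ₘ[μ] ℂ) (hf : N.rho f < ∞) :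
    N.incl (N.toSpace f hf) = f := rfl

instance (N : FunNorm μ) : Norm N.Space := ⟨fun f => (N.rho (N.incl f)).toReal⟩

theorem norm_def (N : FunNorm μ) (f : N.Space) : ‖f‖ = (N.rho (N.incl f)).toReal := rfl

theorem norm_smul_le' (N : FunNorm μ) (c : ℂ) (f : N.Space) : ‖c • f‖ ≤ ‖c‖ * ‖f‖ := by
  rw [norm_def, norm_def, map_smul, ← toReal_enorm c, ← ENNReal.toReal_mul]
  exact ENNReal.toReal_mono
    (ENNReal.mul_lt_top enorm_lt_top (N.rho_incl_lt_top f)).ne (N.smul_le c _)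

instance (N : FunNorm μ) : NormedAddCommGroup N.Space :=
  AddGroupNorm.toNormedAddCommGroup
    { toFun := fun f => ‖f‖
      map_zero' := by simp [norm_def, N.rho_zero]
      add_le' := fun f g => by
        rw [norm_def, norm_def, norm_def, map_add, ← ENNReal.toReal_add
          (N.rho_incl_lt_top f).ne (N.rho_incl_lt_top g).ne]
        exact ENNReal.toReal_mono (ENNReal.add_lt_top.2
          ⟨N.rho_incl_lt_top f, N.rho_incl_lt_top g⟩).ne (N.add_le _ _)
      neg' := fun f => by
        have h : ∀ g : N.Space, ‖-g‖ ≤ ‖g‖ := fun g => by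
          simpa using N.norm_smul_le' (-1) g
        exact le_antisymm (h f) (by simpa using h (-f))
      eq_zero_of_map_eq_zero' := fun f hf => by
        have h : N.rho (N.incl f) = 0 :=
          ((ENNReal.toReal_eq_zero_iff _).1 hf).resolve_right (N.rho_incl_lt_top f).ne
        exact N.incl_injective (by rw [N.eq_zero _ h, map_zero]) }

instance (N : FunNorm μ) : NormedSpace ℂ N.Space where
  norm_smul_le := N.norm_smul_le'

end FunNorm

/-- Restriction of a function on the line to `(0, ∞)`. -/
def restr (f : ℝ →ₘ[volume] ℂ) : ℝ →ₘ[volPos] ℂ :=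
  AEEqFun.mk f f.aestronglyMeasurable.restrict

theorem coeFn_restr (f : ℝ →ₘ[volume] ℂ) : restr f =ᵐ[volPos] f := AEEqFun.coeFn_mk _ _

/-- Extension of a function on `(0, ∞)` to the line by zero. -/
def ext0 (f : ℝ →ₘ[volPos] ℂ) : ℝ →ₘ[volume] ℂ :=
  AEEqFun.mk ((Ioi (0 : ℝ)).indicator f)
    ((aestronglyMeasurable_indicator_iff measurableSet_Ioi).2 f.aestronglyMeasurable)

theorem coeFn_ext0 (f : ℝ →ₘ[volPos] ℂ) :
    ext0 f =ᵐ[volume] (Ioi (0 : ℝ)).indicator f := AEEqFun.coeFn_mk _ _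

theorem restr_add (f g : ℝ →ₘ[volume] ℂ) : restr (f + g) = restr f + restr g := by
  apply AEEqFun.ext
  filter_upwards [coeFn_restr (f + g), coeFn_restr f, coeFn_restr g,
    AEEqFun.coeFn_add (restr f) (restr g), ae_restrict_of_ae (AEEqFun.coeFn_add f g)]
    with x h1 h2 h3 h4 h5
  rw [h1, h4, h5]; simp [h2, h3]

theorem restr_smul (c : ℂ) (f : ℝ →ₘ[volume] ℂ) : restr (c • f) = c • restr f := by
  apply AEEqFun.ext
  filter_upwards [coeFn_restr (c • f), coeFn_restr f,
    AEEqFun.coeFn_smul c (restr f), ae_restrict_of_ae (AEEqFun.coeFn_smul c f)]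
    with x h1 h2 h3 h4
  rw [h1, h3, h4]; simp [h2]

theorem ext0_add (f g : ℝ →ₘ[volPos] ℂ) : ext0 (f + g) = ext0 f + ext0 g := by
  apply AEEqFun.ext
  filter_upwards [coeFn_ext0 (f + g), coeFn_ext0 f, coeFn_ext0 g,
    AEEqFun.coeFn_add (ext0 f) (ext0 g),
    (ae_restrict_iff' measurableSet_Ioi).1 (AEEqFun.coeFn_add f g)]
    with x h1 h2 h3 h4 h5
  rw [h1, h4, Pi.add_apply, h2, h3]
  by_cases hx : x ∈ Ioi (0 : ℝ)
  · simp only [indicator_of_mem hx, h5 hx, Pi.add_apply]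
  · simp only [indicator_of_notMem hx, add_zero]

theorem ext0_smul (c : ℂ) (f : ℝ →ₘ[volPos] ℂ) : ext0 (c • f) = c • ext0 f := by
  apply AEEqFun.ext
  filter_upwards [coeFn_ext0 (c • f), coeFn_ext0 f,
    AEEqFun.coeFn_smul c (ext0 f),
    (ae_restrict_iff' measurableSet_Ioi).1 (AEEqFun.coeFn_smul c f)]
    with x h1 h2 h3 h4
  rw [h1, h3, Pi.smul_apply, h2]
  by_cases hx : x ∈ Ioi (0 : ℝ)
  · simp only [indicator_of_mem hx, h4 hx, Pi.smul_apply]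
  · simp only [indicator_of_notMem hx, smul_zero]

/-- A space `X`, given by its norms on `ℝ` and on `ℝ₊`, such that restriction and extension by
zero are contractions. -/
structure SpacePair where
  line : FunNorm volume
  half : FunNorm volPos
  restr_le : ∀ f, half.rho (restr f) ≤ line.rho f
  ext0_le : ∀ f, line.rho (ext0 f) ≤ half.rho f

namespace SpacePair

/-- The restriction operator `r₊ : X(ℝ) → X(ℝ₊)`. -/
def rPlus (X : SpacePair) : X.line.Space →L[ℂ] X.half.Space :=
  LinearMap.mkContinuous
    { toFun := fun f => X.half.toSpace (restr (X.line.incl f))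
        (lt_of_le_of_lt (X.restr_le _) (X.line.rho_incl_lt_top f))
      map_add' := fun f g => X.half.incl_injective (by simp [restr_add])
      map_smul' := fun c f => X.half.incl_injective (by simp [restr_smul]) }
    1 (fun f => by
      rw [one_mul]
      exact ENNReal.toReal_mono (X.line.rho_incl_lt_top f).ne (X.restr_le _))

/-- The operator of extension by zero `ℓ₊ : X(ℝ₊) → X(ℝ)`. -/
def ellPlus (X : SpacePair) : X.half.Space →L[ℂ] X.line.Space :=
  LinearMap.mkContinuous
    { toFun := fun f => X.line.toSpace (ext0 (X.half.incl f))
        (lt_of_le_of_lt (X.ext0_le _) (X.half.rho_incl_lt_top f))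
      map_add' := fun f g => X.line.incl_injective (by simp [ext0_add])
      map_smul' := fun c f => X.line.incl_injective (by simp [ext0_smul]) }
    1 (fun f => by
      rw [one_mul]
      exact ENNReal.toReal_mono (X.half.rho_incl_lt_top f).ne (X.ext0_le _))

end SpacePair

/-! ### Fourier convolution operators and Wiener-Hopf operators -/

theorem memLp_comp_mul {g : ℝ → ℂ} {q : ℝ≥0∞} (hg : MemLp g q volume) {c : ℝ} (hc : c ≠ 0) :
    MemLp (fun x => g (c * x)) q volume := by
  have hm : Measure.map (fun x : ℝ => c * x) volume = ENNReal.ofReal |c⁻¹| • volume :=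
    Real.map_volume_mul_left hc
  have h : MemLp g q (Measure.map (fun x : ℝ => c * x) volume) := by
    rw [hm]; exact hg.smul_measure ENNReal.ofReal_ne_top
  exact h.comp_of_map (measurable_const_mul c).aemeasurable

/-- The Fourier transform `(F f)(ξ) = ∫ f(x) e^{iξx} dx` on `L²(ℝ)`. Mathlib's transform is
`(𝓕 f)(w) = ∫ f(x) e^{-2πiwx} dx`. -/
def fourierL2 (f : Lp ℂ 2 (volume : Measure ℝ)) : Lp ℂ 2 (volume : Measure ℝ) :=
  MemLp.toLp (fun ξ => (𝓕 f : Lp ℂ 2 (volume : Measure ℝ)) (-(2 * Real.pi)⁻¹ * ξ))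
    (memLp_comp_mul (Lp.memLp _) (by simp [Real.pi_ne_zero]))

/-- The inverse Fourier transform `(F⁻¹ g)(x) = (2π)⁻¹ (F g)(-x)` on `L²(ℝ)`. -/
def fourierInvL2 (g : Lp ℂ 2 (volume : Measure ℝ)) : Lp ℂ 2 (volume : Measure ℝ) :=
  MemLp.toLp (fun x => ((2 * Real.pi)⁻¹ : ℂ) * fourierL2 g (-1 * x))
    ((memLp_comp_mul (Lp.memLp _) (by norm_num)).const_mul _)

/-- The product of a bounded function and a function in `L²(ℝ)`. -/
def mulL2 (a : ℝ → ℂ) (ha : MemLp a ∞ volume) (g : Lp ℂ 2 (volume : Measure ℝ)) :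
    Lp ℂ 2 (volume : Measure ℝ) :=
  MemLp.toLp (fun ξ => a ξ * g ξ) ((Lp.memLp g).mul ha)

/-- `T` is a bounded operator on `X(ℝ)` that extends `f ↦ F⁻¹(a · F f)` from `L²(ℝ) ∩ X(ℝ)`. -/
def IsConvolutionExtension (N : FunNorm volume) (a : ℝ → ℂ) (T : N.Space →L[ℂ] N.Space) : Prop :=
  ∃ ha : MemLp a ∞ volume, ∀ (f : N.Space) (hf : MemLp (N.incl f) 2 volume),
    N.incl (T f) = (fourierInvL2 (mulL2 a ha (fourierL2 (hf.toLp _))) : ℝ →ₘ[volume] ℂ)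

/-- `a` is a Fourier multiplier on `X(ℝ)`. -/
def IsFourierMultiplier (N : FunNorm volume) (a : ℝ → ℂ) : Prop :=
  ∃ T : N.Space →L[ℂ] N.Space, IsConvolutionExtension N a T

open Classical in
/-- The Fourier convolution operator `W⁰(a)` on `X(ℝ)`: the bounded extension in the definition of
a Fourier multiplier (there is only one if `L²(ℝ) ∩ X(ℝ)` is dense in `X(ℝ)`); by convention `0`
if `a` is not a Fourier multiplier. -/
def W0 (N : FunNorm volume) (a : ℝ → ℂ) : N.Space →L[ℂ] N.Space :=
  if h : IsFourierMultiplier N a then h.choose else 0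

/-- The Wiener-Hopf operator `W(a) = r₊ W⁰(a) ℓ₊` on `X(ℝ₊)`. -/
def W (X : SpacePair) (a : ℝ → ℂ) : X.half.Space →L[ℂ] X.half.Space :=
  X.rPlus ∘L W0 X.line a ∘L X.ellPlus

/-- The rational function `r_n(ξ) = ((ξ - i) / (ξ + i))^n`. -/
def r (n : ℤ) (ξ : ℝ) : ℂ := (((ξ : ℂ) - Complex.I) / ((ξ : ℂ) + Complex.I)) ^ n

/-- The functions `ψ_k = W(r_k) ψ_0`, `k ≥ 1`, obtained from `ψ_0`. -/
def psi (X : SpacePair) (psi0 : X.half.Space) : ℕ → X.half.Space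
  | 0 => psi0
  | k + 1 => W X (r ((k : ℤ) + 1)) psi0

/-! ### Lorentz spaces -/

/-- The distribution function `λ ↦ |{x : |f(x)| > λ}|`. -/
def distr (μ : Measure ℝ) (f : ℝ → ℂ) (l : ℝ≥0) : ℝ≥0∞ := μ {x | l < ‖f x‖₊}

/-- The non-increasing rearrangement `f*(t) = inf {λ ≥ 0 : μ_f(λ) ≤ t}`, with `inf ∅ = ∞`. -/
def rearr (μ : Measure ℝ) (f : ℝ → ℂ) (t : ℝ) : ℝ≥0∞ :=
  ⨅ (l : ℝ≥0) (_ : distr μ f l ≤ ENNReal.ofReal t), (l : ℝ≥0∞)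

/-- The maximal function `f**(t) = (1/t) ∫₀ᵗ f*(s) ds`. -/
def rearrAvg (μ : Measure ℝ) (f : ℝ → ℂ) (t : ℝ) : ℝ≥0∞ :=
  (ENNReal.ofReal t)⁻¹ * ∫⁻ s in Ioo 0 t, rearr μ f s

/-- The Lorentz norm `(∫₀^∞ (t^{1/p} f**(t))^q dt/t)^{1/q}`. -/
def lorentzRho (μ : Measure ℝ) (p q : ℝ) (f : ℝ → ℂ) : ℝ≥0∞ :=
  (∫⁻ t in Ioi (0 : ℝ),
    (ENNReal.ofReal (t ^ (1 / p)) * rearrAvg μ f t) ^ q * (ENNReal.ofReal t)⁻¹) ^ (1 / q)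

theorem distr_congr {μ : Measure ℝ} {f g : ℝ → ℂ} (h : f =ᵐ[μ] g) : distr μ f = distr μ g := by
  funext l
  apply measure_congr
  filter_upwards [h] with x hx
  exact propext (by change (l < ‖f x‖₊) ↔ (l < ‖g x‖₊); rw [hx])

theorem lorentzRho_mono {μ ν : Measure ℝ} {p q : ℝ} (hq : 0 ≤ q) {f g : ℝ → ℂ}
    (h : ∀ l, distr μ f l ≤ distr ν g l) : lorentzRho μ p q f ≤ lorentzRho ν p q g := by
  unfold lorentzRho rearrAvg
  have h1 : ∀ t, rearr μ f t ≤ rearr ν g t := fun t =>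
    le_iInf₂ fun l hl => iInf₂_le l ((h l).trans hl)
  have h2 : (0 : ℝ) ≤ 1 / q := by positivity
  gcongr
  exact h1 _

theorem rearr_antitone (μ : Measure ℝ) (f : ℝ → ℂ) : Antitone (rearr μ f) := fun _ _ hst =>
  le_iInf₂ fun l hl => iInf₂_le l (hl.trans (ENNReal.ofReal_le_ofReal hst))

theorem distr_antitone (μ : Measure ℝ) (f : ℝ → ℂ) : Antitone (distr μ f) := fun _ _ hst =>
  measure_mono fun _ hx => lt_of_le_of_lt hst hx

theorem distr_toNNReal_antitone (μ : Measure ℝ) (f : ℝ → ℂ) :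
    Antitone (fun l : ℝ => distr μ f l.toNNReal) := fun _ _ hst =>
  distr_antitone μ f (Real.toNNReal_le_toNNReal hst)

theorem volume_lt (R : ℝ≥0∞) : volume {l : ℝ | 0 < l ∧ ENNReal.ofReal l < R} = R := by
  induction R with
  | top => 
    have : {l : ℝ | 0 < l ∧ ENNReal.ofReal l < ∞} = Ioi 0 := by ext; simp
    rw [this, Real.volume_Ioi]
  | coe R =>
    have : {l : ℝ | 0 < l ∧ ENNReal.ofReal l < R} = Ioo 0 (R : ℝ) := by
      ext l
      simp only [mem_ofPred_eq, mem_Ioo, and_congr_right_iff]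
      intro hl
      rw [ENNReal.ofReal, ENNReal.coe_lt_coe, Real.toNNReal_lt_iff_lt_coe hl.le]
    rw [this, Real.volume_Ioo]; simp

theorem volume_le (R : ℝ≥0∞) : volume {l : ℝ | 0 < l ∧ ENNReal.ofReal l ≤ R} = R := by
  induction R with
  | top => 
    have : {l : ℝ | 0 < l ∧ ENNReal.ofReal l ≤ ∞} = Ioi 0 := by ext; simp
    rw [this, Real.volume_Ioi]
  | coe R =>
    have : {l : ℝ | 0 < l ∧ ENNReal.ofReal l ≤ R} = Ioc 0 (R : ℝ) := by
      ext l
      simp only [mem_ofPred_eq, mem_Ioc, and_congr_right_iff]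
      intro hl
      rw [ENNReal.ofReal, ENNReal.coe_le_coe, Real.toNNReal_le_iff_le_coe]
    rw [this, Real.volume_Ioc]; simp

theorem rearr_le {μ : Measure ℝ} {f : ℝ → ℂ} {t : ℝ} (l : ℝ≥0)
    (h : distr μ f l ≤ ENNReal.ofReal t) : rearr μ f t ≤ l :=
  iInf₂_le (f := fun (l : ℝ≥0) (_ : distr μ f l ≤ ENNReal.ofReal t) => (l : ℝ≥0∞)) l h

theorem rearr_eq_volume (μ : Measure ℝ) (f : ℝ → ℂ) (s : ℝ) :
    rearr μ f s = volume {l : ℝ | 0 < l ∧ ENNReal.ofReal s < distr μ f l.toNNReal} := by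
  apply le_antisymm
  · conv_lhs => rw [← volume_lt (rearr μ f s)]
    refine measure_mono fun l hl => ⟨hl.1, ?_⟩
    by_contra hcon
    exact absurd (rearr_le l.toNNReal (not_lt.1 hcon)) (not_le.2 hl.2)
  · conv_rhs => rw [← volume_le (rearr μ f s)]
    refine measure_mono fun l hl => ⟨hl.1, le_iInf₂ fun l' hl' => ?_⟩
    by_contra hcon
    have h1 : l' ≤ l.toNNReal := ENNReal.coe_le_coe.1 (not_le.1 hcon).le
    exact absurd (hl.2.trans_le (distr_antitone μ f h1)) (not_lt.2 hl')

theorem lintegral_rearr (μ : Measure ℝ) (f : ℝ → ℂ) (t : ℝ) :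
    ∫⁻ s in Ioo 0 t, rearr μ f s =
      ∫⁻ l in Ioi (0 : ℝ), min (distr μ f l.toNNReal) (ENNReal.ofReal t) := by
  have hD : Measurable (fun l : ℝ => distr μ f l.toNNReal) :=
    (distr_toNNReal_antitone μ f).measurable
  have h1 : ∀ s, rearr μ f s = ∫⁻ l in Ioi (0 : ℝ),
      {z : ℝ × ℝ | ENNReal.ofReal z.1 < distr μ f z.2.toNNReal}.indicator 1 (s, l) := by
    intro s
    rw [rearr_eq_volume]
    have hm : MeasurableSet {l : ℝ | ENNReal.ofReal s < distr μ f l.toNNReal} :=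
      measurableSet_lt measurable_const hD
    have : (fun l : ℝ => {z : ℝ × ℝ | ENNReal.ofReal z.1 < distr μ f z.2.toNNReal}.indicator
        (1 : ℝ × ℝ → ℝ≥0∞) (s, l)) =
        {l : ℝ | ENNReal.ofReal s < distr μ f l.toNNReal}.indicator 1 := rfl
    rw [this, lintegral_indicator_one hm, Measure.restrict_apply hm, inter_comm]
    rfl
  have hmz : MeasurableSet {z : ℝ × ℝ | ENNReal.ofReal z.1 < distr μ f z.2.toNNReal} :=
    measurableSet_lt (ENNReal.measurable_ofReal.comp measurable_fst) (hD.comp measurable_snd)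
  simp_rw [h1]
  rw [lintegral_lintegral_swap (f := fun s l =>
    {z : ℝ × ℝ | ENNReal.ofReal z.1 < distr μ f z.2.toNNReal}.indicator (1 : ℝ × ℝ → ℝ≥0∞) (s, l))
    (measurable_one.indicator hmz).aemeasurable]
  refine lintegral_congr fun l => ?_
  have hm : MeasurableSet {s : ℝ | ENNReal.ofReal s < distr μ f l.toNNReal} :=
    measurableSet_lt ENNReal.measurable_ofReal measurable_const
  have : (fun s : ℝ => {z : ℝ × ℝ | ENNReal.ofReal z.1 < distr μ f z.2.toNNReal}.indicator
      (1 : ℝ × ℝ → ℝ≥0∞) (s, l)) =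
      {s : ℝ | ENNReal.ofReal s < distr μ f l.toNNReal}.indicator 1 := rfl
  rw [this, lintegral_indicator_one hm, Measure.restrict_apply hm]
  conv_rhs => rw [← volume_lt (min (distr μ f l.toNNReal) (ENNReal.ofReal t))]
  congr 1
  ext s
  simp only [mem_inter_iff, mem_ofPred_eq, mem_Ioo, lt_min_iff]
  constructor
  · rintro ⟨h, h0, ht⟩
    exact ⟨h0, h, (ENNReal.ofReal_lt_ofReal_iff (h0.trans ht)).2 ht⟩
  · rintro ⟨h0, h, ht⟩
    exact ⟨h, h0, (ENNReal.ofReal_lt_ofReal_iff_of_nonneg h0.le).1 ht⟩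

theorem lintegral_excess {μ : Measure ℝ} {f : ℝ → ℂ} (hf : AEStronglyMeasurable f μ) (l0 : ℝ≥0) :
    ∫⁻ x, ENNReal.ofReal (‖f x‖ - l0) ∂μ = ∫⁻ l in Ioi (l0 : ℝ), distr μ f l.toNNReal := by
  have h1 : ∫⁻ x, ENNReal.ofReal (‖f x‖ - l0) ∂μ = ∫⁻ x, ENNReal.ofReal (max (‖f x‖ - l0) 0) ∂μ :=
    lintegral_congr fun x => by rw [ENNReal.ofReal_max]; simp
  rw [h1, lintegral_eq_lintegral_meas_lt (f := fun x => max (‖f x‖ - l0) 0) μ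
    (ae_of_all _ fun x => le_max_right _ _)
    ((hf.norm.aemeasurable.sub aemeasurable_const).max aemeasurable_const)]
  rw [← lintegral_indicator measurableSet_Ioi, ← lintegral_indicator measurableSet_Ioi,
    ← lintegral_add_right_eq_self ((Ioi (l0 : ℝ)).indicator _) (l0 : ℝ)]
  refine lintegral_congr fun t => ?_
  by_cases ht : 0 < t
  · rw [indicator_of_mem (show t ∈ Ioi (0 : ℝ) from ht),
      indicator_of_mem (show t + l0 ∈ Ioi (l0 : ℝ) by simpa using ht)]
    unfold distr
    congr 1
    ext x
    have h2 : 0 ≤ t + l0 := by positivity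
    simp only [mem_ofPred_eq, lt_max_iff]
    rw [Real.toNNReal_lt_iff_lt_coe h2, coe_nnnorm]
    constructor
    · rintro (h | h) <;> linarith
    · intro h; left; linarith
  · rw [indicator_of_notMem (by simpa using ht), indicator_of_notMem (by simpa using ht)]

theorem lintegral_rearr_le {μ : Measure ℝ} {f : ℝ → ℂ} (hf : AEStronglyMeasurable f μ)
    (t : ℝ) (l0 : ℝ≥0) :
    ∫⁻ s in Ioo 0 t, rearr μ f s ≤
      ENNReal.ofReal t * l0 + ∫⁻ x, ENNReal.ofReal (‖f x‖ - l0) ∂μ := by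
  rw [lintegral_rearr, lintegral_excess hf, ← Ioc_union_Ioi_eq_Ioi l0.coe_nonneg,
    lintegral_union measurableSet_Ioi (by
      rw [Set.disjoint_left]; exact fun x hx hx' => absurd hx.2 (not_le.2 hx'))]
  refine add_le_add ?_ (lintegral_mono fun l => min_le_left _ _)
  refine (lintegral_mono fun l => min_le_right _ _).trans ?_
  rw [setLIntegral_const, Real.volume_Ioc]
  exact le_of_eq (by congr 1; simp)

theorem lintegral_rearr_eq {μ : Measure ℝ} {f : ℝ → ℂ} (hf : AEStronglyMeasurable f μ)
    {t : ℝ} {l0 : ℝ≥0} (h : rearr μ f t = l0) :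
    ENNReal.ofReal t * l0 + ∫⁻ x, ENNReal.ofReal (‖f x‖ - l0) ∂μ ≤
      ∫⁻ s in Ioo 0 t, rearr μ f s := by
  rw [lintegral_rearr, lintegral_excess hf, ← Ioc_union_Ioi_eq_Ioi l0.coe_nonneg,
    lintegral_union measurableSet_Ioi (by
      rw [Set.disjoint_left]; exact fun x hx hx' => absurd hx.2 (not_le.2 hx'))]
  refine add_le_add ?_ ?_
  · have h1 : ENNReal.ofReal t * l0 = ∫⁻ _ in Ioo (0 : ℝ) l0, ENNReal.ofReal t := by
      rw [setLIntegral_const, Real.volume_Ioo]; congr 1; simp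
    rw [h1]
    refine (setLIntegral_mono' measurableSet_Ioo fun l hl => ?_).trans
      (lintegral_mono_set Ioo_subset_Ioc_self)
    refine le_min ?_ le_rfl
    by_contra hcon
    have h2 : rearr μ f t ≤ l.toNNReal := rearr_le _ (not_le.1 hcon).le
    rw [h, ENNReal.coe_le_coe, Real.le_toNNReal_iff_coe_le hl.1.le] at h2
    exact absurd hl.2 (not_lt.2 h2)
  · refine setLIntegral_mono' measurableSet_Ioi fun l hl => le_min le_rfl ?_
    have h2 : rearr μ f t < (l.toNNReal : ℝ≥0∞) := by
      rw [h, ENNReal.coe_lt_coe]; exact Real.lt_toNNReal_iff_coe_lt.2 hl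
    obtain ⟨l', hl', h3⟩ : ∃ l' : ℝ≥0, distr μ f l' ≤ ENNReal.ofReal t ∧ l' < l.toNNReal := by
      simp only [rearr, iInf_lt_iff] at h2
      obtain ⟨l', hl', h3⟩ := h2
      exact ⟨l', hl', by exact_mod_cast h3⟩
    exact (distr_antitone μ f h3.le).trans hl'

theorem lintegral_rearr_add {μ : Measure ℝ} {f g : ℝ → ℂ} (hf : AEStronglyMeasurable f μ)
    (hg : AEStronglyMeasurable g μ) {t : ℝ} (ht : 0 < t) :
    ∫⁻ s in Ioo 0 t, rearr μ (f + g) s ≤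
      (∫⁻ s in Ioo 0 t, rearr μ f s) + ∫⁻ s in Ioo 0 t, rearr μ g s := by
  have htop : ∀ h : ℝ → ℂ, rearr μ h t = ∞ → ∫⁻ s in Ioo 0 t, rearr μ h s = ∞ := by
    intro h hh
    rw [eq_top_iff]
    calc ∞ = ∫⁻ _ in Ioo 0 t, ∞ := by
          rw [setLIntegral_const, Real.volume_Ioo, ENNReal.top_mul]; simpa using ht
      _ ≤ _ := setLIntegral_mono' measurableSet_Ioo fun s hs =>
          hh ▸ rearr_antitone μ h hs.2.le
  by_cases h1 : rearr μ f t = ∞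
  · rw [htop f h1, top_add]; exact le_top
  by_cases h2 : rearr μ g t = ∞
  · rw [htop g h2, add_top]; exact le_top
  lift rearr μ f t to ℝ≥0 using h1 with l1 hl1
  lift rearr μ g t to ℝ≥0 using h2 with l2 hl2
  refine (lintegral_rearr_le (hf.add hg) t (l1 + l2)).trans
    (le_trans ?_ (add_le_add (lintegral_rearr_eq hf hl1.symm) (lintegral_rearr_eq hg hl2.symm)))
  have h3 : ∫⁻ x, ENNReal.ofReal (‖(f + g) x‖ - (l1 + l2 : ℝ≥0)) ∂μ ≤
      (∫⁻ x, ENNReal.ofReal (‖f x‖ - l1) ∂μ) + ∫⁻ x, ENNReal.ofReal (‖g x‖ - l2) ∂μ := by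
    have hm : AEMeasurable (fun x => ENNReal.ofReal (‖f x‖ - l1)) μ :=
      (hf.norm.aemeasurable.sub aemeasurable_const).ennreal_ofReal
    rw [← lintegral_add_left' hm]
    refine lintegral_mono fun x => ?_
    refine (ENNReal.ofReal_le_ofReal ?_).trans ENNReal.ofReal_add_le
    have := norm_add_le (f x) (g x)
    push_cast
    simp only [Pi.add_apply]
    linarith
  calc _ ≤ ENNReal.ofReal t * (l1 + l2 : ℝ≥0) + ((∫⁻ x, ENNReal.ofReal (‖f x‖ - l1) ∂μ) +
        ∫⁻ x, ENNReal.ofReal (‖g x‖ - l2) ∂μ) := add_le_add le_rfl h3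
    _ = _ := by push_cast; ring

theorem measurable_rearrAvg (μ : Measure ℝ) (f : ℝ → ℂ) : Measurable (rearrAvg μ f) := by
  have h : Monotone fun t : ℝ => ∫⁻ s in Ioo 0 t, rearr μ f s := fun _ _ hst =>
    lintegral_mono_set (Ioo_subset_Ioo_right hst)
  exact ENNReal.measurable_ofReal.inv.mul h.measurable

theorem lorentzRho_add {μ : Measure ℝ} {p q : ℝ} (hq : 1 ≤ q) {f g : ℝ → ℂ}
    (hf : AEStronglyMeasurable f μ) (hg : AEStronglyMeasurable g μ) :
    lorentzRho μ p q (f + g) ≤ lorentzRho μ p q f + lorentzRho μ p q g := by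
  have hq0 : (0 : ℝ) ≤ q := by linarith
  have hq1 : (0 : ℝ) ≤ 1 / q := by positivity
  set ν : Measure ℝ := (volume.restrict (Ioi (0 : ℝ))).withDensity fun t => (ENNReal.ofReal t)⁻¹
  have hT : ∀ h : ℝ → ℂ, Measurable fun t : ℝ =>
      ENNReal.ofReal (t ^ (1 / p)) * rearrAvg μ h t := fun h =>
    ((measurable_id.pow_const _).ennreal_ofReal).mul (measurable_rearrAvg μ h)
  have key : ∀ h : ℝ → ℂ, lorentzRho μ p q h =
      (∫⁻ t, (ENNReal.ofReal (t ^ (1 / p)) * rearrAvg μ h t) ^ q ∂ν) ^ (1 / q) := by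
    intro h
    have hd : Measurable fun t : ℝ => (ENNReal.ofReal t)⁻¹ := ENNReal.measurable_ofReal.inv
    rw [lintegral_withDensity_eq_lintegral_mul _ hd ((hT h).pow_const q)]
    simp only [lorentzRho, Pi.mul_apply, mul_comm]
  rw [key, key, key]
  refine le_trans ?_ (ENNReal.lintegral_Lp_add_le (hT f).aemeasurable (hT g).aemeasurable hq)
  have hae : ∀ᵐ t ∂ν, 0 < t :=
    (withDensity_absolutelyContinuous _ _).ae_le (ae_restrict_mem measurableSet_Ioi)
  refine ENNReal.rpow_le_rpow (lintegral_mono_ae ?_) hq1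
  filter_upwards [hae] with t ht
  refine ENNReal.rpow_le_rpow ?_ hq0
  simp only [Pi.add_apply, rearrAvg, ← mul_add]
  gcongr
  exact lintegral_rearr_add hf hg ht

theorem rearr_smul_le (μ : Measure ℝ) (c : ℂ) (f : ℝ → ℂ) (t : ℝ) :
    rearr μ (c • f) t ≤ ‖c‖ₑ * rearr μ f t := by
  by_cases hc : c = 0
  · refine le_trans (iInf₂_le 0 ?_) bot_le
    simp [distr, hc]
  · have hc' : ‖c‖ₑ ≠ 0 := by simpa using hc
    rw [rearr, rearr, ENNReal.mul_iInf_of_ne hc' enorm_ne_top]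
    refine le_iInf fun l => ?_
    rw [ENNReal.mul_iInf_of_ne hc' enorm_ne_top]
    refine le_iInf fun hl => ?_
    refine (iInf₂_le (f := fun (l : ℝ≥0) (_ : distr μ (c • f) l ≤ ENNReal.ofReal t) => (l : ℝ≥0∞))
      (‖c‖₊ * l) (le_trans (measure_mono fun x hx => ?_) hl)).trans ?_
    · simp only [mem_ofPred_eq, Pi.smul_apply, nnnorm_smul] at hx ⊢
      exact lt_of_mul_lt_mul_left' hx
    · simp [enorm_eq_nnnorm]

theorem lorentzRho_smul {μ : Measure ℝ} {p q : ℝ} (hq : 1 ≤ q) (c : ℂ) (f : ℝ → ℂ) :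
    lorentzRho μ p q (c • f) ≤ ‖c‖ₑ * lorentzRho μ p q f := by
  have hq0 : (0 : ℝ) < q := by linarith
  have hq1 : (0 : ℝ) ≤ 1 / q := by positivity
  have h1 : ∀ t, rearrAvg μ (c • f) t ≤ ‖c‖ₑ * rearrAvg μ f t := by
    intro t
    unfold rearrAvg
    rw [mul_left_comm, ← lintegral_const_mul' _ _ enorm_ne_top]
    gcongr
    exact rearr_smul_le μ c f _
  have h2 : ‖c‖ₑ = (‖c‖ₑ ^ q) ^ (1 / q) := by
    rw [← ENNReal.rpow_mul, mul_one_div_cancel hq0.ne', ENNReal.rpow_one]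
  unfold lorentzRho
  conv_rhs => rw [h2]
  rw [← ENNReal.mul_rpow_of_nonneg _ _ hq1, ← lintegral_const_mul' _ _
    (ENNReal.rpow_ne_top_of_nonneg hq0.le enorm_ne_top)]
  refine ENNReal.rpow_le_rpow (lintegral_mono fun t => ?_) hq1
  rw [← mul_assoc, ← ENNReal.mul_rpow_of_nonneg _ _ hq0.le, mul_left_comm]
  gcongr
  exact h1 t

theorem lorentzRho_eq_zero {μ : Measure ℝ} {p q : ℝ} (hq : 1 ≤ q) {f : ℝ → ℂ}
    (h : lorentzRho μ p q f = 0) : f =ᵐ[μ] 0 := by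
  have hq0 : (0 : ℝ) < q := by linarith
  have hm : Measurable fun t : ℝ =>
      (ENNReal.ofReal (t ^ (1 / p)) * rearrAvg μ f t) ^ q * (ENNReal.ofReal t)⁻¹ :=
    ((((measurable_id.pow_const _).ennreal_ofReal).mul (measurable_rearrAvg μ f)).pow_const
      q).mul ENNReal.measurable_ofReal.inv
  rw [lorentzRho, ENNReal.rpow_eq_zero_iff_of_pos (by positivity), lintegral_eq_zero_iff hm] at h
  have hne : (ae (volume.restrict (Ioi (0 : ℝ)))).NeBot := by
    rw [ae_neBot, Ne, Measure.restrict_eq_zero, Real.volume_Ioi]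
    exact ENNReal.top_ne_zero
  obtain ⟨t, ht, ht0⟩ := (h.and (ae_restrict_mem measurableSet_Ioi)).exists
  have ht0' : 0 < t := ht0
  have h1 : rearrAvg μ f t = 0 := by
    simp only [Pi.zero_apply, mul_eq_zero, ENNReal.inv_eq_zero, ENNReal.ofReal_ne_top, or_false,
      ENNReal.rpow_eq_zero_iff_of_pos hq0, ENNReal.ofReal_eq_zero] at ht
    exact ht.resolve_left (not_le.2 (Real.rpow_pos_of_pos ht0' _))
  rw [rearrAvg, mul_eq_zero, ENNReal.inv_eq_zero, or_iff_right ENNReal.ofReal_ne_top,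
    lintegral_rearr, lintegral_eq_zero_iff
      ((distr_toNNReal_antitone μ f).measurable.min measurable_const)] at h1
  have h2 : ∀ᵐ l : ℝ ∂(volume.restrict (Ioi (0 : ℝ))), distr μ f l.toNNReal = 0 := by
    filter_upwards [h1] with l hl
    rcases min_eq_iff.1 hl with h3 | h3
    · exact h3.1
    · exact absurd h3.1 (by simpa using ht0')
  have h3 : ∀ k : ℕ, distr μ f (((k : ℝ≥0) + 1)⁻¹) = 0 := by
    intro k
    have hk : (0 : ℝ) < ((k : ℝ) + 1)⁻¹ := by positivity
    have h4 : ∀ᵐ l : ℝ ∂(volume.restrict (Ioo (0 : ℝ) ((k : ℝ) + 1)⁻¹)),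
        distr μ f l.toNNReal = 0 := ae_restrict_of_ae_restrict_of_subset Ioo_subset_Ioi_self h2
    have : (ae (volume.restrict (Ioo (0 : ℝ) ((k : ℝ) + 1)⁻¹))).NeBot := by
      rw [ae_neBot, Ne, Measure.restrict_eq_zero, Real.volume_Ioo]
      simpa using hk
    obtain ⟨l, hl, hl'⟩ := (h4.and (ae_restrict_mem measurableSet_Ioo)).exists
    refine le_antisymm (le_trans (distr_antitone μ f ?_) hl.le) bot_le
    rw [Real.toNNReal_le_iff_le_coe]
    push_cast
    exact hl'.2.le
  have h5 : ∀ᵐ x ∂μ, ∀ k : ℕ, ¬ (((k : ℝ≥0) + 1)⁻¹ < ‖f x‖₊) :=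
    ae_all_iff.2 fun k => by
      rw [ae_iff]; simp only [not_not]; exact h3 k
  filter_upwards [h5] with x hx
  by_contra hne
  have hpos : 0 < ‖f x‖ := norm_pos_iff.2 hne
  obtain ⟨k, hk⟩ := exists_nat_one_div_lt hpos
  refine hx k ?_
  rw [← NNReal.coe_lt_coe]
  push_cast
  rw [one_div] at hk
  exact hk

/-- The Lorentz norm on the measure space `(ℝ, μ)`. -/
def lorentzNorm (μ : Measure ℝ) (p q : ℝ) (hq : 1 < q) : FunNorm μ where
  rho f := lorentzRho μ p q f
  add_le f g := by
    refine le_trans (lorentzRho_mono (by linarith) fun l => ?_)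
      (lorentzRho_add hq.le f.aestronglyMeasurable g.aestronglyMeasurable)
    rw [distr_congr (AEEqFun.coeFn_add f g)]
  smul_le c f := by
    refine le_trans (lorentzRho_mono (by linarith) fun l => ?_) (lorentzRho_smul hq.le c f)
    rw [distr_congr (AEEqFun.coeFn_smul c f)]
  eq_zero f hf := AEEqFun.ext ((lorentzRho_eq_zero hq.le hf).trans AEEqFun.coeFn_zero.symm)

theorem distr_restr_le (f : ℝ →ₘ[volume] ℂ) (l : ℝ≥0) :
    distr volPos (restr f) l ≤ distr volume f l := by
  rw [distr_congr (coeFn_restr f)]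
  exact Measure.restrict_apply_le _ _

theorem distr_ext0_le (f : ℝ →ₘ[volPos] ℂ) (l : ℝ≥0) :
    distr volume (ext0 f) l ≤ distr volPos f l := by
  rw [distr_congr (coeFn_ext0 f), distr, distr,
    Measure.restrict_apply' measurableSet_Ioi]
  refine measure_mono fun x hx => ?_
  by_cases h : x ∈ Ioi (0 : ℝ)
  · exact ⟨by simpa [indicator_of_mem h] using hx, h⟩
  · simp [indicator_of_notMem h] at hx

/-- The Lorentz space `L^{p,q}`. -/
def lorentz (p q : ℝ) (hq : 1 < q) : SpacePair where
  line := lorentzNorm volume p q hq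
  half := lorentzNorm volPos p q hq
  restr_le f := lorentzRho_mono (by linarith) (distr_restr_le f)
  ext0_le f := lorentzRho_mono (by linarith) (distr_ext0_le f)

/-! ### Luxemburg norms -/

/-- The conditions on `M(x, t)` under which the Luxemburg functional is a norm. -/
structure IsModular (μ : Measure ℝ) (M : ℝ → ℝ≥0∞ → ℝ≥0∞) : Prop where
  meas : ∀ g : ℝ → ℝ≥0∞, AEMeasurable g μ → AEMeasurable (fun x => M x (g x)) μ
  mono : ∀ᵐ x ∂μ, Monotone (M x)
  zero : ∀ᵐ x ∂μ, M x 0 = 0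
  convex : ∀ᵐ x ∂μ, ∀ a b s t : ℝ≥0∞, a + b = 1 → M x (a * s + b * t) ≤ a * M x s + b * M x t
  pos : ∀ᵐ x ∂μ, ∀ t : ℝ≥0∞, t ≠ 0 → ∃ k : ℕ, M x (k * t) ≠ 0

/-- The Luxemburg functional `inf {λ > 0 : ∫ M(x, g(x)/λ) dμ(x) ≤ 1}`. -/
def luxemburg (μ : Measure ℝ) (M : ℝ → ℝ≥0∞ → ℝ≥0∞) (g : ℝ → ℝ≥0∞) : ℝ≥0∞ :=
  ⨅ (l : ℝ≥0) (_ : 0 < l ∧ ∫⁻ x, M x (g x / l) ∂μ ≤ 1), (l : ℝ≥0∞)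

theorem luxemburg_le {μ : Measure ℝ} {M : ℝ → ℝ≥0∞ → ℝ≥0∞} {g : ℝ → ℝ≥0∞} (l : ℝ≥0)
    (hl : 0 < l) (h : ∫⁻ x, M x (g x / l) ∂μ ≤ 1) : luxemburg μ M g ≤ l :=
  iInf₂_le (f := fun (l : ℝ≥0) (_ : 0 < l ∧ ∫⁻ x, M x (g x / l) ∂μ ≤ 1) => (l : ℝ≥0∞)) l ⟨hl, h⟩

theorem luxemburg_mono {μ ν : Measure ℝ} {M : ℝ → ℝ≥0∞ → ℝ≥0∞} {g h : ℝ → ℝ≥0∞}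
    (H : ∀ l : ℝ≥0, 0 < l → ∫⁻ x, M x (g x / l) ∂μ ≤ ∫⁻ x, M x (h x / l) ∂ν) :
    luxemburg μ M g ≤ luxemburg ν M h :=
  le_iInf₂ fun l hl => luxemburg_le l hl.1 ((H l hl.1).trans hl.2)

namespace IsModular

variable {μ : Measure ℝ} {M : ℝ → ℝ≥0∞ → ℝ≥0∞}

theorem lintegral_div_le (hM : IsModular μ M) (g : ℝ → ℝ≥0∞) {m : ℕ} (hm : m ≠ 0) :
    ∫⁻ x, M x ((m : ℝ≥0∞)⁻¹ * g x) ∂μ ≤ (m : ℝ≥0∞)⁻¹ * ∫⁻ x, M x (g x) ∂μ := by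
  have hm' : (m : ℝ≥0∞)⁻¹ ≠ ∞ := by simpa using hm
  have h1 : (m : ℝ≥0∞)⁻¹ ≤ 1 := by
    rw [ENNReal.inv_le_one]; exact_mod_cast Nat.one_le_iff_ne_zero.2 hm
  rw [← lintegral_const_mul' _ _ hm']
  refine lintegral_mono_ae ?_
  filter_upwards [hM.zero, hM.convex] with x hx hx'
  have := hx' (m : ℝ≥0∞)⁻¹ (1 - (m : ℝ≥0∞)⁻¹) (g x) 0 (add_tsub_cancel_of_le h1)
  simpa [hx] using this

/-- The functions of finite Luxemburg norm are those with `∫ M(x, g(x)/λ) dμ(x) < ∞` for some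
`λ > 0`. -/
theorem luxemburg_lt_top_iff (hM : IsModular μ M) (g : ℝ → ℝ≥0∞) :
    luxemburg μ M g < ∞ ↔ ∃ l : ℝ≥0, 0 < l ∧ ∫⁻ x, M x (g x / l) ∂μ < ∞ := by
  constructor
  · intro h
    simp only [luxemburg, iInf_lt_iff] at h
    obtain ⟨l, hl, _⟩ := h
    exact ⟨l, hl.1, hl.2.trans_lt ENNReal.one_lt_top⟩
  · rintro ⟨l, hl, h⟩
    obtain ⟨m, hm⟩ := ENNReal.exists_nat_gt h.ne
    have hm0 : m ≠ 0 := by rintro rfl; simp at hm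
    have hm0' : (m : ℝ≥0∞) ≠ 0 := by exact_mod_cast hm0
    refine lt_of_le_of_lt (luxemburg_le (m * l) (by positivity) ?_)
      (ENNReal.coe_lt_top (r := m * l))
    have h1 : ∀ x, g x / ((m * l : ℝ≥0) : ℝ≥0∞) = (m : ℝ≥0∞)⁻¹ * (g x / l) := by
      intro x
      rw [ENNReal.coe_mul, ENNReal.coe_natCast, ENNReal.div_eq_inv_mul, ENNReal.div_eq_inv_mul,
        ENNReal.mul_inv (Or.inl hm0') (Or.inl (ENNReal.natCast_ne_top m)), mul_assoc]
    simp_rw [h1]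
    refine (hM.lintegral_div_le _ hm0).trans ?_
    calc (m : ℝ≥0∞)⁻¹ * ∫⁻ x, M x (g x / l) ∂μ ≤ (m : ℝ≥0∞)⁻¹ * m := by gcongr
      _ = 1 := ENNReal.inv_mul_cancel hm0' (ENNReal.natCast_ne_top m)

theorem luxemburg_zero (hM : IsModular μ M) : luxemburg μ M 0 = 0 := by
  refine le_antisymm (le_of_forall_gt fun c hc => ?_) bot_le
  obtain ⟨l, hl, hl'⟩ := ENNReal.lt_iff_exists_nnreal_btwn.1 hc
  refine lt_of_le_of_lt (luxemburg_le l (by exact_mod_cast hl) ?_) hl'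
  have : ∫⁻ x, M x ((0 : ℝ → ℝ≥0∞) x / l) ∂μ = 0 := by
    rw [← lintegral_zero (μ := μ)]
    refine lintegral_congr_ae ?_
    filter_upwards [hM.zero] with x hx
    simpa using hx
  rw [this]; exact zero_le_one

theorem luxemburg_add (hM : IsModular μ M) {g h : ℝ → ℝ≥0∞} (hg : AEMeasurable g μ) :
    luxemburg μ M (g + h) ≤ luxemburg μ M g + luxemburg μ M h := by
  conv_rhs => rw [luxemburg, luxemburg]
  simp_rw [ENNReal.iInf_add, ENNReal.add_iInf]
  refine le_iInf₂ fun l1 hl1 => le_iInf₂ fun l2 hl2 => ?_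
  obtain ⟨h1, h1'⟩ := hl1
  obtain ⟨h2, h2'⟩ := hl2
  have h1e : (l1 : ℝ≥0∞) ≠ 0 := by exact_mod_cast h1.ne'
  have h2e : (l2 : ℝ≥0∞) ≠ 0 := by exact_mod_cast h2.ne'
  have h3e : (l1 + l2 : ℝ≥0∞) ≠ 0 := by simp [h1e]
  have h3t : (l1 + l2 : ℝ≥0∞) ≠ ∞ := by simp
  set a : ℝ≥0∞ := l1 / (l1 + l2) with ha
  set b : ℝ≥0∞ := l2 / (l1 + l2) with hb
  have hab : a + b = 1 := by
    rw [ha, hb, ← ENNReal.add_div, ENNReal.div_self h3e h3t]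
  have ha' : a ≠ ∞ := fun h => by simp [h] at hab
  have hb' : b ≠ ∞ := fun h => by simp [h] at hab
  have hkey : ∀ x, (g + h) x / ((l1 + l2 : ℝ≥0) : ℝ≥0∞) = a * (g x / l1) + b * (h x / l2) := by
    intro x
    rw [Pi.add_apply, ENNReal.add_div, ENNReal.coe_add]
    have e : ∀ (u v w : ℝ≥0∞), v ≠ 0 → v ≠ ∞ → u / w = v / w * (u / v) := by
      intro u v w h0 ht
      rw [ENNReal.div_eq_inv_mul, ENNReal.div_eq_inv_mul, ENNReal.div_eq_inv_mul, mul_assoc,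
        ← mul_assoc v, ENNReal.mul_inv_cancel h0 ht, one_mul]
    rw [e (g x) l1 _ h1e ENNReal.coe_ne_top, e (h x) l2 _ h2e ENNReal.coe_ne_top]
  refine le_trans (luxemburg_le (l1 + l2) (by positivity) ?_) (by rw [ENNReal.coe_add])
  simp_rw [hkey]
  calc ∫⁻ x, M x (a * (g x / l1) + b * (h x / l2)) ∂μ
      ≤ ∫⁻ x, (a * M x (g x / l1) + b * M x (h x / l2)) ∂μ := by
        refine lintegral_mono_ae ?_
        filter_upwards [hM.convex] with x hx
        exact hx _ _ _ _ hab
    _ = a * ∫⁻ x, M x (g x / l1) ∂μ + b * ∫⁻ x, M x (h x / l2) ∂μ := by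
        rw [lintegral_add_left' ((hM.meas _ (hg.div_const _)).const_mul _),
          lintegral_const_mul' _ _ ha', lintegral_const_mul' _ _ hb']
    _ ≤ a * 1 + b * 1 := by gcongr
    _ = 1 := by rw [mul_one, mul_one, hab]

theorem luxemburg_smul (hM : IsModular μ M) (c : ℝ≥0) (g : ℝ → ℝ≥0∞) :
    luxemburg μ M (fun x => c * g x) ≤ c * luxemburg μ M g := by
  by_cases hc : c = 0
  · have : (fun x => ((c : ℝ≥0) : ℝ≥0∞) * g x) = 0 := by funext x; simp [hc]
    rw [this, hM.luxemburg_zero]; exact bot_le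
  · have hc' : (c : ℝ≥0∞) ≠ 0 := by exact_mod_cast hc
    conv_rhs => rw [luxemburg]
    rw [ENNReal.mul_iInf_of_ne hc' ENNReal.coe_ne_top]
    refine le_iInf fun l => ?_
    rw [ENNReal.mul_iInf_of_ne hc' ENNReal.coe_ne_top]
    refine le_iInf fun hl => ?_
    refine le_trans (luxemburg_le (c * l) (mul_pos (pos_iff_ne_zero.2 hc) hl.1) ?_)
      (by rw [ENNReal.coe_mul])
    have : ∀ x, (c : ℝ≥0∞) * g x / ((c * l : ℝ≥0) : ℝ≥0∞) = g x / l := fun x => by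
      rw [ENNReal.coe_mul, ENNReal.mul_div_mul_left _ _ hc' ENNReal.coe_ne_top]
    simp_rw [this]
    exact hl.2

theorem luxemburg_eq_zero (hM : IsModular μ M) {g : ℝ → ℝ≥0∞} (hg : AEMeasurable g μ)
    (h : luxemburg μ M g = 0) : g =ᵐ[μ] 0 := by
  have h1 : ∀ n : ℕ, n ≠ 0 → ∫⁻ x, M x (n * g x) ∂μ ≤ 1 := by
    intro n hn
    have h2 : luxemburg μ M g < (n : ℝ≥0∞)⁻¹ := by
      rw [h]; simp
    simp only [luxemburg, iInf_lt_iff] at h2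
    obtain ⟨l, ⟨hl, hl'⟩, hln⟩ := h2
    refine le_trans (lintegral_mono_ae ?_) hl'
    filter_upwards [hM.mono] with x hx
    refine hx ?_
    rw [ENNReal.div_eq_inv_mul]
    gcongr
    rw [ENNReal.le_inv_iff_mul_le, mul_comm, ← ENNReal.le_inv_iff_mul_le]
    exact hln.le
  have h3 : ∀ k : ℕ, ∀ᵐ x ∂μ, M x (k * g x) = 0 := by
    intro k
    by_cases hk : k = 0
    · filter_upwards [hM.zero] with x hx
      simpa [hk] using hx
    have h4 : ∫⁻ x, M x (k * g x) ∂μ = 0 := by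
      refine le_antisymm (le_of_forall_gt fun c hc => ?_) bot_le
      obtain ⟨m, hm⟩ := ENNReal.exists_inv_nat_lt hc.ne'
      rcases Nat.eq_zero_or_pos m with rfl | hm0
      · simp at hm
      refine lt_of_le_of_lt ?_ hm
      have h5 := hM.lintegral_div_le (fun x => ((m * k : ℕ) : ℝ≥0∞) * g x) hm0.ne'
      have h6 : ∀ x, (m : ℝ≥0∞)⁻¹ * (((m * k : ℕ) : ℝ≥0∞) * g x) = k * g x := fun x => by
        rw [Nat.cast_mul, mul_assoc, ← mul_assoc, ENNReal.inv_mul_cancel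
          (by exact_mod_cast hm0.ne') (ENNReal.natCast_ne_top m), one_mul]
      simp_rw [h6] at h5
      refine h5.trans ?_
      calc _ ≤ (m : ℝ≥0∞)⁻¹ * 1 := by gcongr; exact h1 _ (by positivity)
        _ = _ := mul_one _
    exact (lintegral_eq_zero_iff' (hM.meas _ (hg.const_mul _))).1 h4
  filter_upwards [ae_all_iff.2 h3, hM.pos] with x hx hx'
  by_contra hne
  obtain ⟨k, hk⟩ := hx' _ hne
  exact hk (hx k)

/-- The Luxemburg norm. -/
def norm (hM : IsModular μ M) : FunNorm μ where
  rho f := luxemburg μ M fun x => ‖f x‖ₑ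
  add_le f g := by
    refine le_trans (luxemburg_mono fun l _ => lintegral_mono_ae ?_)
      (hM.luxemburg_add f.aestronglyMeasurable.enorm)
    filter_upwards [hM.mono, AEEqFun.coeFn_add f g] with x hx hx'
    refine hx ?_
    rw [hx', Pi.add_apply, Pi.add_apply]
    gcongr
    exact enorm_add_le _ _
  smul_le c f := by
    refine le_trans (luxemburg_mono fun l _ => lintegral_mono_ae ?_)
      (hM.luxemburg_smul ‖c‖₊ fun x => ‖f x‖ₑ)
    filter_upwards [AEEqFun.coeFn_smul c f] with x hx
    rw [hx, Pi.smul_apply, enorm_smul]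
    rfl
  eq_zero f hf := by
    refine AEEqFun.ext ?_
    filter_upwards [hM.luxemburg_eq_zero f.aestronglyMeasurable.enorm hf,
      AEEqFun.coeFn_zero (μ := μ) (β := ℂ)] with x hx hx'
    rw [hx']
    simpa using hx

theorem restrict {M : ℝ → ℝ≥0∞ → ℝ≥0∞} (hM : IsModular volume M) : IsModular volPos M where
  meas g hg := by
    have h1 : AEMeasurable ((Ioi (0 : ℝ)).indicator g) volume :=
      (aemeasurable_indicator_iff measurableSet_Ioi).2 hg
    refine (hM.meas _ h1).restrict.congr ?_
    filter_upwards [ae_restrict_mem measurableSet_Ioi] with x hx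
    rw [indicator_of_mem hx]
  mono := ae_restrict_of_ae hM.mono
  zero := ae_restrict_of_ae hM.zero
  convex := ae_restrict_of_ae hM.convex
  pos := ae_restrict_of_ae hM.pos

/-- The spaces on `ℝ` and `ℝ₊` given by a Luxemburg norm. -/
def space {M : ℝ → ℝ≥0∞ → ℝ≥0∞} (hM : IsModular volume M) : SpacePair where
  line := hM.norm
  half := hM.restrict.norm
  restr_le f := luxemburg_mono fun l _ => by
    refine le_trans (lintegral_mono_ae ?_) (setLIntegral_le_lintegral (Ioi (0 : ℝ)) _)
    filter_upwards [coeFn_restr f] with x hx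
    rw [hx]
  ext0_le f := luxemburg_mono fun l _ => by
    rw [← lintegral_indicator measurableSet_Ioi]
    refine lintegral_mono_ae ?_
    filter_upwards [coeFn_ext0 f, hM.zero] with x hx hx'
    rw [hx]
    by_cases h : x ∈ Ioi (0 : ℝ)
    · simp only [indicator_of_mem h]; exact le_rfl
    · simp [indicator_of_notMem h, hx']

end IsModular

/-! ### Orlicz spaces -/

/-- `φ : [0, ∞) → [0, ∞]` is non-decreasing and left-continuous with `φ(0) = 0` and
`φ(∞) = ∞`, and not identically infinite on `(0, ∞)`. -/
structure IsYoungDensity (φ : ℝ≥0 → ℝ≥0∞) : Prop where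
  mono : Monotone φ
  leftCont : ∀ t, ContinuousWithinAt φ (Iic t) t
  zero : φ 0 = 0
  tendsto : Tendsto φ atTop (𝓝 ∞)
  finite : ∃ t, 0 < t ∧ φ t < ∞

/-- The Young function `Φ(x) = ∫₀ˣ φ(t) dt`. -/
def young (φ : ℝ≥0 → ℝ≥0∞) (x : ℝ≥0∞) : ℝ≥0∞ :=
  ∫⁻ t in {t : ℝ | 0 < t ∧ ENNReal.ofReal t ≤ x}, φ t.toNNReal

theorem young_mono (φ : ℝ≥0 → ℝ≥0∞) : Monotone (young φ) := fun _ _ hst =>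
  lintegral_mono_set fun _ hx => ⟨hx.1, hx.2.trans hst⟩

theorem young_zero (φ : ℝ≥0 → ℝ≥0∞) : young φ 0 = 0 := by
  have : {t : ℝ | 0 < t ∧ ENNReal.ofReal t ≤ 0} = ∅ := by
    ext t
    simp only [mem_ofPred_eq, mem_empty_iff_false, iff_false, not_and]
    intro h; simpa using h
  rw [young, this]; simp

theorem young_coe (φ : ℝ≥0 → ℝ≥0∞) (x : ℝ≥0) :
    young φ x = ∫⁻ t in Ioc 0 (x : ℝ), φ t.toNNReal := by
  have : {t : ℝ | 0 < t ∧ ENNReal.ofReal t ≤ x} = Ioc 0 (x : ℝ) := by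
    ext t
    simp only [mem_ofPred_eq, mem_Ioc, and_congr_right_iff]
    intro ht
    rw [ENNReal.ofReal, ENNReal.coe_le_coe, Real.toNNReal_le_iff_le_coe]
  rw [young, this]

theorem young_coe_add (φ : ℝ≥0 → ℝ≥0∞) {s t : ℝ≥0} (h : s ≤ t) :
    young φ t = young φ s + ∫⁻ u in Ioc (s : ℝ) t, φ u.toNNReal := by
  have h' : (s : ℝ) ≤ t := by exact_mod_cast h
  have hd : Disjoint (Ioc 0 (s : ℝ)) (Ioc (s : ℝ) t) :=
    Set.disjoint_left.2 fun x hx hx' => absurd hx.2 (not_le.2 hx'.1)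
  rw [young_coe, young_coe, ← Ioc_union_Ioc_eq_Ioc s.coe_nonneg h',
    lintegral_union measurableSet_Ioc hd]

theorem IsYoungDensity.exists_le {φ : ℝ≥0 → ℝ≥0∞} (hφ : IsYoungDensity φ) :
    ∃ T : ℝ≥0, ∀ n : ℕ, ∀ x : ℝ≥0∞, (T + n : ℝ≥0) ≤ x → (n : ℝ≥0∞) ≤ young φ x := by
  obtain ⟨T, hT⟩ := eventually_atTop.1 (hφ.tendsto.eventually (lt_mem_nhds ENNReal.one_lt_top))
  refine ⟨T, fun n x hx => le_trans ?_ (young_mono φ hx)⟩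
  rw [young_coe_add φ (le_self_add : T ≤ T + n)]
  refine le_trans ?_ le_add_self
  calc (n : ℝ≥0∞) = ∫⁻ _ in Ioc (T : ℝ) (T + n : ℝ≥0), 1 := by
        rw [setLIntegral_const, Real.volume_Ioc]; simp
    _ ≤ _ := setLIntegral_mono' measurableSet_Ioc fun u hu =>
        (hT _ (NNReal.le_toNNReal_of_coe_le hu.1.le)).le

theorem IsYoungDensity.young_top {φ : ℝ≥0 → ℝ≥0∞} (hφ : IsYoungDensity φ) : young φ ∞ = ∞ := by
  obtain ⟨T, hT⟩ := hφ.exists_le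
  exact ENNReal.eq_top_of_forall_nnreal_le fun r => by
    obtain ⟨n, hn⟩ := exists_nat_ge r
    exact le_trans (by exact_mod_cast hn) (hT n ∞ le_top)

theorem IsYoungDensity.convex_aux {φ : ℝ≥0 → ℝ≥0∞} (hφ : IsYoungDensity φ) {a b s t : ℝ≥0}
    (hab : a + b = 1) (hst : s ≤ t) :
    young φ ((a * s + b * t : ℝ≥0) : ℝ≥0∞) ≤ a * young φ s + b * young φ t := by
  set z : ℝ≥0 := a * s + b * t with hz
  have habR : (a : ℝ) + b = 1 := by exact_mod_cast hab
  have hstR : (s : ℝ) ≤ t := by exact_mod_cast hst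
  have hzR : (z : ℝ) = a * s + b * t := by rw [hz]; push_cast; rfl
  have h1 : (z : ℝ) - s = b * (t - s) := by
    rw [hzR]; linear_combination (s : ℝ) * habR
  have h2 : (t : ℝ) - z = a * (t - s) := by
    rw [hzR]; linear_combination (-(t : ℝ)) * habR
  have hsz : s ≤ z := by
    rw [← NNReal.coe_le_coe, ← sub_nonneg, h1]
    exact mul_nonneg b.coe_nonneg (sub_nonneg.2 hstR)
  have hzt : z ≤ t := by
    rw [← NNReal.coe_le_coe, ← sub_nonneg, h2]
    exact mul_nonneg a.coe_nonneg (sub_nonneg.2 hstR)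
  rw [young_coe_add φ hzt, young_coe_add φ hsz]
  set A := ∫⁻ u in Ioc (s : ℝ) z, φ u.toNNReal
  set B := ∫⁻ u in Ioc (z : ℝ) t, φ u.toNNReal
  have hA : A ≤ φ z * ENNReal.ofReal (z - s) := by
    rw [← Real.volume_Ioc, ← setLIntegral_const]
    exact setLIntegral_mono' measurableSet_Ioc fun u hu =>
      hφ.mono (Real.toNNReal_le_iff_le_coe.2 hu.2)
  have hB : φ z * ENNReal.ofReal (t - z) ≤ B := by
    rw [← Real.volume_Ioc, ← setLIntegral_const]
    exact setLIntegral_mono' measurableSet_Ioc fun u hu =>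
      hφ.mono (NNReal.le_toNNReal_of_coe_le hu.1.le)
  have hAB : (a : ℝ≥0∞) * A ≤ b * B := by
    calc (a : ℝ≥0∞) * A ≤ a * (φ z * ENNReal.ofReal (z - s)) := by gcongr
      _ = b * (φ z * ENNReal.ofReal (t - z)) := by
          rw [h1, h2, ENNReal.ofReal_mul b.coe_nonneg, ENNReal.ofReal_mul a.coe_nonneg,
            ENNReal.ofReal_coe_nnreal, ENNReal.ofReal_coe_nnreal]
          ring
      _ ≤ b * B := by gcongr
  have habE : (a : ℝ≥0∞) + b = 1 := by exact_mod_cast hab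
  calc young φ s + A = (a + b) * (young φ s + A) := by rw [habE, one_mul]
    _ = a * young φ s + b * (young φ s + A) + a * A := by ring
    _ ≤ a * young φ s + b * (young φ s + A) + b * B := by gcongr
    _ = _ := by ring

theorem IsYoungDensity.convex {φ : ℝ≥0 → ℝ≥0∞} (hφ : IsYoungDensity φ) {a b s t : ℝ≥0∞}
    (hab : a + b = 1) : young φ (a * s + b * t) ≤ a * young φ s + b * young φ t := by
  wlog hst : s ≤ t generalizing a b s t
  · rw [add_comm (a * s), add_comm (a * young φ s)]
    exact this (by rw [add_comm]; exact hab) (not_le.1 hst).le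
  by_cases hb : b = 0
  · have ha : a = 1 := by simpa [hb] using hab
    simp [ha, hb]
  by_cases ht : t = ∞
  · have h : a * young φ s + b * young φ t = ∞ := by
      rw [ht, hφ.young_top, ENNReal.mul_top hb, add_top]
    rw [h]; exact le_top
  have hs : s ≠ ∞ := ne_top_of_le_ne_top ht hst
  have ha' : a ≠ ∞ := by rintro rfl; simp at hab
  have hb' : b ≠ ∞ := by rintro rfl; simp at hab
  lift a to ℝ≥0 using ha'
  lift b to ℝ≥0 using hb'
  lift s to ℝ≥0 using hs
  lift t to ℝ≥0 using ht
  exact_mod_cast hφ.convex_aux (by exact_mod_cast hab) (by exact_mod_cast hst)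

theorem IsYoungDensity.isModular {φ : ℝ≥0 → ℝ≥0∞} (hφ : IsYoungDensity φ) :
    IsModular volume fun _ => young φ where
  meas _ hg := (young_mono φ).measurable.comp_aemeasurable hg
  mono := ae_of_all _ fun _ => young_mono φ
  zero := ae_of_all _ fun _ => young_zero φ
  convex := ae_of_all _ fun _ _ _ _ _ hab => hφ.convex hab
  pos := ae_of_all _ fun _ t ht => by
    obtain ⟨T, hT⟩ := hφ.exists_le
    obtain ⟨k, hk⟩ := ENNReal.exists_nat_mul_gt ht (ENNReal.coe_ne_top (r := T + (1 : ℕ)))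
    refine ⟨k, fun h => ?_⟩
    have := hT 1 _ hk.le
    rw [h] at this
    simp at this

/-- The Orlicz space `L^Φ`. -/
def orlicz (φ : ℝ≥0 → ℝ≥0∞) (hφ : IsYoungDensity φ) : SpacePair := hφ.isModular.space

/-- Reflexivity: the canonical map into the bidual is surjective. -/
def IsReflexive (E : Type*) [NormedAddCommGroup E] [NormedSpace ℂ E] : Prop :=
  Function.Surjective (NormedSpace.inclusionInDoubleDual ℂ E)

/-! ### Variable Lebesgue spaces -/

/-- `p(·)` is a variable exponent on `ℝ`: a measurable, a.e. finite function with values in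
`[1, ∞]`. -/
structure IsExponent (p : ℝ → ℝ≥0∞) : Prop where
  meas : AEMeasurable p volume
  one_le : ∀ x, 1 ≤ p x
  finite : ∀ᵐ x, p x < ∞

/-- The function `t ↦ t^{p(x)}` (the value at the points with `p(x) = ∞` plays no role). -/
def powExp (p : ℝ → ℝ≥0∞) (x : ℝ) (t : ℝ≥0∞) : ℝ≥0∞ := t ^ (p x).toReal

theorem IsExponent.isModular {p : ℝ → ℝ≥0∞} (hp : IsExponent p) :
    IsModular volume (powExp p) := by
  have h1 : ∀ᵐ x, 1 ≤ (p x).toReal := by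
    filter_upwards [hp.finite] with x hx
    have := ENNReal.toReal_mono hx.ne (hp.one_le x)
    simpa using this
  refine ⟨fun g hg => hg.pow hp.meas.ennreal_toReal, ?_, ?_, ?_, ?_⟩
  · filter_upwards [h1] with x hx
    exact ENNReal.monotone_rpow_of_nonneg (by linarith)
  · filter_upwards [h1] with x hx
    exact ENNReal.zero_rpow_of_pos (by linarith)
  · filter_upwards [h1] with x hx
    exact fun a b s t hab => ENNReal.rpow_arith_mean_le_arith_mean2_rpow a b s t hab hx
  · filter_upwards [h1] with x hx
    intro t ht
    refine ⟨1, fun h => ?_⟩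
    rw [powExp, Nat.cast_one, one_mul, ENNReal.rpow_eq_zero_iff_of_pos (by linarith)] at h
    exact ht h

/-- The variable Lebesgue space `L^{p(·)}`. -/
def varLebesgue (p : ℝ → ℝ≥0∞) (hp : IsExponent p) : SpacePair := hp.isModular.space

/-- The Hardy-Littlewood maximal function: the supremum of the averages of `|f|` over the bounded
intervals that contain `x`. -/
def maximal (f : ℝ → ℂ) (x : ℝ) : ℝ≥0∞ :=
  ⨆ (a : ℝ) (b : ℝ) (_ : a < b) (_ : x ∈ Icc a b),
    (∫⁻ t in Icc a b, ‖f t‖ₑ) / ENNReal.ofReal (b - a)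

/-- The class `𝓑_M(ℝ)`: `1 < p₋ ≤ p₊ < ∞` and the maximal operator is bounded on `L^{p(·)}(ℝ)`. -/
structure IsBM (p : ℝ → ℝ≥0∞) (hp : IsExponent p) : Prop where
  one_lt_essInf : 1 < essInf p volume
  essSup_lt_top : essSup p volume < ∞
  maximal_bounded : ∃ C : ℝ≥0, ∀ f : (varLebesgue p hp).line.Space,
    luxemburg volume (powExp p) (maximal ((varLebesgue p hp).line.incl f)) ≤
      C * (varLebesgue p hp).line.rho ((varLebesgue p hp).line.incl f)

/-! ### The three classes of spaces -/

/-- `X` is (a) a Lorentz space `L^{p,q}` with `1 < p, q < ∞`, (b) a reflexive Orlicz space `L^Φ`,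
or (c) a variable Lebesgue space `L^{p(·)}` with `p(·) ∈ 𝓑_M(ℝ)`. -/
inductive IsAdmissible : SpacePair → Prop
  | lorentz (p q : ℝ) (hp : 1 < p) (hq : 1 < q) : IsAdmissible (lorentz p q hq)
  | orlicz (φ : ℝ≥0 → ℝ≥0∞) (hφ : IsYoungDensity φ)
      (hr : IsReflexive (orlicz φ hφ).half.Space) : IsAdmissible (orlicz φ hφ)
  | varLebesgue (p : ℝ → ℝ≥0∞) (hp : IsExponent p) (hM : IsBM p hp) :
      IsAdmissible (varLebesgue p hp)

end WH
end

/-!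
Let `K_σ` (`σ = ±1`) be convolution with `expKernel σ`, the one-sided exponential inverting
`1 + σ d/dx`; on the Fourier side `1 - 2 K_σ` is multiplication by `r_σ`. The kernel of `K_σ` is
dominated by `e^{-|x|}`, so `1 - 2 K_σ` is bounded on any space on which convolution with
`e^{-|x|}` is: for Lorentz spaces by the layer-cake comparison of `f**`, for Orlicz spaces by
Jensen's inequality, for variable Lebesgue spaces by the maximal function. Since `W⁰` is determined
only on `L² ∩ X`, identifying `W(r_k)` with a compression also requires density of `L² ∩ X(ℝ₊)`,
which is where reflexivity of the Orlicz space enters.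

`W(r_1)` and `W(r_{-1})` behave like the forward and the backward shift: `K_1` preserves support in
`ℝ₊`, so `W(r_{-1}) W(r_1) = 1` and `W(r_{-n}) = W(r_{-1})^n`. The equation `W(r_{-1}) f = 0` reads
`f = 2 K_{-1} f` on `ℝ₊`, that is `f' = -f`, so `Ker W(r_{-1})` is spanned by `e^{-x}`. The kernel
of the `n`-th power of a backward shift is then spanned by the first `n` forward shifts of that
vector.
-/

noncomputable section

namespace WH

/-! ### Convolution with one-sided exponentials -/

/-- The kernel `e^{-|u|}`, with values in `[0, ∞]`; it dominates the two one-sided kernels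
`expKernel`. -/
def laplaceKernel (u : ℝ) : ℝ≥0∞ := ENNReal.ofReal (Real.exp (-|u|))

/-- The convolution of a nonnegative function with `e^{-|u|}`. -/
def laplaceConv (g : ℝ → ℝ≥0∞) (x : ℝ) : ℝ≥0∞ := ∫⁻ t, laplaceKernel (x - t) * g t

/-- The one-sided kernel that is `e^{-|u|}` on the half-line `σu > 0` and vanishes elsewhere. The
unit `σ` of `ℤ` is the choice of a sign. -/
def expKernel (σ : ℤˣ) (u : ℝ) : ℂ := if 0 < (σ : ℝ) * u then (Real.exp (-|u|) : ℂ) else 0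

/-- The convolution `K_σ f` of a function with the one-sided kernel `expKernel σ`. -/
def expConv (σ : ℤˣ) (f : ℝ → ℂ) (x : ℝ) : ℂ := ∫ t, expKernel σ (x - t) * f t

@[fun_prop]
theorem measurable_laplaceKernel : Measurable laplaceKernel := by
  have : Continuous fun u : ℝ => Real.exp (-|u|) := by fun_prop
  exact this.measurable.ennreal_ofReal

@[fun_prop]
theorem measurable_expKernel (σ : ℤˣ) : Measurable (expKernel σ) := by
  have : Measurable fun u : ℝ => (Real.exp (-|u|) : ℂ) := by fun_prop
  exact this.ite (measurableSet_lt measurable_const (measurable_const_mul _)) measurable_const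

theorem laplaceKernel_le_one (u : ℝ) : laplaceKernel u ≤ 1 := by
  simp [laplaceKernel]

theorem enorm_expKernel_le (σ : ℤˣ) (u : ℝ) : ‖expKernel σ u‖ₑ ≤ laplaceKernel u := by
  unfold expKernel laplaceKernel
  split_ifs
  · rw [← ofReal_norm, Complex.norm_real, Real.norm_of_nonneg (Real.exp_pos _).le]
  · simp

theorem expKernel_neg (σ : ℤˣ) (u : ℝ) : expKernel (-σ) (-u) = expKernel σ u := by
  simp [expKernel]

theorem expKernel_one (u : ℝ) :
    expKernel 1 u = (Ioi (0 : ℝ)).indicator (fun v => (Real.exp (-v) : ℂ)) u := by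
  by_cases hu : 0 < u <;> simp [expKernel, hu, abs_of_pos]

theorem lintegral_laplaceKernel : ∫⁻ u, laplaceKernel u = 2 := by
  have right_half : ∫⁻ u in Ioi (0 : ℝ), laplaceKernel u = 1 := by
    rw [setLIntegral_congr_fun (g := fun u => ENNReal.ofReal (Real.exp (-u))) measurableSet_Ioi
      fun u (hu : 0 < u) => by rw [laplaceKernel, abs_of_pos hu],
      ← ofReal_integral_eq_lintegral_ofReal (integrableOn_exp_neg_Ioi 0)
        (ae_of_all _ fun _ => (Real.exp_pos _).le), integral_exp_neg_Ioi_zero, ENNReal.ofReal_one]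
  have left_half : ∫⁻ u in Iic (0 : ℝ), laplaceKernel u = 1 := by
    rw [setLIntegral_congr_fun (g := fun u => ENNReal.ofReal (Real.exp u)) measurableSet_Iic
      fun u (hu : u ≤ 0) => by rw [laplaceKernel, abs_of_nonpos hu, neg_neg],
      ← ofReal_integral_eq_lintegral_ofReal (integrableOn_exp_Iic 0)
        (ae_of_all _ fun _ => (Real.exp_pos _).le), integral_exp_Iic_zero, ENNReal.ofReal_one]
  rw [← lintegral_add_compl _ (measurableSet_Iic (a := (0 : ℝ))), left_half, compl_Iic, right_half,
    one_add_one_eq_two]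

theorem lintegral_laplaceKernel_sub_left (x : ℝ) : ∫⁻ t, laplaceKernel (x - t) = 2 := by
  rw [lintegral_sub_left_eq_self, lintegral_laplaceKernel]

theorem lintegral_laplaceKernel_sub_right (t : ℝ) : ∫⁻ x, laplaceKernel (x - t) = 2 := by
  rw [lintegral_sub_right_eq_self, lintegral_laplaceKernel]

theorem measurable_laplaceConv {g : ℝ → ℝ≥0∞} (hg : Measurable g) :
    Measurable (laplaceConv g) := by
  have : Measurable fun z : ℝ × ℝ => laplaceKernel (z.1 - z.2) * g z.2 := by fun_prop
  exact this.lintegral_prod_right (ν := volume)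

theorem laplaceConv_congr {f g : ℝ → ℝ≥0∞} (h : f =ᵐ[volume] g) (x : ℝ) :
    laplaceConv f x = laplaceConv g x :=
  lintegral_congr_ae (by filter_upwards [h] with t ht; rw [ht])

theorem laplaceConv_div (g : ℝ → ℝ≥0∞) {l : ℝ≥0} (hl : l ≠ 0) (x : ℝ) :
    laplaceConv g x / l = laplaceConv (fun t => g t / l) x := by
  simp_rw [laplaceConv, ENNReal.div_eq_inv_mul, mul_left_comm _ (l : ℝ≥0∞)⁻¹]
  rw [lintegral_const_mul' _ _ (ENNReal.inv_ne_top.2 (by simpa using hl))]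

theorem lintegral_laplaceConv {g : ℝ → ℝ≥0∞} (hg : Measurable g) :
    ∫⁻ x, laplaceConv g x = 2 * ∫⁻ t, g t := by
  unfold laplaceConv
  rw [lintegral_lintegral_swap (by fun_prop), ← lintegral_const_mul _ hg]
  refine lintegral_congr fun t => ?_
  rw [lintegral_mul_const _ (by fun_prop), lintegral_laplaceKernel_sub_right]

theorem laplaceConv_le_lintegral (g : ℝ → ℝ≥0∞) (x : ℝ) : laplaceConv g x ≤ ∫⁻ t, g t :=
  lintegral_mono fun t => mul_le_of_le_one_left' (laplaceKernel_le_one (x - t))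

theorem laplaceConv_le_two_mul_add_laplaceConv_sub (g : ℝ → ℝ≥0∞) (c : ℝ≥0) (x : ℝ) :
    laplaceConv g x ≤ 2 * c + laplaceConv (fun t => g t - c) x :=
  calc laplaceConv g x
    _ ≤ ∫⁻ t, (laplaceKernel (x - t) * c + laplaceKernel (x - t) * (g t - c)) :=
        lintegral_mono fun t => by rw [← mul_add]; gcongr; exact le_add_tsub
    _ = 2 * c + laplaceConv (fun t => g t - c) x := by
        rw [lintegral_add_left (by fun_prop), lintegral_mul_const _ (by fun_prop),
          lintegral_laplaceKernel_sub_left, laplaceConv]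

theorem enorm_expKernel_mul_le (σ : ℤˣ) (u : ℝ) (z : ℂ) :
    ‖expKernel σ u * z‖ₑ ≤ laplaceKernel u * ‖z‖ₑ := by
  rw [enorm_mul]
  gcongr
  exact enorm_expKernel_le σ u

theorem enorm_expConv_le (σ : ℤˣ) (f : ℝ → ℂ) (x : ℝ) :
    ‖expConv σ f x‖ₑ ≤ laplaceConv (‖f ·‖ₑ) x :=
  (enorm_integral_le_lintegral_enorm _).trans
    (lintegral_mono fun _ => enorm_expKernel_mul_le σ _ _)

theorem stronglyMeasurable_expConv (σ : ℤˣ) {f : ℝ → ℂ} (hf : Measurable f) :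
    StronglyMeasurable (expConv σ f) := by
  have : Measurable fun z : ℝ × ℝ => expKernel σ (z.1 - z.2) * f z.2 := by fun_prop
  exact this.stronglyMeasurable.integral_prod_right (ν := volume)

theorem expConv_congr (σ : ℤˣ) {f g : ℝ → ℂ} (h : f =ᵐ[volume] g) (x : ℝ) :
    expConv σ f x = expConv σ g x :=
  integral_congr_ae (by filter_upwards [h] with t ht; rw [ht])

theorem integrable_expKernel_mul (σ : ℤˣ) {f : ℝ → ℂ} (hf : AEStronglyMeasurable f volume) {x : ℝ}
    (hfx : laplaceConv (‖f ·‖ₑ) x < ∞) : Integrable fun t => expKernel σ (x - t) * f t := by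
  have hmeas : Measurable fun t => expKernel σ (x - t) := by fun_prop
  exact ⟨hmeas.aestronglyMeasurable.mul hf,
    (lintegral_mono fun _ => enorm_expKernel_mul_le σ _ _).trans_lt hfx⟩

theorem expConv_add (σ : ℤˣ) {f g : ℝ → ℂ} (hf : AEStronglyMeasurable f volume)
    (hg : AEStronglyMeasurable g volume) {x : ℝ} (hfx : laplaceConv (‖f ·‖ₑ) x < ∞)
    (hgx : laplaceConv (‖g ·‖ₑ) x < ∞) :
    expConv σ (f + g) x = expConv σ f x + expConv σ g x := by
  simp_rw [expConv, Pi.add_apply, mul_add]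
  exact integral_add (integrable_expKernel_mul σ hf hfx) (integrable_expKernel_mul σ hg hgx)

theorem expConv_smul (σ : ℤˣ) (c : ℂ) (f : ℝ → ℂ) (x : ℝ) :
    expConv σ (c • f) x = c * expConv σ f x := by
  simp_rw [expConv, Pi.smul_apply, smul_eq_mul, mul_left_comm _ c]
  exact integral_const_mul _ _

/-! ### Function norms for which the exponential convolutions are bounded -/

/-- The properties of a function norm on the line that the determination of the kernels uses: its
functions lie in `L¹ + L^∞`, convolution with `e^{-|u|}` is bounded, and it contains the indicator
function of `[0, 1]`. -/
structure IsConvBounded (N : FunNorm volume) : Prop where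
  exists_excess_lt_top : ∀ f : ℝ →ₘ[volume] ℂ, N.rho f < ∞ → ∃ c : ℝ≥0, ∫⁻ t, (‖f t‖ₑ - c) < ∞
  exists_bound : ∃ C : ℝ≥0, ∀ f g : ℝ →ₘ[volume] ℂ, N.rho f < ∞ →
    (∀ᵐ x, ‖g x‖ₑ ≤ laplaceConv (‖f ·‖ₑ) x) → N.rho g ≤ C * N.rho f
  rho_indicator_lt_top : ∀ f : ℝ →ₘ[volume] ℂ,
    f =ᵐ[volume] (Icc (0 : ℝ) 1).indicator 1 → N.rho f < ∞

/-- The operator `K_σ` of convolution with the one-sided exponential, on a.e. classes. -/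
def expConvAE (σ : ℤˣ) (f : ℝ →ₘ[volume] ℂ) : ℝ →ₘ[volume] ℂ :=
  AEEqFun.mk (expConv σ f) (stronglyMeasurable_expConv σ f.measurable).aestronglyMeasurable

theorem coeFn_expConvAE (σ : ℤˣ) (f : ℝ →ₘ[volume] ℂ) :
    expConvAE σ f =ᵐ[volume] expConv σ f :=
  AEEqFun.coeFn_mk _ _

theorem enorm_expConvAE_le (σ : ℤˣ) (f : ℝ →ₘ[volume] ℂ) :
    ∀ᵐ x, ‖expConvAE σ f x‖ₑ ≤ laplaceConv (‖f ·‖ₑ) x := by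
  filter_upwards [coeFn_expConvAE σ f] with x hx
  rw [hx]
  exact enorm_expConv_le σ f x

theorem expConvAE_smul (σ : ℤˣ) (c : ℂ) (f : ℝ →ₘ[volume] ℂ) :
    expConvAE σ (c • f) = c • expConvAE σ f := by
  apply AEEqFun.ext
  filter_upwards [coeFn_expConvAE σ (c • f), coeFn_expConvAE σ f,
    AEEqFun.coeFn_smul c (expConvAE σ f)] with x hcf hf hsmul
  rw [hcf, hsmul, Pi.smul_apply, hf, expConv_congr σ (AEEqFun.coeFn_smul c f), expConv_smul,
    smul_eq_mul]

namespace IsConvBounded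

variable {N : FunNorm volume}

theorem laplaceConv_lt_top (hN : IsConvBounded N) {f : ℝ →ₘ[volume] ℂ} (hf : N.rho f < ∞) (x : ℝ) :
    laplaceConv (‖f ·‖ₑ) x < ∞ := by
  obtain ⟨c, hc⟩ := hN.exists_excess_lt_top f hf
  calc laplaceConv (‖f ·‖ₑ) x
    _ ≤ 2 * c + laplaceConv (fun t => ‖f t‖ₑ - c) x :=
        laplaceConv_le_two_mul_add_laplaceConv_sub _ c x
    _ ≤ 2 * c + ∫⁻ t, (‖f t‖ₑ - c) := by gcongr; exact laplaceConv_le_lintegral _ x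
    _ < ∞ := ENNReal.add_lt_top.2 ⟨ENNReal.mul_lt_top (by simp) (by simp), hc⟩

theorem rho_lt_top_of_le_laplaceConv (hN : IsConvBounded N) {f g : ℝ →ₘ[volume] ℂ}
    (hf : N.rho f < ∞) (h : ∀ᵐ x, ‖g x‖ₑ ≤ laplaceConv (‖f ·‖ₑ) x) : N.rho g < ∞ := by
  obtain ⟨C, hC⟩ := hN.exists_bound
  exact (hC f g hf h).trans_lt (ENNReal.mul_lt_top (by simp) hf)

theorem expConvAE_add (hN : IsConvBounded N) (σ : ℤˣ) {f g : ℝ →ₘ[volume] ℂ} (hf : N.rho f < ∞)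
    (hg : N.rho g < ∞) : expConvAE σ (f + g) = expConvAE σ f + expConvAE σ g := by
  apply AEEqFun.ext
  filter_upwards [coeFn_expConvAE σ (f + g), coeFn_expConvAE σ f, coeFn_expConvAE σ g,
    AEEqFun.coeFn_add (expConvAE σ f) (expConvAE σ g)] with x hfg_x hf_x hg_x hadd
  rw [hfg_x, hadd, Pi.add_apply, hf_x, hg_x, expConv_congr σ (AEEqFun.coeFn_add f g),
    expConv_add σ f.aestronglyMeasurable g.aestronglyMeasurable (hN.laplaceConv_lt_top hf x)
      (hN.laplaceConv_lt_top hg x)]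

/-- The operator `K_σ` of convolution with the one-sided exponential, as a bounded operator. -/
def convOp (hN : IsConvBounded N) (σ : ℤˣ) : N.Space →L[ℂ] N.Space :=
  LinearMap.mkContinuousOfExistsBound
    { toFun := fun f => N.toSpace (expConvAE σ (N.incl f))
        (hN.rho_lt_top_of_le_laplaceConv (N.rho_incl_lt_top f) (enorm_expConvAE_le σ _))
      map_add' := fun f g => N.incl_injective (by
        simp [hN.expConvAE_add σ (N.rho_incl_lt_top f) (N.rho_incl_lt_top g)])
      map_smul' := fun c f => N.incl_injective (by simp [expConvAE_smul]) }
    (by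
      obtain ⟨C, hC⟩ := hN.exists_bound
      refine ⟨C, fun f => ?_⟩
      have hle := ENNReal.toReal_mono
        (ENNReal.mul_lt_top ENNReal.coe_lt_top (N.rho_incl_lt_top f)).ne
        (hC (N.incl f) _ (N.rho_incl_lt_top f) (enorm_expConvAE_le σ _))
      rwa [ENNReal.toReal_mul] at hle)

/-- The operator `1 - 2 K_σ`, the Fourier convolution operator with symbol `r_σ`. -/
def shift (hN : IsConvBounded N) (σ : ℤˣ) : N.Space →L[ℂ] N.Space := 1 - (2 : ℂ) • hN.convOp σ

theorem incl_shift (hN : IsConvBounded N) (σ : ℤˣ) (f : N.Space) :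
    N.incl (hN.shift σ f) = N.incl f - (2 : ℂ) • expConvAE σ (N.incl f) := by
  have hconv : N.incl (hN.convOp σ f) = expConvAE σ (N.incl f) := rfl
  simp [shift, hconv]

theorem coeFn_shift (hN : IsConvBounded N) (σ : ℤˣ) (f : N.Space) :
    N.incl (hN.shift σ f) =ᵐ[volume] fun x => N.incl f x - 2 * expConv σ (N.incl f) x := by
  rw [hN.incl_shift]
  filter_upwards [AEEqFun.coeFn_sub (N.incl f) ((2 : ℂ) • expConvAE σ (N.incl f)),
    AEEqFun.coeFn_smul (2 : ℂ) (expConvAE σ (N.incl f)),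
    coeFn_expConvAE σ (N.incl f)] with x hsub hsmul hconv
  rw [hsub, Pi.sub_apply, hsmul, Pi.smul_apply, hconv, smul_eq_mul]

end IsConvBounded

/-! ### The exponential convolutions on `L²` -/

theorem laplaceConv_sq_le {g : ℝ → ℝ≥0∞} (hg : Measurable g) (x : ℝ) :
    laplaceConv g x ^ (2 : ℝ) ≤ 2 * laplaceConv (fun t => g t ^ (2 : ℝ)) x := by
  set ν : Measure ℝ := volume.withDensity fun t => laplaceKernel (x - t) with hν
  have lintegral_ν {h : ℝ → ℝ≥0∞} (hh : Measurable h) : ∫⁻ t, h t ∂ν = laplaceConv h x := by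
    rw [hν, lintegral_withDensity_eq_lintegral_mul _ (by fun_prop) hh]
    rfl
  have ν_univ : ∫⁻ _ : ℝ, 1 ∂ν = 2 := by
    rw [lintegral_ν measurable_const]
    simp_rw [laplaceConv, mul_one]
    exact lintegral_laplaceKernel_sub_left x
  have cauchy_schwarz := ENNReal.lintegral_mul_le_Lp_mul_Lq ν Real.HolderConjugate.two_two
    (f := fun _ => 1) (g := g) aemeasurable_const hg.aemeasurable
  simp only [Pi.mul_apply, one_mul, ENNReal.one_rpow] at cauchy_schwarz
  rw [ν_univ, lintegral_ν hg, lintegral_ν (hg.pow_const _)] at cauchy_schwarz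
  calc laplaceConv g x ^ (2 : ℝ)
    _ ≤ (2 ^ (1 / 2 : ℝ) * laplaceConv (fun t => g t ^ (2 : ℝ)) x ^ (1 / 2 : ℝ)) ^ (2 : ℝ) := by
        gcongr
    _ = 2 * laplaceConv (fun t => g t ^ (2 : ℝ)) x := by
        rw [ENNReal.mul_rpow_of_nonneg _ _ (by norm_num), ← ENNReal.rpow_mul, ← ENNReal.rpow_mul]
        norm_num

theorem lintegral_laplaceConv_sq_le {g : ℝ → ℝ≥0∞} (hg : Measurable g) :
    ∫⁻ x, laplaceConv g x ^ (2 : ℝ) ≤ 4 * ∫⁻ t, g t ^ (2 : ℝ) := by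
  refine (lintegral_mono (laplaceConv_sq_le hg)).trans ?_
  rw [lintegral_const_mul _ (measurable_laplaceConv (hg.pow_const _)),
    lintegral_laplaceConv (hg.pow_const _), ← mul_assoc]
  norm_num

theorem lintegral_enorm_sq_lt_top {f : ℝ → ℂ} (hf : MemLp f 2 volume) :
    ∫⁻ t, ‖f t‖ₑ ^ (2 : ℝ) < ∞ := by
  simpa using lintegral_rpow_enorm_lt_top_of_eLpNorm_lt_top (by simp) (by simp) hf.2

theorem lintegral_laplaceConv_enorm_sq_lt_top {f : ℝ → ℂ} (hf : MemLp f 2 volume) :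
    ∫⁻ x, laplaceConv (‖f ·‖ₑ) x ^ (2 : ℝ) < ∞ := by
  have hae : (‖f ·‖ₑ) =ᵐ[volume] (‖hf.1.mk f ·‖ₑ) := hf.1.ae_eq_mk.fun_comp _
  simp_rw [laplaceConv_congr hae]
  exact (lintegral_laplaceConv_sq_le hf.1.stronglyMeasurable_mk.measurable.enorm).trans_lt
    (ENNReal.mul_lt_top (by simp) (lintegral_enorm_sq_lt_top (hf.ae_eq hf.1.ae_eq_mk)))

theorem memLp_expConv (σ : ℤˣ) {f : ℝ → ℂ} (hf : MemLp f 2 volume) :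
    MemLp (expConv σ f) 2 volume := by
  constructor
  · rw [funext (expConv_congr σ hf.1.ae_eq_mk)]
    exact (stronglyMeasurable_expConv σ hf.1.stronglyMeasurable_mk.measurable).aestronglyMeasurable
  · rw [eLpNorm_lt_top_iff_lintegral_rpow_enorm_lt_top (by simp) (by simp), ENNReal.toReal_ofNat]
    refine (lintegral_mono fun x => ?_).trans_lt (lintegral_laplaceConv_enorm_sq_lt_top hf)
    gcongr
    exact enorm_expConv_le σ f x

theorem lintegral_laplaceConv_mul_lt_top {f g : ℝ → ℂ} (hf : MemLp f 2 volume)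
    (hg : MemLp g 2 volume) : ∫⁻ x, laplaceConv (‖f ·‖ₑ) x * ‖g x‖ₑ < ∞ := by
  have mul_le_add_sq (a b : ℝ≥0∞) : a * b ≤ a ^ (2 : ℝ) + b ^ (2 : ℝ) := by
    rw [ENNReal.rpow_two, ENNReal.rpow_two, sq, sq]
    rcases le_total a b with hab | hba
    · exact (mul_le_mul_left hab _).trans le_add_self
    · exact (mul_le_mul_right hba _).trans le_self_add
  refine (lintegral_mono fun x => mul_le_add_sq _ _).trans_lt ?_
  rw [lintegral_add_right' _ (hg.1.enorm.pow_const _)]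
  exact ENNReal.add_lt_top.2
    ⟨lintegral_laplaceConv_enorm_sq_lt_top hf, lintegral_enorm_sq_lt_top hg⟩

theorem integrable_prod_expKernel_mul (σ : ℤˣ) {f g : ℝ → ℂ} (hf : MemLp f 2 volume)
    (hg : MemLp g 2 volume) :
    Integrable (fun z : ℝ × ℝ => expKernel σ (z.1 - z.2) * f z.2 * g z.1)
      (volume.prod volume) := by
  have hkernel : Measurable fun z : ℝ × ℝ => expKernel σ (z.1 - z.2) := by fun_prop
  have hmeas : AEStronglyMeasurable (fun z : ℝ × ℝ => expKernel σ (z.1 - z.2) * f z.2 * g z.1)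
      (volume.prod volume) := (hkernel.aestronglyMeasurable.mul hf.1.comp_snd).mul hg.1.comp_fst
  refine ⟨hmeas, ?_⟩
  rw [HasFiniteIntegral, lintegral_prod _ hmeas.enorm]
  refine (lintegral_mono fun x => ?_).trans_lt (lintegral_laplaceConv_mul_lt_top hf hg)
  simp_rw [enorm_mul _ (g x)]
  rw [lintegral_mul_const' _ _ enorm_ne_top]
  gcongr
  exact lintegral_mono fun t => enorm_expKernel_mul_le σ _ _

theorem integral_expConv_mul (σ : ℤˣ) {f g : ℝ → ℂ} (hf : MemLp f 2 volume)
    (hg : MemLp g 2 volume) :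
    ∫ x, expConv σ f x * g x = ∫ t, f t * expConv (-σ) g t :=
  calc ∫ x, expConv σ f x * g x
    _ = ∫ x, ∫ t, expKernel σ (x - t) * f t * g x :=
        integral_congr_ae (ae_of_all _ fun _ => (integral_mul_const _ _).symm)
    _ = ∫ t, ∫ x, expKernel σ (x - t) * f t * g x :=
        integral_integral_swap (integrable_prod_expKernel_mul σ hf hg)
    _ = ∫ t, f t * expConv (-σ) g t := integral_congr_ae (ae_of_all _ fun t => by
        simp only [expConv]
        rw [← integral_const_mul]
        refine integral_congr_ae (ae_of_all _ fun x => ?_)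
        simp only [← expKernel_neg σ (x - t), neg_sub]
        ring)

theorem expConv_comp_neg (σ : ℤˣ) (f : ℝ → ℂ) (x : ℝ) :
    expConv σ (fun t => f (-t)) x = expConv (-σ) f (-x) := by
  rw [expConv, expConv, ← integral_neg_eq_self]
  refine integral_congr_ae (ae_of_all _ fun t => ?_)
  simp only [← expKernel_neg σ, neg_neg]
  congr 2
  ring

theorem expConv_one (f : ℝ → ℂ) (x : ℝ) :
    expConv 1 f x = ∫ t in Iic x, (Real.exp (t - x) : ℂ) * f t := by
  rw [expConv, integral_Iic_eq_integral_Iio, ← integral_indicator measurableSet_Iio]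
  refine integral_congr_ae (ae_of_all _ fun t => ?_)
  by_cases ht : t < x <;> simp [expKernel_one, ht]

theorem expConv_one_add_deriv {ψ ψ' : ℝ → ℂ} (hderiv : ∀ x, HasDerivAt ψ (ψ' x) x)
    (hψ : Integrable ψ) (hψ' : Integrable ψ') (t : ℝ) :
    expConv 1 (fun x => ψ x + ψ' x) t = ψ t := by
  have hexp (x : ℝ) : HasDerivAt (fun x : ℝ => (Real.exp (x - t) : ℂ)) (Real.exp (x - t)) x :=
    ((hasDerivAt_id x).sub_const t).exp.ofReal_comp.congr_deriv (by simp)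
  have hexp_norm {x : ℝ} (hx : x ≤ t) : ‖(Real.exp (x - t) : ℂ)‖ ≤ 1 := by
    rw [Complex.norm_real, Real.norm_of_nonneg (Real.exp_pos _).le]
    exact Real.exp_le_one_iff.2 (by linarith)
  have hexp_cont : Continuous fun x : ℝ => (Real.exp (x - t) : ℂ) := by fun_prop
  have hψ_lim : Tendsto ψ atBot (𝓝 0) := tendsto_zero_of_hasDerivAt_of_integrableOn_Iic
    (fun x (_ : x ∈ Iic t) => hderiv x) hψ'.integrableOn hψ.integrableOn
  have hlim : Tendsto (fun x => (Real.exp (x - t) : ℂ) * ψ x) atBot (𝓝 0) := by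
    refine squeeze_zero_norm' ?_ (tendsto_zero_iff_norm_tendsto_zero.1 hψ_lim)
    filter_upwards [eventually_le_atBot t] with x hx
    rw [norm_mul]
    exact mul_le_of_le_one_left (norm_nonneg _) (hexp_norm hx)
  have hInt : IntegrableOn (fun x => (Real.exp (x - t) : ℂ) * (ψ x + ψ' x)) (Iic t) :=
    (hψ.add hψ').integrableOn.bdd_mul hexp_cont.aestronglyMeasurable
      ((ae_restrict_mem measurableSet_Iic).mono fun x => hexp_norm)
  rw [expConv_one, integral_Iic_of_hasDerivAt_of_tendsto'
    (fun x _ => ((hexp x).mul (hderiv x)).congr_deriv (by ring)) hInt hlim]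
  simp

theorem expConv_add_deriv (σ : ℤˣ) {ψ ψ' : ℝ → ℂ} (hderiv : ∀ x, HasDerivAt ψ (ψ' x) x)
    (hψ : Integrable ψ) (hψ' : Integrable ψ') (t : ℝ) :
    expConv σ (fun x => ψ x + (σ : ℤ) * ψ' x) t = ψ t := by
  rcases Int.units_eq_one_or σ with rfl | rfl
  · simpa using expConv_one_add_deriv hderiv hψ hψ' t
  · have hderiv_neg (x : ℝ) : HasDerivAt (fun x => ψ (-x)) (-ψ' (-x)) x := by
      simpa [Function.comp_def] using (hderiv (-x)).scomp x (hasDerivAt_neg x)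
    have hreflected := expConv_one_add_deriv hderiv_neg hψ.comp_neg hψ'.comp_neg.neg (-t)
    rw [expConv_comp_neg 1 (fun x => ψ x + -ψ' x), neg_neg] at hreflected
    simpa using hreflected

/-- The operator `K_σ` of convolution with the one-sided exponential, on `L²(ℝ)`. -/
def expConvL2 (σ : ℤˣ) (f : Lp ℂ 2 (volume : Measure ℝ)) : Lp ℂ 2 (volume : Measure ℝ) :=
  (memLp_expConv σ (Lp.memLp f)).toLp

theorem coeFn_expConvL2 (σ : ℤˣ) (f : Lp ℂ 2 (volume : Measure ℝ)) :
    expConvL2 σ f =ᵐ[volume] expConv σ f :=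
  MemLp.coeFn_toLp _

/-! ### The exponential convolutions on the Fourier side -/

section Fourier

open scoped SchwartzMap ContDiff

theorem integral_mul_fourier (φ : 𝓢(ℝ, ℂ)) (f : Lp ℂ 2 (volume : Measure ℝ)) :
    ∫ x, φ x * (𝓕 f : Lp ℂ 2 (volume : Measure ℝ)) x = ∫ x, (𝓕 φ) x * f x := by
  have hdistr := DFunLike.congr_fun (Lp.fourier_toTemperedDistribution_eq f) φ
  rw [TemperedDistribution.fourier_apply, Lp.toTemperedDistribution_apply,
    Lp.toTemperedDistribution_apply] at hdistr
  exact hdistr.symm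

theorem ae_eq_of_integral_schwartz_mul_eq {f g : ℝ → ℂ} (hf : LocallyIntegrable f volume)
    (hg : LocallyIntegrable g volume)
    (h : ∀ φ : 𝓢(ℝ, ℂ), ∫ x, φ x * f x = ∫ x, φ x * g x) : f =ᵐ[volume] g := by
  refine ae_eq_of_integral_contDiff_smul_eq hf hg fun u hu_smooth hu_supp => ?_
  have hsmooth : ContDiff ℝ ∞ fun x => (u x : ℂ) := Complex.ofRealCLM.contDiff.comp hu_smooth
  have hsupp : HasCompactSupport fun x => (u x : ℂ) := hu_supp.comp_left Complex.ofReal_zero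
  simpa [Complex.real_smul] using h (hsupp.toSchwartzMap hsmooth)

theorem locallyIntegrable_Lp_two (f : Lp ℂ 2 (volume : Measure ℝ)) :
    LocallyIntegrable f volume :=
  (Lp.memLp f).locallyIntegrable (by norm_num)

theorem exists_schwartz_mul_fourier_eq (c : ℂ) (φ : 𝓢(ℝ, ℂ)) :
    ∃ χ : 𝓢(ℝ, ℂ), (∀ w, χ w = φ w * (1 + c * (2 * Real.pi * Complex.I * w))) ∧
      ∀ x, (𝓕 χ : 𝓢(ℝ, ℂ)) x = (𝓕 φ : 𝓢(ℝ, ℂ)) x - c * deriv (𝓕 φ : 𝓢(ℝ, ℂ)) x := by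
  have htemperate : (fun w : ℝ => inner ℝ w (1 : ℝ)).HasTemperateGrowth := by fun_prop
  refine ⟨φ + (c * (2 * Real.pi * Complex.I)) •
    SchwartzMap.smulLeftCLM ℂ (fun w : ℝ => inner ℝ w (1 : ℝ)) φ, fun w => ?_, fun x => ?_⟩
  · simp only [add_apply, smul_apply, SchwartzMap.smulLeftCLM_apply_apply htemperate]
    simp
    ring
  · have hderiv : deriv (𝓕 φ : 𝓢(ℝ, ℂ)) x =
        (LineDeriv.lineDerivOp (1 : ℝ) (𝓕 φ : 𝓢(ℝ, ℂ)) : 𝓢(ℝ, ℂ)) x := rfl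
    rw [hderiv, SchwartzMap.lineDerivOp_fourier_eq, FourierTransform.fourier_add,
      FourierTransform.fourier_smul, FourierTransform.fourier_smul, add_apply, smul_apply,
      smul_apply, smul_eq_mul, smul_eq_mul]
    ring

theorem fourier_expConvL2 (σ : ℤˣ) (f : Lp ℂ 2 (volume : Measure ℝ)) :
    (fun w : ℝ => (1 + (σ : ℤ) * (2 * Real.pi * Complex.I * w)) *
      (𝓕 (expConvL2 σ f) : Lp ℂ 2 (volume : Measure ℝ)) w) =ᵐ[volume]
      (𝓕 f : Lp ℂ 2 (volume : Measure ℝ)) := by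
  refine ae_eq_of_integral_schwartz_mul_eq
    ((locallyIntegrable_Lp_two _).continuous_mul (by fun_prop)) (locallyIntegrable_Lp_two _)
    fun φ => ?_
  obtain ⟨χ, hχ, hχ_fourier⟩ := exists_schwartz_mul_fourier_eq (σ : ℤ) φ
  have hinverse (t : ℝ) : expConv (-σ) (𝓕 χ : 𝓢(ℝ, ℂ)) t = (𝓕 φ : 𝓢(ℝ, ℂ)) t := by
    rw [funext hχ_fourier]
    have := expConv_add_deriv (-σ)
      (fun x => (𝓕 φ : 𝓢(ℝ, ℂ)).differentiable.differentiableAt.hasDerivAt)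
      (𝓕 φ : 𝓢(ℝ, ℂ)).integrable (SchwartzMap.derivCLM ℝ ℂ (𝓕 φ)).integrable t
    simpa [sub_eq_add_neg] using this
  calc ∫ w, φ w * ((1 + (σ : ℤ) * (2 * Real.pi * Complex.I * w)) *
        (𝓕 (expConvL2 σ f) : Lp ℂ 2 (volume : Measure ℝ)) w)
    _ = ∫ w, χ w * (𝓕 (expConvL2 σ f) : Lp ℂ 2 (volume : Measure ℝ)) w := by
        simp_rw [hχ, mul_assoc]
    _ = ∫ x, expConv σ f x * (𝓕 χ : 𝓢(ℝ, ℂ)) x := by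
        rw [integral_mul_fourier]
        refine integral_congr_ae ?_
        filter_upwards [coeFn_expConvL2 σ f] with x hx
        rw [hx, mul_comm]
    _ = ∫ t, f t * (𝓕 φ : 𝓢(ℝ, ℂ)) t := by
        rw [integral_expConv_mul σ (Lp.memLp f) ((𝓕 χ : 𝓢(ℝ, ℂ)).memLp 2 volume)]
        simp_rw [hinverse]
    _ = ∫ x, φ x * (𝓕 f : Lp ℂ 2 (volume : Measure ℝ)) x := by
        simp_rw [integral_mul_fourier, mul_comm]

theorem ae_comp_mul_left {p : ℝ → Prop} (h : ∀ᵐ x, p x) {c : ℝ} (hc : c ≠ 0) :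
    ∀ᵐ x, p (c * x) := by
  have hquasi : Measure.QuasiMeasurePreserving (fun x : ℝ => c * x) volume volume := by
    refine ⟨measurable_const_mul c, ?_⟩
    rw [Real.map_volume_mul_left hc]
    exact Measure.smul_absolutelyContinuous
  exact hquasi.ae h

theorem inv_two_pi_ne_zero : (2 * Real.pi)⁻¹ ≠ 0 := inv_ne_zero Real.two_pi_pos.ne'

theorem coeFn_fourierL2 (f : Lp ℂ 2 (volume : Measure ℝ)) :
    fourierL2 f =ᵐ[volume] fun ξ =>
      (𝓕 f : Lp ℂ 2 (volume : Measure ℝ)) (-(2 * Real.pi)⁻¹ * ξ) :=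
  MemLp.coeFn_toLp _

theorem coeFn_fourierInvL2 (g : Lp ℂ 2 (volume : Measure ℝ)) :
    fourierInvL2 g =ᵐ[volume] fun x => ((2 * Real.pi)⁻¹ : ℂ) *
      (𝓕 g : Lp ℂ 2 (volume : Measure ℝ)) ((2 * Real.pi)⁻¹ * x) := by
  have hneg : (-1 : ℝ) ≠ 0 := by norm_num
  have hdef : fourierInvL2 g =ᵐ[volume] fun x => ((2 * Real.pi)⁻¹ : ℂ) * fourierL2 g (-1 * x) :=
    MemLp.coeFn_toLp _
  filter_upwards [hdef, ae_comp_mul_left (coeFn_fourierL2 g) hneg] with x hdef_x hfourier_x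
  rw [hdef_x, hfourier_x]
  congr 2
  ring

theorem integral_mul_fourierL2 (ψ : ℝ → ℂ) (g : Lp ℂ 2 (volume : Measure ℝ)) :
    ∫ ξ, ψ ξ * fourierL2 g ξ =
      2 * Real.pi * ∫ w, ψ (-(2 * Real.pi) * w) * (𝓕 g : Lp ℂ 2 (volume : Measure ℝ)) w := by
  have hsubst := Measure.integral_comp_mul_left
    (fun w => ψ (-(2 * Real.pi) * w) * (𝓕 g : Lp ℂ 2 (volume : Measure ℝ)) w) (-(2 * Real.pi)⁻¹)
  rw [inv_neg, inv_inv, abs_neg, abs_of_pos Real.two_pi_pos, Complex.real_smul] at hsubst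
  push_cast at hsubst
  rw [← hsubst]
  refine integral_congr_ae ?_
  filter_upwards [coeFn_fourierL2 g] with ξ hξ
  rw [hξ, ← mul_assoc, neg_mul_neg, mul_assoc, mul_inv_cancel_left₀ Real.two_pi_pos.ne']

theorem integral_mul_fourierInvL2 (ψ : ℝ → ℂ) (g : Lp ℂ 2 (volume : Measure ℝ)) :
    ∫ x, ψ x * fourierInvL2 g x =
      ∫ w, ψ (2 * Real.pi * w) * (𝓕 g : Lp ℂ 2 (volume : Measure ℝ)) w := by
  have hsubst := Measure.integral_comp_mul_left
    (fun w => ψ (2 * Real.pi * w) * (𝓕 g : Lp ℂ 2 (volume : Measure ℝ)) w) (2 * Real.pi)⁻¹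
  rw [inv_inv, abs_of_pos Real.two_pi_pos, Complex.real_smul] at hsubst
  calc ∫ x, ψ x * fourierInvL2 g x
    _ = ∫ x, ((2 * Real.pi)⁻¹ : ℂ) * (ψ (2 * Real.pi * ((2 * Real.pi)⁻¹ * x)) *
          (𝓕 g : Lp ℂ 2 (volume : Measure ℝ)) ((2 * Real.pi)⁻¹ * x)) := by
        refine integral_congr_ae ?_
        filter_upwards [coeFn_fourierInvL2 g] with x hx
        rw [hx, mul_inv_cancel_left₀ Real.two_pi_pos.ne', mul_left_comm]
    _ = ∫ w, ψ (2 * Real.pi * w) * (𝓕 g : Lp ℂ 2 (volume : Measure ℝ)) w := by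
        rw [integral_const_mul, hsubst]
        push_cast
        exact inv_mul_cancel_left₀ (by exact_mod_cast Real.two_pi_pos.ne') _

theorem fourier_comp_mul_left (f : ℝ → ℂ) (c w : ℝ) :
    𝓕 (fun x => f (c * x)) (c * w) = |c⁻¹| • 𝓕 f w := by
  rw [Real.fourier_eq', Real.fourier_eq', ← Measure.integral_comp_mul_left]
  refine integral_congr_ae (ae_of_all _ fun x => ?_)
  simp only [RCLike.inner_apply, conj_trivial]
  congr 4
  ring

theorem fourierInvL2_fourierL2 (g : Lp ℂ 2 (volume : Measure ℝ)) :
    fourierInvL2 (fourierL2 g) = g := by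
  refine Lp.ext (ae_eq_of_integral_schwartz_mul_eq (locallyIntegrable_Lp_two _)
    (locallyIntegrable_Lp_two _) fun φ => ?_)
  let dilation : ℝ ≃L[ℝ] ℝ :=
    ContinuousLinearEquiv.unitsEquivAut ℝ (Units.mk0 (2 * Real.pi) Real.two_pi_pos.ne')
  obtain ⟨φ₁, hφ₁⟩ : ∃ φ₁ : 𝓢(ℝ, ℂ), ∀ x, φ₁ x = φ (2 * Real.pi * x) :=
    ⟨SchwartzMap.compCLMOfContinuousLinearEquiv ℝ dilation φ, fun x => by
      simp [dilation, mul_comm]⟩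
  have hdilation (w : ℝ) :
      (2 * Real.pi : ℂ) * (𝓕 φ₁ : 𝓢(ℝ, ℂ)) (-(2 * Real.pi) * w) = (𝓕⁻ φ : 𝓢(ℝ, ℂ)) w := by
    have hfourier := fourier_comp_mul_left φ (2 * Real.pi) (-w)
    rw [abs_of_pos (inv_pos.2 Real.two_pi_pos), ← Real.fourierInv_eq_fourier_neg,
      Complex.real_smul] at hfourier
    rw [SchwartzMap.fourier_coe, SchwartzMap.fourierInv_coe, funext hφ₁, neg_mul_comm, hfourier]
    push_cast
    exact mul_inv_cancel_left₀ (by exact_mod_cast Real.two_pi_pos.ne') _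
  calc ∫ x, φ x * fourierInvL2 (fourierL2 g) x
    _ = ∫ w, φ₁ w * (𝓕 (fourierL2 g) : Lp ℂ 2 (volume : Measure ℝ)) w := by
        simp_rw [integral_mul_fourierInvL2, hφ₁]
    _ = ∫ w, (2 * Real.pi : ℂ) * (𝓕 φ₁) (-(2 * Real.pi) * w) *
          (𝓕 g : Lp ℂ 2 (volume : Measure ℝ)) w := by
        rw [integral_mul_fourier, integral_mul_fourierL2, ← integral_const_mul]
        simp_rw [mul_assoc]
    _ = ∫ x, φ x * g x := by
        simp_rw [hdilation]
        rw [integral_mul_fourier, FourierTransform.fourier_fourierInv_eq]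

theorem fourierL2_sub_smul (c : ℂ) (f g : Lp ℂ 2 (volume : Measure ℝ)) :
    fourierL2 (f - c • g) =ᵐ[volume] fun ξ => fourierL2 f ξ - c * fourierL2 g ξ := by
  have hlinear : (𝓕 (f - c • g) : Lp ℂ 2 (volume : Measure ℝ)) = 𝓕 f - c • 𝓕 g := by
    rw [sub_eq_add_neg, ← neg_smul, FourierTransform.fourier_add, FourierTransform.fourier_smul,
      neg_smul, ← sub_eq_add_neg]
  have hcoe : (𝓕 (f - c • g) : Lp ℂ 2 (volume : Measure ℝ)) =ᵐ[volume] fun w =>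
      (𝓕 f : Lp ℂ 2 (volume : Measure ℝ)) w - c * (𝓕 g : Lp ℂ 2 (volume : Measure ℝ)) w := by
    rw [hlinear]
    filter_upwards [Lp.coeFn_sub (𝓕 f : Lp ℂ 2 (volume : Measure ℝ)) (c • 𝓕 g),
      Lp.coeFn_smul c (𝓕 g : Lp ℂ 2 (volume : Measure ℝ))] with w hsub hsmul
    rw [hsub, Pi.sub_apply, hsmul, Pi.smul_apply, smul_eq_mul]
  filter_upwards [coeFn_fourierL2 (f - c • g), coeFn_fourierL2 f, coeFn_fourierL2 g,
    ae_comp_mul_left hcoe (neg_ne_zero.2 inv_two_pi_ne_zero)] with ξ hfg_ξ hf_ξ hg_ξ hcoe_ξ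
  rw [hfg_ξ, hf_ξ, hg_ξ, hcoe_ξ]

theorem fourierL2_expConvL2 (σ : ℤˣ) (f : Lp ℂ 2 (volume : Measure ℝ)) :
    (fun ξ : ℝ => (1 - (σ : ℤ) * (Complex.I * ξ)) * fourierL2 (expConvL2 σ f) ξ) =ᵐ[volume]
      fourierL2 f := by
  filter_upwards [coeFn_fourierL2 (expConvL2 σ f), coeFn_fourierL2 f, ae_comp_mul_left
    (fourier_expConvL2 σ f) (neg_ne_zero.2 inv_two_pi_ne_zero)] with ξ hconv_ξ hf_ξ hfourier_ξ
  rw [hconv_ξ, hf_ξ, ← hfourier_ξ]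
  push_cast
  field_simp
  ring

end Fourier

/-! ### Symbols -/

theorem add_I_ne_zero (ξ : ℝ) : (ξ : ℂ) + Complex.I ≠ 0 := fun h => by
  simpa using congrArg Complex.im h

theorem sub_I_ne_zero (ξ : ℝ) : (ξ : ℂ) - Complex.I ≠ 0 := fun h => by
  simpa using congrArg Complex.im h

theorem norm_r (k : ℤ) (ξ : ℝ) : ‖r k ξ‖ = 1 := by
  have norm_sub_I : ‖(ξ : ℂ) - Complex.I‖ = ‖(ξ : ℂ) + Complex.I‖ := by
    rw [← Complex.norm_conj]
    simp
  rw [r, norm_zpow, norm_div, norm_sub_I, div_self (norm_ne_zero_iff.2 (add_I_ne_zero ξ)),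
    one_zpow]

theorem measurable_r (k : ℤ) : Measurable (r k) := by
  unfold r
  fun_prop

theorem memLp_r (k : ℤ) : MemLp (r k) ∞ (volume : Measure ℝ) :=
  memLp_top_of_bound (measurable_r k).aestronglyMeasurable 1 (ae_of_all _ fun ξ => (norm_r k ξ).le)

theorem r_zero (ξ : ℝ) : r 0 ξ = 1 := zpow_zero _

theorem r_add (j k : ℤ) (ξ : ℝ) : r (j + k) ξ = r j ξ * r k ξ :=
  zpow_add₀ (div_ne_zero (sub_I_ne_zero ξ) (add_I_ne_zero ξ)) j k

theorem sub_two_mul_eq_r_mul (σ : ℤˣ) (ξ : ℝ) (z : ℂ) :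
    (1 - (σ : ℤ) * (Complex.I * ξ)) * z - 2 * z =
      r σ ξ * ((1 - (σ : ℤ) * (Complex.I * ξ)) * z) := by
  have := add_I_ne_zero ξ
  have := sub_I_ne_zero ξ
  rcases Int.units_eq_one_or σ with rfl | rfl
  · simp only [r, Units.val_one, zpow_one, Int.cast_one]
    field_simp
    linear_combination (-2 * z * ξ) * Complex.I_mul_I
  · simp only [r, Units.val_neg, Units.val_one, zpow_neg_one, inv_div, Int.cast_neg, Int.cast_one]
    field_simp
    linear_combination (-2 * z * ξ) * Complex.I_mul_I

theorem fourierL2_sub_two_smul_expConvL2 (σ : ℤˣ) (f : Lp ℂ 2 (volume : Measure ℝ)) :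
    fourierL2 (f - (2 : ℂ) • expConvL2 σ f) =ᵐ[volume] fun ξ => r σ ξ * fourierL2 f ξ := by
  filter_upwards [fourierL2_sub_smul 2 f (expConvL2 σ f), fourierL2_expConvL2 σ f]
    with ξ hsub hconv
  rw [hsub, ← hconv, sub_two_mul_eq_r_mul]

/-- `T` preserves `L² ∩ X(ℝ)` and acts there as multiplication by `a` on the Fourier side. In
contrast to `IsConvolutionExtension`, this notion is visibly multiplicative in `(T, a)`. -/
def HasSymbol (N : FunNorm volume) (T : N.Space →L[ℂ] N.Space) (a : ℝ → ℂ) : Prop :=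
  ∀ (f : N.Space) (hf : MemLp (N.incl f) 2 volume), ∃ hTf : MemLp (N.incl (T f)) 2 volume,
    fourierL2 (hTf.toLp _) =ᵐ[volume] fun ξ => a ξ * fourierL2 (hf.toLp _) ξ

namespace HasSymbol

variable {N : FunNorm volume} {S T : N.Space →L[ℂ] N.Space} {a b : ℝ → ℂ}

theorem one (N : FunNorm volume) : HasSymbol N 1 1 := fun _ hf =>
  ⟨hf, ae_of_all _ fun _ => (one_mul _).symm⟩

theorem mul (hS : HasSymbol N S a) (hT : HasSymbol N T b) : HasSymbol N (S * T) (a * b) := by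
  intro f hf
  obtain ⟨hTf, fourier_Tf⟩ := hT f hf
  obtain ⟨hSTf, fourier_STf⟩ := hS (T f) hTf
  refine ⟨hSTf, fourier_STf.trans ?_⟩
  filter_upwards [fourier_Tf] with ξ hξ
  rw [hξ, Pi.mul_apply, mul_assoc]

theorem pow (hT : HasSymbol N T a) (n : ℕ) : HasSymbol N (T ^ n) (a ^ n) := by
  induction n with
  | zero => exact HasSymbol.one N
  | succ n ih => exact pow_succ T n ▸ pow_succ a n ▸ ih.mul hT

theorem isConvolutionExtension (hT : HasSymbol N T a) (ha : MemLp a ∞ volume) :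
    IsConvolutionExtension N a T := by
  refine ⟨ha, fun f hf => ?_⟩
  obtain ⟨hTf, fourier_Tf⟩ := hT f hf
  have : mulL2 a ha (fourierL2 (hf.toLp _)) = fourierL2 (hTf.toLp _) :=
    Lp.ext ((MemLp.coeFn_toLp _).trans fourier_Tf.symm)
  rw [this, fourierInvL2_fourierL2]
  exact (AEEqFun.mk_coeFn _).symm

end HasSymbol

theorem r_pow (k : ℤ) (n : ℕ) : r k ^ n = r (n * k) := by
  funext ξ
  rw [Pi.pow_apply, r, r, ← zpow_natCast, ← zpow_mul, mul_comm]

theorem IsConvBounded.hasSymbol_shift {N : FunNorm volume} (hN : IsConvBounded N) (σ : ℤˣ) :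
    HasSymbol N (hN.shift σ) (r σ) := by
  intro f hf
  have hshift := hN.coeFn_shift σ f
  have hTf : MemLp (N.incl (hN.shift σ f)) 2 volume :=
    (hf.sub ((memLp_expConv σ hf).const_mul 2)).ae_eq hshift.symm
  have toLp_shift : hTf.toLp = hf.toLp - (2 : ℂ) • expConvL2 σ hf.toLp := by
    refine Lp.ext ?_
    filter_upwards [hTf.coeFn_toLp, hf.coeFn_toLp, hshift, coeFn_expConvL2 σ hf.toLp,
      Lp.coeFn_sub hf.toLp ((2 : ℂ) • expConvL2 σ hf.toLp),
      Lp.coeFn_smul (2 : ℂ) (expConvL2 σ hf.toLp)] with x hTfx hfx hx hconv hsub hsmul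
    rw [hTfx, hx, hsub, Pi.sub_apply, hsmul, Pi.smul_apply, hconv, hfx,
      expConv_congr σ hf.coeFn_toLp, smul_eq_mul]
  exact ⟨hTf, toLp_shift ▸ fourierL2_sub_two_smul_expConvL2 σ hf.toLp⟩

theorem IsConvolutionExtension.apply_eq {N : FunNorm volume} {a : ℝ → ℂ}
    {S T : N.Space →L[ℂ] N.Space} (hS : IsConvolutionExtension N a S)
    (hT : IsConvolutionExtension N a T) {f : N.Space} (hf : MemLp (N.incl f) 2 volume) :
    S f = T f := by
  obtain ⟨_, hS⟩ := hS
  obtain ⟨_, hT⟩ := hT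
  exact N.incl_injective (by rw [hS f hf, hT f hf])

theorem IsFourierMultiplier.isConvolutionExtension_W0 {N : FunNorm volume} {a : ℝ → ℂ}
    (ha : IsFourierMultiplier N a) : IsConvolutionExtension N a (W0 N a) := by
  rw [W0, dif_pos ha]
  exact ha.choose_spec

/-! ### Restriction and extension -/

theorem restr_ext0 (f : ℝ →ₘ[volPos] ℂ) : restr (ext0 f) = f := by
  apply AEEqFun.ext
  filter_upwards [coeFn_restr (ext0 f), ae_restrict_of_ae (coeFn_ext0 f),
    ae_restrict_mem measurableSet_Ioi] with x hrestr hext hx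
  rw [hrestr, hext, indicator_of_mem hx]

theorem ext0_restr {f : ℝ →ₘ[volume] ℂ} (hf : ∀ᵐ x, x ≤ 0 → f x = 0) : ext0 (restr f) = f := by
  apply AEEqFun.ext
  filter_upwards [coeFn_ext0 (restr f), (ae_restrict_iff' measurableSet_Ioi).1 (coeFn_restr f),
    hf] with x hext hrestr hfx
  rw [hext]
  by_cases hx : x ∈ Ioi (0 : ℝ)
  · rw [indicator_of_mem hx, hrestr hx]
  · rw [indicator_of_notMem hx, hfx (not_lt.1 hx)]

namespace SpacePair

theorem rPlus_ellPlus (X : SpacePair) (f : X.half.Space) : X.rPlus (X.ellPlus f) = f :=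
  X.half.incl_injective (restr_ext0 _)

theorem ellPlus_rPlus (X : SpacePair) {f : X.line.Space}
    (hf : ∀ᵐ x, x ≤ 0 → X.line.incl f x = 0) : X.ellPlus (X.rPlus f) = f :=
  X.line.incl_injective (ext0_restr hf)

theorem coeFn_incl_rPlus (X : SpacePair) (f : X.line.Space) :
    X.half.incl (X.rPlus f) =ᵐ[volPos] X.line.incl f :=
  coeFn_restr _

theorem coeFn_incl_ellPlus (X : SpacePair) (f : X.half.Space) :
    X.line.incl (X.ellPlus f) =ᵐ[volume] (Ioi (0 : ℝ)).indicator (X.half.incl f) :=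
  coeFn_ext0 _

theorem incl_ellPlus_of_nonpos (X : SpacePair) (f : X.half.Space) :
    ∀ᵐ x, x ≤ 0 → X.line.incl (X.ellPlus f) x = 0 := by
  filter_upwards [X.coeFn_incl_ellPlus f] with x hext hx
  rw [hext, indicator_of_notMem (notMem_Ioi.2 hx)]

theorem memLp_incl_ellPlus (X : SpacePair) {f : X.half.Space} {q : ℝ≥0∞}
    (hf : MemLp (X.half.incl f) q volPos) : MemLp (X.line.incl (X.ellPlus f)) q volume :=
  ((memLp_indicator_iff_restrict measurableSet_Ioi).2 hf).ae_eq (X.coeFn_incl_ellPlus f).symm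

end SpacePair

theorem expConv_one_of_nonpos {f : ℝ → ℂ} (hf : ∀ᵐ x, x ≤ 0 → f x = 0) {x : ℝ} (hx : x ≤ 0) :
    expConv 1 f x = 0 := by
  rw [expConv_one]
  refine setIntegral_eq_zero_of_ae_eq_zero ?_
  filter_upwards [hf] with t hft ht
  rw [hft (le_trans ht hx), mul_zero]

theorem expKernel_neg_one (u : ℝ) :
    expKernel (-1) u = (Iio (0 : ℝ)).indicator (fun v => (Real.exp v : ℂ)) u := by
  by_cases hu : u < 0 <;> simp [expKernel, hu, abs_of_neg]

theorem expConv_neg_one (f : ℝ → ℂ) (x : ℝ) :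
    expConv (-1) f x = Real.exp x * ∫ t in Ioi x, (Real.exp (-t) : ℂ) * f t := by
  rw [expConv, ← integral_const_mul, ← integral_indicator measurableSet_Ioi]
  congr 1
  funext t
  by_cases ht : x < t
  · simp [expKernel_neg_one, ht, ← mul_assoc, ← Complex.exp_add, sub_eq_add_neg]
  · simp [expKernel_neg_one, ht]

theorem expConv_neg_one_congr {f g : ℝ → ℂ} (hfg : f =ᵐ[volPos] g) {x : ℝ} (hx : 0 ≤ x) :
    expConv (-1) f x = expConv (-1) g x := by
  rw [expConv_neg_one, expConv_neg_one]
  congr 1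
  refine integral_congr_ae ?_
  filter_upwards [ae_restrict_of_ae_restrict_of_subset (Ioi_subset_Ioi hx) hfg] with t ht
  rw [ht]

/-! ### Powers of a left inverse -/

theorem ker_pow_succ_of_mul_eq_one {R E : Type*} [Ring R] [AddCommGroup E] [Module R E]
    {A B : E →ₗ[R] E} (hBA : B * A = 1) {v : E} (hB : LinearMap.ker B = Submodule.span R {v})
    (n : ℕ) :
    LinearMap.ker (B ^ (n + 1)) = LinearMap.ker (B ^ n) ⊔ Submodule.span R {(A ^ n) v} := by
  have hpow (x : E) : (B ^ n) ((A ^ n) x) = x :=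
    LinearMap.congr_fun (pow_mul_pow_eq_one n hBA) x
  apply le_antisymm
  · intro x hx
    rw [pow_succ', LinearMap.mem_ker, Module.End.mul_apply, ← LinearMap.mem_ker, hB,
      Submodule.mem_span_singleton] at hx
    obtain ⟨c, hc⟩ := hx
    have hsub : x - c • (A ^ n) v ∈ LinearMap.ker (B ^ n) := by
      rw [LinearMap.mem_ker, map_sub, map_smul, hpow, hc, sub_self]
    rw [← sub_add_cancel x (c • (A ^ n) v)]
    exact Submodule.add_mem_sup hsub (Submodule.mem_span_singleton.2 ⟨c, rfl⟩)
  · have hv : v ∈ LinearMap.ker B := hB ▸ Submodule.mem_span_singleton_self v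
    rw [pow_succ']
    refine sup_le (LinearMap.ker_le_ker_comp _ _) ((Submodule.span_singleton_le_iff_mem _ _).2 ?_)
    rwa [LinearMap.mem_ker, Module.End.mul_apply, hpow]

theorem ker_pow_eq_span_of_mul_eq_one {R E : Type*} [Ring R] [AddCommGroup E] [Module R E]
    {A B : E →ₗ[R] E} (hBA : B * A = 1) {v : E} (hB : LinearMap.ker B = Submodule.span R {v})
    (n : ℕ) :
    LinearMap.ker (B ^ n) = Submodule.span R ((fun k : ℕ => (A ^ k) v) '' {k | k < n}) := by
  induction n with
  | zero => simp [Module.End.one_eq_id]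
  | succ n ih =>
    have insert_lt : {k | k < n + 1} = insert n {k | k < n} :=
      Set.ext fun k => Nat.lt_succ_iff_lt_or_eq.trans or_comm
    rw [ker_pow_succ_of_mul_eq_one hBA hB, ih, insert_lt, image_insert_eq, Submodule.span_insert,
      sup_comm]

/-! ### Functions proportional to their tail integrals -/

theorem hasDerivAt_integral_Ioi {E : Type*} [NormedAddCommGroup E] [NormedSpace ℝ E]
    [CompleteSpace E] {h : ℝ → E} {a x : ℝ} (hInt : IntegrableOn h (Ioi a))
    (hcont : ContinuousOn h (Ioi a)) (hx : a < x) :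
    HasDerivAt (fun y => ∫ t in Ioi y, h t) (-h x) x := by
  have hderiv : HasDerivAt (fun y => ∫ t in a..y, h t) (h x) x :=
    intervalIntegral.integral_hasDerivAt_right
      ((intervalIntegrable_iff_integrableOn_Ioc_of_le hx.le).2
        (hInt.mono_set Ioc_subset_Ioi_self))
      (hcont.stronglyMeasurableAtFilter isOpen_Ioi x hx)
      (hcont.continuousAt (Ioi_mem_nhds hx))
  refine (hderiv.const_sub (∫ t in Ioi a, h t)).congr_of_eventuallyEq ?_
  filter_upwards [lt_mem_nhds hx] with y hy
  rw [← intervalIntegral.integral_Ioi_sub_Ioi hInt hy.le, sub_sub_cancel]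

theorem exists_integral_Ioi_eq_mul_exp {h : ℝ → ℂ} {a : ℝ} (c : ℂ)
    (hInt : IntegrableOn h (Ioi a))
    (hh : ∀ᵐ x, a < x → h x = c * ∫ t in Ioi x, h t) :
    ∃ d : ℂ, ∀ x, a < x → ∫ t in Ioi x, h t = d * Complex.exp (-(c * x)) := by
  set G : ℝ → ℂ := fun x => ∫ t in Ioi x, h t
  have hG_cont : ContinuousOn (fun x => c * G x) (Ioi a) :=
    (hInt.continuousOn_Ici_primitive_Ioi.mono Ioi_subset_Ici_self).const_mul c
  have h_ae_eq : h =ᵐ[volume.restrict (Ioi a)] fun x => c * G x :=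
    (ae_restrict_iff' measurableSet_Ioi).2 hh
  have hG_tail (x : ℝ) (hx : a < x) : G x = ∫ t in Ioi x, c * G t :=
    integral_congr_ae
      (ae_restrict_of_ae_restrict_of_subset (Ioi_subset_Ioi hx.le) h_ae_eq)
  have hG_deriv (x : ℝ) (hx : a < x) : HasDerivAt G (-(c * G x)) x :=
    (hasDerivAt_integral_Ioi (hInt.congr h_ae_eq) hG_cont hx).congr_of_eventuallyEq
      (eventually_of_mem (Ioi_mem_nhds hx) hG_tail)
  have hexp (x : ℝ) : HasDerivAt (fun y : ℝ => Complex.exp (c * y)) (c * Complex.exp (c * x)) x :=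
    (((hasDerivAt_id x).ofReal_comp.const_mul c).cexp).congr_deriv (by simp [mul_comm])
  have hderiv_zero (x : ℝ) (hx : a < x) :
      HasDerivAt (fun y : ℝ => Complex.exp (c * y) * G y) 0 x :=
    ((hexp x).mul (hG_deriv x hx)).congr_deriv (by ring)
  obtain ⟨d, hd⟩ := isOpen_Ioi.exists_is_const_of_deriv_eq_zero isPreconnected_Ioi
    (fun x hx => (hderiv_zero x hx).differentiableAt.differentiableWithinAt)
    (fun x hx => (hderiv_zero x hx).deriv)
  refine ⟨d, fun x hx => ?_⟩
  rw [← hd x hx, mul_right_comm, ← Complex.exp_add, add_neg_cancel, Complex.exp_zero, one_mul]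

theorem expConv_neg_one_const_mul_exp_neg (c : ℂ) (x : ℝ) :
    expConv (-1) (fun t => c * Real.exp (-t)) x = c * Real.exp (-x) / 2 := by
  have mul_exp (t : ℝ) :
      (Real.exp (-t) : ℂ) * (c * Real.exp (-t)) = c * (Real.exp (-2 * t) : ℝ) := by
    rw [mul_left_comm, ← Complex.ofReal_mul, ← Real.exp_add]
    ring_nf
  have exp_mul : Real.exp x * (Real.exp (-2 * x) / 2) = Real.exp (-x) / 2 := by
    rw [← mul_div_assoc, ← Real.exp_add]
    ring_nf
  simp_rw [expConv_neg_one, mul_exp]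
  rw [integral_const_mul, integral_complex_ofReal, integral_exp_mul_Ioi (by norm_num),
    mul_left_comm, ← Complex.ofReal_mul, neg_div_neg_eq, exp_mul]
  push_cast
  ring

theorem ae_eq_two_mul_expConv_neg_one_iff {F : ℝ → ℂ}
    (hInt : IntegrableOn (fun t => (Real.exp (-t) : ℂ) * F t) (Ioi 0)) :
    (F =ᵐ[volPos] fun x => 2 * expConv (-1) F x) ↔
      ∃ c : ℂ, F =ᵐ[volPos] fun x => c * Real.exp (-x) := by
  constructor
  · intro hF
    have tail_eq : ∀ᵐ x, 0 < x →
        (Real.exp (-x) : ℂ) * F x = 2 * ∫ t in Ioi x, (Real.exp (-t) : ℂ) * F t := by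
      filter_upwards [(ae_restrict_iff' measurableSet_Ioi).1 hF] with x hFx hx
      rw [hFx hx, expConv_neg_one, mul_left_comm, ← mul_assoc (Real.exp (-x) : ℂ),
        ← Complex.ofReal_mul, ← Real.exp_add, neg_add_cancel, Real.exp_zero, Complex.ofReal_one,
        one_mul]
    obtain ⟨d, hd⟩ := exists_integral_Ioi_eq_mul_exp 2 hInt tail_eq
    refine ⟨2 * d, ?_⟩
    filter_upwards [hF, ae_restrict_mem measurableSet_Ioi] with x hFx hx
    rw [hFx, expConv_neg_one, hd x hx, mul_left_comm (Real.exp x : ℂ), Complex.ofReal_exp,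
      ← Complex.exp_add, mul_assoc, Complex.ofReal_exp]
    congr 3
    push_cast
    ring
  · rintro ⟨c, hF⟩
    filter_upwards [hF, ae_restrict_mem measurableSet_Ioi] with x hFx hx
    rw [expConv_neg_one_congr hF (le_of_lt hx), expConv_neg_one_const_mul_exp_neg, hFx]
    ring

/-! ### Compressions to the half-line -/

namespace SpacePair

variable {X : SpacePair}

/-- The compression `r₊ T ℓ₊` to the half-line of an operator `T` on the line. -/
def compression (X : SpacePair) (T : X.line.Space →L[ℂ] X.line.Space) :
    X.half.Space →L[ℂ] X.half.Space :=
  X.rPlus ∘L T ∘L X.ellPlus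

theorem compression_one (X : SpacePair) : X.compression 1 = 1 :=
  ContinuousLinearMap.ext X.rPlus_ellPlus

theorem compression_mul_of_ellPlus {T : X.line.Space →L[ℂ] X.line.Space}
    (hT : ∀ f, X.ellPlus (X.compression T f) = T (X.ellPlus f))
    (S : X.line.Space →L[ℂ] X.line.Space) :
    X.compression (S * T) = X.compression S * X.compression T :=
  ContinuousLinearMap.ext fun f => congrArg (fun g => X.rPlus (S g)) (hT f).symm

theorem compression_mul_of_rPlus {S : X.line.Space →L[ℂ] X.line.Space}
    (hS : ∀ g, X.rPlus (S g) = X.compression S (X.rPlus g))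
    (T : X.line.Space →L[ℂ] X.line.Space) :
    X.compression (S * T) = X.compression S * X.compression T :=
  ContinuousLinearMap.ext fun f => hS (T (X.ellPlus f))

theorem compression_pow_of_ellPlus {T : X.line.Space →L[ℂ] X.line.Space}
    (hT : ∀ f, X.ellPlus (X.compression T f) = T (X.ellPlus f)) (n : ℕ) :
    X.compression (T ^ n) = X.compression T ^ n := by
  induction n with
  | zero => exact X.compression_one
  | succ n ih => rw [pow_succ, compression_mul_of_ellPlus hT, ih, pow_succ]

theorem compression_pow_of_rPlus {S : X.line.Space →L[ℂ] X.line.Space}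
    (hS : ∀ g, X.rPlus (S g) = X.compression S (X.rPlus g)) (n : ℕ) :
    X.compression (S ^ n) = X.compression S ^ n := by
  induction n with
  | zero => exact X.compression_one
  | succ n ih => rw [pow_succ', compression_mul_of_rPlus hS, ih, pow_succ']

end SpacePair

section WienerHopf

variable {X : SpacePair}

theorem HasSymbol.W_eq_compression {T : X.line.Space →L[ℂ] X.line.Space} {a : ℝ → ℂ}
    (hT : HasSymbol X.line T a) (ha : MemLp a ∞ volume)
    (hd : Dense {g : X.half.Space | MemLp (X.half.incl g) 2 volPos}) :
    W X a = X.compression T := by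
  have hext := hT.isConvolutionExtension ha
  have ha_mult : IsFourierMultiplier X.line a := ⟨T, hext⟩
  refine ContinuousLinearMap.ext_on (hd.mono Submodule.subset_span) fun g hg => ?_
  exact congrArg X.rPlus
    (ha_mult.isConvolutionExtension_W0.apply_eq hext (X.memLp_incl_ellPlus hg))

namespace IsConvBounded

theorem exists_hasSymbol_r {N : FunNorm volume} (hN : IsConvBounded N) (k : ℤ) :
    ∃ T, HasSymbol N T (r k) := by
  obtain ⟨n, rfl | rfl⟩ := k.eq_nat_or_neg
  · exact ⟨_, by simpa [r_pow] using (hN.hasSymbol_shift 1).pow n⟩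
  · exact ⟨_, by simpa [r_pow] using (hN.hasSymbol_shift (-1)).pow n⟩

theorem isFourierMultiplier_r {N : FunNorm volume} (hN : IsConvBounded N) (k : ℤ) :
    IsFourierMultiplier N (r k) :=
  let ⟨T, hT⟩ := hN.exists_hasSymbol_r k
  ⟨T, hT.isConvolutionExtension (memLp_r k)⟩

theorem ellPlus_compression_shift_one (hN : IsConvBounded X.line) (f : X.half.Space) :
    X.ellPlus (X.compression (hN.shift 1) f) = hN.shift 1 (X.ellPlus f) := by
  refine X.ellPlus_rPlus ?_
  have hf := X.incl_ellPlus_of_nonpos f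
  filter_upwards [hN.coeFn_shift 1 (X.ellPlus f), hf] with x hshift hfx hx
  refine hshift.trans ?_
  rw [hfx hx, expConv_one_of_nonpos hf hx, mul_zero, sub_zero]

theorem coeFn_rPlus_shift_neg_one (hN : IsConvBounded X.line) (g : X.line.Space) :
    X.half.incl (X.rPlus (hN.shift (-1) g)) =ᵐ[volPos]
      fun x => X.half.incl (X.rPlus g) x - 2 * expConv (-1) (X.half.incl (X.rPlus g)) x := by
  filter_upwards [X.coeFn_incl_rPlus (hN.shift (-1) g), X.coeFn_incl_rPlus g,
    ae_restrict_of_ae (hN.coeFn_shift (-1) g), ae_restrict_mem measurableSet_Ioi]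
    with x hrestr hg hshift hx
  rw [hrestr, hshift, hg, expConv_neg_one_congr (X.coeFn_incl_rPlus g) (le_of_lt hx)]

theorem rPlus_shift_neg_one (hN : IsConvBounded X.line) (g : X.line.Space) :
    X.rPlus (hN.shift (-1) g) = X.compression (hN.shift (-1)) (X.rPlus g) := by
  have hcompr := hN.coeFn_rPlus_shift_neg_one (X.ellPlus (X.rPlus g))
  rw [X.rPlus_ellPlus] at hcompr
  exact X.half.incl_injective
    (AEEqFun.ext ((hN.coeFn_rPlus_shift_neg_one g).trans hcompr.symm))

section Dense

variable (hN : IsConvBounded X.line)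
  (hd : Dense {g : X.half.Space | MemLp (X.half.incl g) 2 volPos})

include hN hd

theorem W_r_natCast (n : ℕ) : W X (r n) = X.compression (hN.shift 1) ^ n := by
  have hsymbol : HasSymbol X.line (hN.shift 1 ^ n) (r n) := by
    simpa [r_pow] using (hN.hasSymbol_shift 1).pow n
  rw [hsymbol.W_eq_compression (memLp_r n) hd,
    SpacePair.compression_pow_of_ellPlus hN.ellPlus_compression_shift_one]

theorem W_r_neg_natCast (n : ℕ) :
    W X (r (-(n : ℤ))) = X.compression (hN.shift (-1)) ^ n := by
  have hsymbol : HasSymbol X.line (hN.shift (-1) ^ n) (r (-(n : ℤ))) := by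
    simpa [r_pow] using (hN.hasSymbol_shift (-1)).pow n
  rw [hsymbol.W_eq_compression (memLp_r _) hd,
    SpacePair.compression_pow_of_rPlus hN.rPlus_shift_neg_one]

theorem compression_shift_neg_one_mul_compression_shift_one :
    X.compression (hN.shift (-1)) * X.compression (hN.shift 1) = 1 := by
  have hsymbol : HasSymbol X.line (hN.shift (-1) * hN.shift 1) 1 := by
    have r_mul : r (-1) * r 1 = 1 := funext fun ξ => by
      rw [Pi.mul_apply, ← r_add, neg_add_cancel, r_zero, Pi.one_apply]
    exact r_mul ▸ (hN.hasSymbol_shift (-1)).mul (hN.hasSymbol_shift 1)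
  have one_memLp : MemLp (1 : ℝ → ℂ) ∞ volume := memLp_top_const 1
  rw [← SpacePair.compression_mul_of_rPlus hN.rPlus_shift_neg_one,
    ← hsymbol.W_eq_compression one_memLp hd,
    (HasSymbol.one X.line).W_eq_compression one_memLp hd, SpacePair.compression_one]

theorem psi_eq_pow (psi0 : X.half.Space) (k : ℕ) :
    psi X psi0 k = (X.compression (hN.shift 1) ^ k) psi0 := by
  cases k with
  | zero => rfl
  | succ k => rw [← hN.W_r_natCast hd, Nat.cast_succ, psi]

end Dense

/-! ### The kernel of the backward shift -/

theorem integrableOn_exp_neg_mul (hN : IsConvBounded X.line) (f : X.half.Space) :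
    IntegrableOn (fun t => (Real.exp (-t) : ℂ) * X.half.incl f t) (Ioi 0) := by
  have hline : IntegrableOn (fun t => (Real.exp (-t) : ℂ) * X.line.incl (X.ellPlus f) t)
      (Ioi 0) := by
    rw [← integrable_indicator_iff measurableSet_Ioi]
    refine (integrable_expKernel_mul (-1) (X.line.incl (X.ellPlus f)).aestronglyMeasurable
      (hN.laplaceConv_lt_top (X.line.rho_incl_lt_top (X.ellPlus f)) 0)).congr
      (ae_of_all _ fun t => ?_)
    by_cases ht : 0 < t <;> simp [expKernel_neg_one, ht]
  refine hline.congr ?_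
  filter_upwards [X.coeFn_incl_rPlus (X.ellPlus f)] with t ht
  rw [← ht, X.rPlus_ellPlus]

theorem compression_shift_neg_one_apply_eq_zero_iff (hN : IsConvBounded X.line)
    (f : X.half.Space) :
    X.compression (hN.shift (-1)) f = 0 ↔
      ∃ c : ℂ, X.half.incl f =ᵐ[volPos] fun x => c * Real.exp (-x) := by
  have hcompr := hN.coeFn_rPlus_shift_neg_one (X.ellPlus f)
  rw [X.rPlus_ellPlus] at hcompr
  rw [← ae_eq_two_mul_expConv_neg_one_iff (hN.integrableOn_exp_neg_mul f)]
  constructor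
  · intro hzero
    have hzero_ae : X.half.incl (X.compression (hN.shift (-1)) f) =ᵐ[volPos] 0 := by
      rw [hzero, map_zero]
      exact AEEqFun.coeFn_zero
    filter_upwards [hcompr, hzero_ae] with x hx hx_zero
    exact sub_eq_zero.1 (hx.symm.trans hx_zero)
  · intro hf
    refine X.half.incl_injective (AEEqFun.ext ?_)
    rw [map_zero]
    filter_upwards [hcompr, hf, AEEqFun.coeFn_zero (β := ℂ) (μ := volPos)] with x hx hfx hx_zero
    exact hx.trans ((sub_eq_zero.2 hfx).trans hx_zero.symm)

theorem ker_compression_shift_neg_one (hN : IsConvBounded X.line) {psi0 : X.half.Space}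
    {b : ℂ} (hb : b ≠ 0) (hpsi0 : X.half.incl psi0 =ᵐ[volPos] fun x => b * Real.exp (-x)) :
    LinearMap.ker (X.compression (hN.shift (-1))).toLinearMap = Submodule.span ℂ {psi0} := by
  ext f
  rw [LinearMap.mem_ker, ContinuousLinearMap.coe_coe,
    hN.compression_shift_neg_one_apply_eq_zero_iff, Submodule.mem_span_singleton]
  constructor
  · rintro ⟨c, hf⟩
    refine ⟨c / b, X.half.incl_injective (AEEqFun.ext ?_)⟩
    rw [map_smul]
    filter_upwards [AEEqFun.coeFn_smul (c / b) (X.half.incl psi0), hpsi0, hf]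
      with x hsmul hpsi0x hfx
    rw [hsmul, Pi.smul_apply, hpsi0x, hfx, smul_eq_mul, ← mul_assoc, div_mul_cancel₀ c hb]
  · rintro ⟨c, rfl⟩
    refine ⟨c * b, ?_⟩
    rw [map_smul]
    filter_upwards [AEEqFun.coeFn_smul c (X.half.incl psi0), hpsi0] with x hsmul hpsi0x
    rw [hsmul, Pi.smul_apply, hpsi0x, smul_eq_mul, mul_assoc]

end IsConvBounded

theorem exp_neg_sub_one_mul_le_laplaceConv {g : ℝ → ℝ≥0∞} {c : ℝ≥0∞}
    (hg : ∀ᵐ t, t ∈ Icc (0 : ℝ) 1 → c ≤ g t) {x : ℝ} (hx : 0 ≤ x) :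
    ENNReal.ofReal (Real.exp (-x - 1)) * c ≤ laplaceConv g x := by
  calc ENNReal.ofReal (Real.exp (-x - 1)) * c
    _ = ∫⁻ _ in Icc (0 : ℝ) 1, ENNReal.ofReal (Real.exp (-x - 1)) * c := by
      rw [setLIntegral_const, Real.volume_Icc, sub_zero, ENNReal.ofReal_one, mul_one]
    _ ≤ ∫⁻ t in Icc (0 : ℝ) 1, laplaceKernel (x - t) * g t := by
      refine lintegral_mono_ae ((ae_restrict_iff' measurableSet_Icc).2 ?_)
      filter_upwards [hg] with t hgt ht
      have : |x - t| ≤ x + 1 := abs_le.2 ⟨by linarith [ht.2], by linarith [ht.1]⟩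
      gcongr
      · exact ENNReal.ofReal_le_ofReal (Real.exp_le_exp.2 (by linarith))
      · exact hgt ht
    _ ≤ laplaceConv g x := setLIntegral_le_lintegral _ _

theorem IsConvBounded.exists_coeFn_eq_sqrt_two_mul_exp_neg (hN : IsConvBounded X.line) :
    ∃ psi0 : X.half.Space,
      X.half.incl psi0 =ᵐ[volPos] fun x => ((Real.sqrt 2 * Real.exp (-x) : ℝ) : ℂ) := by
  set c : ℂ := ((Real.sqrt 2 * Real.exp 1 : ℝ) : ℂ)
  set χ : ℝ →ₘ[volume] ℂ := AEEqFun.mk ((Icc (0 : ℝ) 1).indicator 1)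
    (stronglyMeasurable_one.indicator measurableSet_Icc).aestronglyMeasurable
  have hχ : χ =ᵐ[volume] (Icc (0 : ℝ) 1).indicator 1 := AEEqFun.coeFn_mk _ _
  have hχ_rho : X.line.rho (c • χ) < ∞ :=
    (X.line.smul_le c χ).trans_lt (ENNReal.mul_lt_top enorm_lt_top (hN.rho_indicator_lt_top χ hχ))
  have hχ_Icc : ∀ᵐ t, t ∈ Icc (0 : ℝ) 1 → ‖c‖ₑ ≤ ‖(c • χ) t‖ₑ := by
    filter_upwards [AEEqFun.coeFn_smul c χ, hχ] with t hsmul hmk ht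
    rw [hsmul, Pi.smul_apply, hmk, indicator_of_mem ht, Pi.one_apply, smul_eq_mul, mul_one]
  have hexp_meas : Continuous fun x : ℝ => ((Real.sqrt 2 * Real.exp (-x) : ℝ) : ℂ) := by fun_prop
  set g : ℝ →ₘ[volPos] ℂ := AEEqFun.mk _ hexp_meas.aestronglyMeasurable
  have hg : ext0 g =ᵐ[volume] (Ioi (0 : ℝ)).indicator
      fun x => ((Real.sqrt 2 * Real.exp (-x) : ℝ) : ℂ) :=
    (coeFn_ext0 g).trans
      ((ae_eq_restrict_iff_indicator_ae_eq measurableSet_Ioi).1 (AEEqFun.coeFn_mk _ _))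
  have hg_le : ∀ᵐ x, ‖ext0 g x‖ₑ ≤ laplaceConv (‖(c • χ) ·‖ₑ) x := by
    filter_upwards [hg] with x hgx
    rw [hgx]
    by_cases hx : 0 < x
    · refine le_of_eq_of_le ?_ (exp_neg_sub_one_mul_le_laplaceConv hχ_Icc hx.le)
      rw [indicator_of_mem (mem_Ioi.2 hx), ← ofReal_norm, ← ofReal_norm,
        ← ENNReal.ofReal_mul (Real.exp_pos _).le, Complex.norm_real, Complex.norm_real,
        Real.norm_of_nonneg (by positivity), Real.norm_of_nonneg (by positivity), mul_left_comm,
        ← Real.exp_add, sub_add_cancel]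
    · simp [hx]
  refine ⟨X.rPlus (X.line.toSpace (ext0 g) (hN.rho_lt_top_of_le_laplaceConv hχ_rho hg_le)), ?_⟩
  filter_upwards [X.coeFn_incl_rPlus (X.line.toSpace _ _), ae_restrict_of_ae hg,
    ae_restrict_mem measurableSet_Ioi] with x hrestr hgx hx
  rw [hrestr, FunNorm.incl_toSpace, hgx, indicator_of_mem hx]

end WienerHopf

/-! ### Truncations -/

/-- The set of points `x ≤ n` where `|f| ≤ n`. -/
def truncSet (f : ℝ → ℂ) (n : ℕ) : Set ℝ := {x | ‖f x‖ ≤ n ∧ x ≤ n}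

theorem measurableSet_truncSet (f : ℝ →ₘ[volPos] ℂ) (n : ℕ) : MeasurableSet (truncSet f n) :=
  (measurableSet_le f.measurable.norm measurable_const).inter
    (measurableSet_le measurable_id measurable_const)

theorem truncSet_mono (f : ℝ → ℂ) : Monotone (truncSet f) := fun _ _ hmn _ hx =>
  ⟨hx.1.trans (Nat.cast_le.2 hmn), hx.2.trans (Nat.cast_le.2 hmn)⟩

theorem volPos_truncSet_lt_top (f : ℝ → ℂ) (n : ℕ) : volPos (truncSet f n) < ∞ := by
  rw [Measure.restrict_apply' measurableSet_Ioi]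
  have hsub : truncSet f n ∩ Ioi 0 ⊆ Ioc 0 (n : ℝ) := fun x hx => ⟨hx.2, hx.1.2⟩
  exact (measure_mono hsub).trans_lt measure_Ioc_lt_top

/-- The truncation of `f` to the set `truncSet f n`. -/
def trunc (f : ℝ →ₘ[volPos] ℂ) (n : ℕ) : ℝ →ₘ[volPos] ℂ :=
  AEEqFun.mk ((truncSet f n).indicator f)
    (f.aestronglyMeasurable.indicator (measurableSet_truncSet f n))

theorem eventually_mem_truncSet (f : ℝ → ℂ) (x : ℝ) : ∀ᶠ n in atTop, x ∈ truncSet f n :=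
  (tendsto_natCast_atTop_atTop.eventually_ge_atTop ‖f x‖).and
    (tendsto_natCast_atTop_atTop.eventually_ge_atTop x)

theorem coeFn_trunc (f : ℝ →ₘ[volPos] ℂ) (n : ℕ) :
    trunc f n =ᵐ[volPos] (truncSet f n).indicator f :=
  AEEqFun.coeFn_mk _ _

theorem coeFn_sub_trunc (f : ℝ →ₘ[volPos] ℂ) (n : ℕ) :
    (f - trunc f n : ℝ →ₘ[volPos] ℂ) =ᵐ[volPos] (truncSet f n)ᶜ.indicator f := by
  filter_upwards [coeFn_trunc f n, AEEqFun.coeFn_sub f (trunc f n)] with x htrunc hsub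
  rw [hsub, Pi.sub_apply, htrunc, indicator_compl, Pi.sub_apply]

theorem enorm_trunc_le (f : ℝ →ₘ[volPos] ℂ) (n : ℕ) :
    ∀ᵐ x ∂volPos, ‖trunc f n x‖ₑ ≤ ‖f x‖ₑ := by
  filter_upwards [coeFn_trunc f n] with x hx
  rw [hx]
  exact enorm_indicator_le_enorm_self _ _

theorem enorm_sub_trunc_le (f : ℝ →ₘ[volPos] ℂ) (n : ℕ) :
    ∀ᵐ x ∂volPos, ‖(f - trunc f n : ℝ →ₘ[volPos] ℂ) x‖ₑ ≤ ‖f x‖ₑ := by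
  filter_upwards [coeFn_sub_trunc f n] with x hx
  rw [hx]
  exact enorm_indicator_le_enorm_self _ _

theorem eventually_sub_trunc_eq_zero (f : ℝ →ₘ[volPos] ℂ) :
    ∀ᵐ x ∂volPos, ∀ᶠ n in atTop, (f - trunc f n : ℝ →ₘ[volPos] ℂ) x = 0 := by
  filter_upwards [ae_all_iff.2 fun n => coeFn_sub_trunc f n] with x hx
  filter_upwards [eventually_mem_truncSet f x] with n hn
  rw [hx n, indicator_of_notMem (notMem_compl_iff.2 hn)]

theorem tendsto_sub_trunc (f : ℝ →ₘ[volPos] ℂ) :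
    ∀ᵐ x ∂volPos, Tendsto (fun n => (f - trunc f n : ℝ →ₘ[volPos] ℂ) x) atTop (𝓝 0) :=
  (eventually_sub_trunc_eq_zero f).mono fun _ hx => EventuallyEq.tendsto hx

theorem memLp_trunc (f : ℝ →ₘ[volPos] ℂ) (n : ℕ) : MemLp (trunc f n) 2 volPos := by
  refine MemLp.ae_eq (coeFn_trunc f n).symm ?_
  rw [memLp_indicator_iff_restrict (measurableSet_truncSet f n)]
  have : IsFiniteMeasure (volPos.restrict (truncSet f n)) := by
    rw [isFiniteMeasure_restrict]
    exact (volPos_truncSet_lt_top f n).ne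
  refine MemLp.of_bound f.aestronglyMeasurable.restrict n ?_
  filter_upwards [ae_restrict_mem (measurableSet_truncSet f n)] with x hx
  exact hx.1

theorem dense_memLp_two_of_tendsto_trunc (N : FunNorm volPos)
    (hrho_le : ∀ f n, N.rho (trunc f n) ≤ N.rho f)
    (hlim : ∀ f, N.rho f < ∞ → Tendsto (fun n => N.rho (f - trunc f n)) atTop (𝓝 0)) :
    Dense {g : N.Space | MemLp (N.incl g) 2 volPos} := by
  intro f
  have hf := N.rho_incl_lt_top f
  refine mem_closure_of_tendsto
    (f := fun n => N.toSpace (trunc (N.incl f) n) ((hrho_le _ n).trans_lt hf)) (b := atTop) ?_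
    (Eventually.of_forall fun n => memLp_trunc (N.incl f) n)
  rw [tendsto_iff_norm_sub_tendsto_zero]
  refine ((ENNReal.tendsto_toReal ENNReal.zero_ne_top).comp (hlim _ hf)).congr fun n => ?_
  rw [norm_sub_rev, N.norm_def, map_sub, N.incl_toSpace, Function.comp_apply]

/-! ### Lorentz spaces -/

section Lorentz

variable {μ : Measure ℝ} {f g : ℝ → ℂ} {p q t : ℝ}

theorem ofReal_norm_sub_coe (z : ℂ) (c : ℝ≥0) : ENNReal.ofReal (‖z‖ - c) = ‖z‖ₑ - c := by
  rw [ENNReal.ofReal_sub _ c.coe_nonneg, ofReal_norm, ENNReal.ofReal_coe_nnreal]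

theorem distr_mono (h : ∀ᵐ x ∂μ, ‖f x‖ₑ ≤ ‖g x‖ₑ) (l : ℝ≥0) : distr μ f l ≤ distr μ g l := by
  refine measure_mono_ae ?_
  filter_upwards [h] with x hx
  exact fun (hl : l < ‖f x‖₊) => hl.trans_le (ENNReal.coe_le_coe.1 hx)

theorem rearrAvg_mono (h : ∀ᵐ x ∂μ, ‖f x‖ₑ ≤ ‖g x‖ₑ) (t : ℝ) : rearrAvg μ f t ≤ rearrAvg μ g t := by
  unfold rearrAvg
  gcongr
  exact le_iInf₂ fun l hl => rearr_le l ((distr_mono h l).trans hl)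

theorem inv_mul_lintegral_Ioo_const (ht : 0 < t) (c : ℝ≥0∞) :
    (ENNReal.ofReal t)⁻¹ * ∫⁻ _ in Ioo 0 t, c = c := by
  rw [setLIntegral_const, Real.volume_Ioo, sub_zero, mul_left_comm,
    ENNReal.inv_mul_cancel (by simpa using ht) ENNReal.ofReal_ne_top, mul_one]

theorem rearr_le_rearrAvg (ht : 0 < t) : rearr μ f t ≤ rearrAvg μ f t := by
  rw [← inv_mul_lintegral_Ioo_const ht (rearr μ f t), rearrAvg]
  gcongr 1
  exact setLIntegral_mono' measurableSet_Ioo fun s hs => rearr_antitone μ f hs.2.le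

theorem rearrAvg_le_add_excess (hf : AEStronglyMeasurable f μ) (ht : 0 < t) (l : ℝ≥0) :
    rearrAvg μ f t ≤ l + (ENNReal.ofReal t)⁻¹ * ∫⁻ x, (‖f x‖ₑ - l) ∂μ := by
  have h_inv : (ENNReal.ofReal t)⁻¹ * ENNReal.ofReal t = 1 :=
    ENNReal.inv_mul_cancel (by simpa using ht) ENNReal.ofReal_ne_top
  have hle := lintegral_rearr_le hf t l
  simp_rw [ofReal_norm_sub_coe] at hle
  calc rearrAvg μ f t
    _ ≤ (ENNReal.ofReal t)⁻¹ * (ENNReal.ofReal t * l + ∫⁻ x, (‖f x‖ₑ - l) ∂μ) := by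
        rw [rearrAvg]; gcongr
    _ = l + (ENNReal.ofReal t)⁻¹ * ∫⁻ x, (‖f x‖ₑ - l) ∂μ := by
        rw [mul_add, ← mul_assoc, h_inv, one_mul]

theorem add_excess_le_rearrAvg (hf : AEStronglyMeasurable f μ) (ht : 0 < t) {l : ℝ≥0}
    (hl : rearr μ f t = l) :
    l + (ENNReal.ofReal t)⁻¹ * ∫⁻ x, (‖f x‖ₑ - l) ∂μ ≤ rearrAvg μ f t := by
  have h_inv : (ENNReal.ofReal t)⁻¹ * ENNReal.ofReal t = 1 :=
    ENNReal.inv_mul_cancel (by simpa using ht) ENNReal.ofReal_ne_top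
  have hle := lintegral_rearr_eq hf hl
  simp_rw [ofReal_norm_sub_coe] at hle
  calc l + (ENNReal.ofReal t)⁻¹ * ∫⁻ x, (‖f x‖ₑ - l) ∂μ
    _ = (ENNReal.ofReal t)⁻¹ * (ENNReal.ofReal t * l + ∫⁻ x, (‖f x‖ₑ - l) ∂μ) := by
        rw [mul_add, ← mul_assoc, h_inv, one_mul]
    _ ≤ rearrAvg μ f t := by rw [rearrAvg]; gcongr

theorem exists_excess_lt_top_of_rearrAvg_lt_top (hf : AEStronglyMeasurable f μ) (ht : 0 < t)
    (h : rearrAvg μ f t < ∞) : ∃ c : ℝ≥0, ∫⁻ x, (‖f x‖ₑ - c) ∂μ < ∞ := by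
  have hrearr : rearr μ f t < ∞ := (rearr_le_rearrAvg ht).trans_lt h
  lift rearr μ f t to ℝ≥0 using hrearr.ne with c hc
  have hsum := (add_excess_le_rearrAvg hf ht hc.symm).trans_lt h
  exact ⟨c, ENNReal.lt_top_of_mul_ne_top_right (ENNReal.add_lt_top.1 hsum).2.ne
    (ENNReal.inv_ne_zero.2 ENNReal.ofReal_ne_top)⟩

theorem rearrAvg_le_of_le_laplaceConv {f g : ℝ →ₘ[volume] ℂ}
    (h : ∀ᵐ x, ‖g x‖ₑ ≤ laplaceConv (‖f ·‖ₑ) x) (ht : 0 < t) :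
    rearrAvg volume g t ≤ 2 * rearrAvg volume f t := by
  obtain hfin | hfin := eq_or_ne (rearr volume f t) ∞
  · have : rearrAvg volume f t = ∞ := top_le_iff.1 (hfin ▸ rearr_le_rearrAvg ht)
    simp [this]
  lift rearr volume f t to ℝ≥0 using hfin with l hl
  have hexcess : ∫⁻ x, (‖g x‖ₑ - (2 * l : ℝ≥0)) ≤ 2 * ∫⁻ x, (‖f x‖ₑ - l) := by
    rw [← lintegral_laplaceConv (f.measurable.enorm.sub_const _)]
    refine lintegral_mono_ae ?_
    filter_upwards [h] with x hx
    rw [tsub_le_iff_left, ENNReal.coe_mul, ENNReal.coe_ofNat]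
    exact hx.trans (laplaceConv_le_two_mul_add_laplaceConv_sub _ l x)
  calc rearrAvg volume g t
    _ ≤ (2 * l : ℝ≥0) + (ENNReal.ofReal t)⁻¹ * ∫⁻ x, (‖g x‖ₑ - (2 * l : ℝ≥0)) :=
        rearrAvg_le_add_excess g.aestronglyMeasurable ht (2 * l)
    _ ≤ (2 * l : ℝ≥0) + (ENNReal.ofReal t)⁻¹ * (2 * ∫⁻ x, (‖f x‖ₑ - l)) := by gcongr
    _ = 2 * (l + (ENNReal.ofReal t)⁻¹ * ∫⁻ x, (‖f x‖ₑ - l)) := by push_cast; ring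
    _ ≤ 2 * rearrAvg volume f t := by
        gcongr
        exact add_excess_le_rearrAvg f.aestronglyMeasurable ht hl.symm

theorem lorentzRho_eq_lintegral_rpow (hq : 0 < q) :
    lorentzRho μ p q f =
      (∫⁻ t in Ioi (0 : ℝ), ENNReal.ofReal (t ^ (q / p - 1)) * rearrAvg μ f t ^ q) ^ (1 / q) := by
  rw [lorentzRho]
  congr 1
  refine setLIntegral_congr_fun measurableSet_Ioi fun t (ht : 0 < t) => ?_
  rw [ENNReal.mul_rpow_of_nonneg _ _ hq.le, ENNReal.ofReal_rpow_of_nonneg (by positivity) hq.le,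
    ← Real.rpow_mul ht.le, ← ENNReal.ofReal_inv_of_pos ht, mul_right_comm,
    ← ENNReal.ofReal_mul (by positivity), Real.rpow_sub_one ht.ne', one_div, mul_comm p⁻¹ q,
    ← div_eq_mul_inv, ← div_eq_mul_inv]

theorem lorentzRho_lt_top_iff (hq : 0 < q) :
    lorentzRho μ p q f < ∞ ↔
      ∫⁻ t in Ioi (0 : ℝ), ENNReal.ofReal (t ^ (q / p - 1)) * rearrAvg μ f t ^ q < ∞ := by
  rw [lorentzRho_eq_lintegral_rpow hq, ENNReal.rpow_lt_top_iff_of_pos (by positivity)]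

theorem measurable_ofReal_rpow_mul_rearrAvg_rpow (μ : Measure ℝ) (f : ℝ → ℂ) (s q : ℝ) :
    Measurable fun t : ℝ => ENNReal.ofReal (t ^ s) * rearrAvg μ f t ^ q := by
  have := measurable_rearrAvg μ f
  fun_prop

theorem lorentzRho_le_const_mul {ν : Measure ℝ} (hq : 0 < q) (c : ℝ≥0)
    (h : ∀ t, 0 < t → rearrAvg μ g t ≤ c * rearrAvg ν f t) :
    lorentzRho μ p q g ≤ c * lorentzRho ν p q f := by
  have hq_inv : 0 ≤ 1 / q := by positivity
  rw [lorentzRho_eq_lintegral_rpow hq, lorentzRho_eq_lintegral_rpow hq]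
  set I := ∫⁻ t in Ioi (0 : ℝ), ENNReal.ofReal (t ^ (q / p - 1)) * rearrAvg ν f t ^ q with hI
  calc (∫⁻ t in Ioi (0 : ℝ), ENNReal.ofReal (t ^ (q / p - 1)) * rearrAvg μ g t ^ q) ^ (1 / q)
    _ ≤ ((c : ℝ≥0∞) ^ q * I) ^ (1 / q) := by
        gcongr
        rw [hI, ← lintegral_const_mul' _ _ (ENNReal.rpow_ne_top_of_nonneg hq.le ENNReal.coe_ne_top)]
        refine setLIntegral_mono' measurableSet_Ioi fun t ht => ?_
        rw [mul_left_comm, ← ENNReal.mul_rpow_of_nonneg _ _ hq.le]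
        gcongr
        exact h t ht
    _ = c * I ^ (1 / q) := by
        rw [ENNReal.mul_rpow_of_nonneg _ _ hq_inv, ← ENNReal.rpow_mul, mul_one_div_cancel hq.ne',
          ENNReal.rpow_one]

theorem rearrAvg_lt_top_of_lorentzRho_lt_top (hq : 0 < q) (hf : lorentzRho μ p q f < ∞) :
    ∀ᵐ t ∂volPos, rearrAvg μ f t < ∞ := by
  rw [lorentzRho_lt_top_iff hq] at hf
  filter_upwards [ae_lt_top (measurable_ofReal_rpow_mul_rearrAvg_rpow μ f _ q) hf.ne,
    ae_restrict_mem measurableSet_Ioi] with t hfin ht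
  have ht_rpow : 0 < t ^ (q / p - 1) := Real.rpow_pos_of_pos ht _
  exact (ENNReal.rpow_lt_top_iff_of_pos hq).1
    (ENNReal.lt_top_of_mul_ne_top_right hfin.ne (by simpa using ht_rpow))

theorem lintegral_Ioc_rpow_mul_rearrAvg_lt_top (hp : 0 < p) (hq : 0 < q)
    (hf : AEStronglyMeasurable f μ) {c : ℝ≥0} (hbound : ∀ᵐ x ∂μ, ‖f x‖ₑ ≤ c) :
    ∫⁻ t in Ioc (0 : ℝ) 1, ENNReal.ofReal (t ^ (q / p - 1)) * rearrAvg μ f t ^ q < ∞ := by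
  have hexcess : ∫⁻ x, (‖f x‖ₑ - c) ∂μ = 0 := by
    rw [← lintegral_zero (μ := μ)]
    exact lintegral_congr_ae (hbound.mono fun x hx => tsub_eq_zero_of_le hx)
  have hrpow : IntegrableOn (fun t : ℝ => t ^ (q / p - 1)) (Ioc 0 1) :=
    (intervalIntegrable_iff_integrableOn_Ioc_of_le zero_le_one).1
      (intervalIntegral.intervalIntegrable_rpow' (by linarith [div_pos hq hp]))
  calc ∫⁻ t in Ioc (0 : ℝ) 1, ENNReal.ofReal (t ^ (q / p - 1)) * rearrAvg μ f t ^ q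
    _ ≤ ∫⁻ t in Ioc (0 : ℝ) 1, ENNReal.ofReal (t ^ (q / p - 1)) * (c : ℝ≥0∞) ^ q := by
        refine setLIntegral_mono' measurableSet_Ioc fun t ht => ?_
        gcongr
        simpa [hexcess] using rearrAvg_le_add_excess hf ht.1 c
    _ = (∫⁻ t in Ioc (0 : ℝ) 1, ENNReal.ofReal (t ^ (q / p - 1))) * (c : ℝ≥0∞) ^ q :=
        lintegral_mul_const _ (by fun_prop)
    _ < ∞ := ENNReal.mul_lt_top hrpow.lintegral_lt_top
        (ENNReal.rpow_lt_top_of_nonneg hq.le ENNReal.coe_ne_top)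

theorem lintegral_Ioi_rpow_mul_rearrAvg_lt_top (hp : 1 < p) (hq : 0 < q)
    (hf : AEStronglyMeasurable f μ) (hInt : ∫⁻ x, ‖f x‖ₑ ∂μ < ∞) :
    ∫⁻ t in Ioi (1 : ℝ), ENNReal.ofReal (t ^ (q / p - 1)) * rearrAvg μ f t ^ q < ∞ := by
  set I := ∫⁻ x, ‖f x‖ₑ ∂μ
  have hrpow : IntegrableOn (fun t : ℝ => t ^ (q / p - 1 - q)) (Ioi 1) :=
    integrableOn_Ioi_rpow_of_lt (by linarith [div_lt_self hq hp]) zero_lt_one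
  calc ∫⁻ t in Ioi (1 : ℝ), ENNReal.ofReal (t ^ (q / p - 1)) * rearrAvg μ f t ^ q
    _ ≤ ∫⁻ t in Ioi (1 : ℝ), ENNReal.ofReal (t ^ (q / p - 1 - q)) * I ^ q := by
        refine setLIntegral_mono' measurableSet_Ioi fun t (ht : 1 < t) => ?_
        have ht_pos : 0 < t := zero_lt_one.trans ht
        have havg : rearrAvg μ f t ≤ ENNReal.ofReal t⁻¹ * I := by
          simpa [ENNReal.ofReal_inv_of_pos ht_pos] using rearrAvg_le_add_excess hf ht_pos 0
        calc ENNReal.ofReal (t ^ (q / p - 1)) * rearrAvg μ f t ^ q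
          _ ≤ ENNReal.ofReal (t ^ (q / p - 1)) * (ENNReal.ofReal t⁻¹ * I) ^ q := by gcongr
          _ = ENNReal.ofReal (t ^ (q / p - 1 - q)) * I ^ q := by
              rw [ENNReal.mul_rpow_of_nonneg _ _ hq.le, ← mul_assoc,
                ENNReal.ofReal_rpow_of_nonneg (by positivity) hq.le,
                ← ENNReal.ofReal_mul (by positivity), Real.inv_rpow ht_pos.le,
                Real.rpow_sub ht_pos _ q, div_eq_mul_inv _ (t ^ q)]
    _ = (∫⁻ t in Ioi (1 : ℝ), ENNReal.ofReal (t ^ (q / p - 1 - q))) * I ^ q :=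
        lintegral_mul_const _ (by fun_prop)
    _ < ∞ := ENNReal.mul_lt_top hrpow.lintegral_lt_top
        (ENNReal.rpow_lt_top_of_nonneg hq.le hInt.ne)

theorem lorentzRho_lt_top_of_bounded_of_integrable (hp : 1 < p) (hq : 0 < q)
    (hf : AEStronglyMeasurable f μ) {c : ℝ≥0} (hbound : ∀ᵐ x ∂μ, ‖f x‖ₑ ≤ c)
    (hInt : ∫⁻ x, ‖f x‖ₑ ∂μ < ∞) : lorentzRho μ p q f < ∞ := by
  rw [lorentzRho_lt_top_iff hq, ← Ioc_union_Ioi_eq_Ioi (zero_le_one (α := ℝ)),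
    lintegral_union measurableSet_Ioi (Ioc_disjoint_Ioi le_rfl)]
  exact ENNReal.add_lt_top.2
    ⟨lintegral_Ioc_rpow_mul_rearrAvg_lt_top (zero_lt_one.trans hp) hq hf hbound,
      lintegral_Ioi_rpow_mul_rearrAvg_lt_top hp hq hf hInt⟩

theorem isConvBounded_lorentz (hp : 1 < p) (hq : 1 < q) :
    IsConvBounded (lorentz p q hq).line where
  exists_excess_lt_top f hf := by
    have : (ae volPos).NeBot := by
      rw [ae_neBot, Ne, Measure.restrict_eq_zero, Real.volume_Ioi]
      exact ENNReal.top_ne_zero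
    obtain ⟨t, hfin, ht⟩ := ((rearrAvg_lt_top_of_lorentzRho_lt_top (by linarith) hf).and
      (ae_restrict_mem measurableSet_Ioi)).exists
    exact exists_excess_lt_top_of_rearrAvg_lt_top f.aestronglyMeasurable ht hfin
  exists_bound := ⟨2, fun _ _ _ h => lorentzRho_le_const_mul (by linarith) 2 fun _ ht => by
    exact_mod_cast rearrAvg_le_of_le_laplaceConv h ht⟩
  rho_indicator_lt_top f hf := by
    have henorm : (‖f ·‖ₑ) =ᵐ[volume] (Icc (0 : ℝ) 1).indicator 1 := by
      filter_upwards [hf] with x hx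
      by_cases hmem : x ∈ Icc (0 : ℝ) 1 <;> simp [hx, hmem]
    refine lorentzRho_lt_top_of_bounded_of_integrable hp (by linarith) f.aestronglyMeasurable
      (c := 1) ?_ ?_
    · filter_upwards [henorm] with x hx
      rw [hx]
      exact indicator_le_self' (fun _ _ => zero_le_one) x
    · rw [lintegral_congr_ae henorm, lintegral_indicator_one measurableSet_Icc, Real.volume_Icc]
      exact ENNReal.ofReal_lt_top

theorem le_rearr_of_distr_eq_top {l : ℝ≥0} (h : distr μ f l = ∞) : (l : ℝ≥0∞) ≤ rearr μ f t := by
  refine le_iInf₂ fun m hm => ?_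
  by_contra! hlt
  have htop : distr μ f l ≤ ENNReal.ofReal t :=
    (distr_antitone μ f (ENNReal.coe_lt_coe.1 hlt).le).trans hm
  exact ENNReal.ofReal_ne_top (top_le_iff.1 (h ▸ htop))

theorem lintegral_Ioi_rpow (s : ℝ) : ∫⁻ t in Ioi (0 : ℝ), ENNReal.ofReal (t ^ s) = ∞ := by
  by_contra hfin
  refine not_integrableOn_Ioi_rpow s ⟨by fun_prop, ?_⟩
  rw [hasFiniteIntegral_iff_ofReal]
  · exact lt_top_iff_ne_top.2 hfin
  · filter_upwards [ae_restrict_mem measurableSet_Ioi] with t ht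
    exact Real.rpow_nonneg (le_of_lt ht) s

theorem distr_lt_top_of_lorentzRho_lt_top (hq : 0 < q) (hf : lorentzRho μ p q f < ∞) {l : ℝ≥0}
    (hl : 0 < l) : distr μ f l < ∞ := by
  rw [lorentzRho_lt_top_iff hq] at hf
  by_contra! htop
  refine hf.not_ge ?_
  calc ∞
    _ = (∫⁻ t in Ioi (0 : ℝ), ENNReal.ofReal (t ^ (q / p - 1))) * (l : ℝ≥0∞) ^ q := by
        rw [lintegral_Ioi_rpow, ENNReal.top_mul]
        simp [hl.ne']
    _ = ∫⁻ t in Ioi (0 : ℝ), ENNReal.ofReal (t ^ (q / p - 1)) * (l : ℝ≥0∞) ^ q :=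
        (lintegral_mul_const _ (by fun_prop)).symm
    _ ≤ ∫⁻ t in Ioi (0 : ℝ), ENNReal.ofReal (t ^ (q / p - 1)) * rearrAvg μ f t ^ q := by
        refine setLIntegral_mono' measurableSet_Ioi fun t ht => ?_
        gcongr
        exact (le_rearr_of_distr_eq_top (top_le_iff.1 htop)).trans (rearr_le_rearrAvg ht)

section DominatedConvergence

variable {u : ℕ → ℝ → ℂ} (hle : ∀ n, ∀ᵐ x ∂μ, ‖u n x‖ₑ ≤ ‖f x‖ₑ)

include hle

theorem tendsto_distr_zero (hf : AEStronglyMeasurable f μ) (hu : ∀ n, AEStronglyMeasurable (u n) μ)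
    (hlim : ∀ᵐ x ∂μ, Tendsto (u · x) atTop (𝓝 0)) {l : ℝ≥0} (hl : 0 < l)
    (hfin : distr μ f l < ∞) : Tendsto (fun n => distr μ (u n) l) atTop (𝓝 0) := by
  have hmeas {v : ℝ → ℂ} (hv : AEStronglyMeasurable v μ) : NullMeasurableSet {x | l < ‖v x‖₊} μ :=
    nullMeasurableSet_lt aemeasurable_const hv.nnnorm.aemeasurable
  have hdistr {v : ℝ → ℂ} (hv : AEStronglyMeasurable v μ) :
      distr μ v l = ∫⁻ x, {x | l < ‖v x‖₊}.indicator 1 x ∂μ :=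
    (lintegral_indicator_one₀ (hmeas hv)).symm
  simp_rw [hdistr (hu _)]
  rw [← lintegral_zero (μ := μ)]
  refine tendsto_lintegral_of_dominated_convergence' ({x | l < ‖f x‖₊}.indicator 1)
    (fun n => aemeasurable_const.indicator₀ (hmeas (hu n))) (fun n => ?_)
    (hdistr hf ▸ hfin.ne) ?_
  · filter_upwards [hle n] with x hx
    refine indicator_apply_le fun hmem : l < ‖u n x‖₊ => ?_
    simp [hmem.trans_le (ENNReal.coe_le_coe.1 hx)]
  · filter_upwards [hlim] with x hx
    have hnorm : Tendsto (fun n => ‖u n x‖₊) atTop (𝓝 0) := by simpa using hx.nnnorm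
    refine tendsto_const_nhds.congr' ?_
    filter_upwards [hnorm.eventually (ge_mem_nhds hl)] with n hn
    simp [not_lt.2 hn]

theorem tendsto_rearrAvg_zero
    (hdistr : ∀ l : ℝ≥0, 0 < l → Tendsto (fun n => distr μ (u n) l) atTop (𝓝 0)) (ht : 0 < t)
    (hfin : rearrAvg μ f t < ∞) : Tendsto (fun n => rearrAvg μ (u n) t) atTop (𝓝 0) := by
  have hinv : (ENNReal.ofReal t)⁻¹ ≠ ∞ := by simpa using ht
  rw [rearrAvg] at hfin
  have hInt := ENNReal.lt_top_of_mul_ne_top_right hfin.ne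
    (ENNReal.inv_ne_zero.2 ENNReal.ofReal_ne_top)
  rw [lintegral_rearr] at hInt
  have hlim : Tendsto (fun n => ∫⁻ s in Ioo 0 t, rearr μ (u n) s) atTop (𝓝 0) := by
    simp_rw [lintegral_rearr]
    rw [← lintegral_zero (μ := volPos)]
    refine tendsto_lintegral_of_dominated_convergence _
      (fun n => (distr_toNNReal_antitone μ (u n)).measurable.min measurable_const)
      (fun n => ae_of_all _ fun l => min_le_min_right _ (distr_mono (hle n) _)) hInt.ne ?_
    filter_upwards [ae_restrict_mem measurableSet_Ioi] with l hl
    simpa using (hdistr _ (Real.toNNReal_pos.2 hl)).min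
      (tendsto_const_nhds (x := ENNReal.ofReal t))
  simpa [rearrAvg] using ENNReal.Tendsto.const_mul hlim (Or.inr hinv)

theorem tendsto_lorentzRho_zero (hq : 0 < q) (hf : AEStronglyMeasurable f μ)
    (hu : ∀ n, AEStronglyMeasurable (u n) μ) (hlim : ∀ᵐ x ∂μ, Tendsto (u · x) atTop (𝓝 0))
    (hfin : lorentzRho μ p q f < ∞) :
    Tendsto (fun n => lorentzRho μ p q (u n)) atTop (𝓝 0) := by
  have hdistr (l : ℝ≥0) (hl : 0 < l) : Tendsto (fun n => distr μ (u n) l) atTop (𝓝 0) :=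
    tendsto_distr_zero hle hf hu hlim hl (distr_lt_top_of_lorentzRho_lt_top hq hfin hl)
  have havg := rearrAvg_lt_top_of_lorentzRho_lt_top hq hfin
  rw [lorentzRho_lt_top_iff hq] at hfin
  have hInt : Tendsto (fun n => ∫⁻ t in Ioi (0 : ℝ),
      ENNReal.ofReal (t ^ (q / p - 1)) * rearrAvg μ (u n) t ^ q) atTop (𝓝 0) := by
    rw [← lintegral_zero (μ := volPos)]
    refine tendsto_lintegral_of_dominated_convergence _
      (fun n => measurable_ofReal_rpow_mul_rearrAvg_rpow μ (u n) _ q)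
      (fun n => ae_of_all _ fun t =>
        mul_le_mul_right (ENNReal.rpow_le_rpow (rearrAvg_mono (hle n) t) hq.le) _) hfin.ne ?_
    filter_upwards [havg, ae_restrict_mem measurableSet_Ioi] with t hfin_t ht
    simpa [ENNReal.zero_rpow_of_pos hq] using ENNReal.Tendsto.const_mul
      ((tendsto_rearrAvg_zero hle hdistr ht hfin_t).ennrpow_const q) (Or.inr ENNReal.ofReal_ne_top)
  simp_rw [lorentzRho_eq_lintegral_rpow hq]
  simpa [ENNReal.zero_rpow_of_pos, hq] using hInt.ennrpow_const (1 / q)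

end DominatedConvergence

theorem dense_memLp_two_lorentz (hq : 1 < q) :
    Dense {g : (lorentz p q hq).half.Space | MemLp ((lorentz p q hq).half.incl g) 2 volPos} :=
  dense_memLp_two_of_tendsto_trunc _
    (fun f n => lorentzRho_mono (by linarith) (distr_mono (enorm_trunc_le f n)))
    fun f hf => tendsto_lorentzRho_zero (fun n => enorm_sub_trunc_le f n) (by linarith)
      f.aestronglyMeasurable (fun n => (f - trunc f n).aestronglyMeasurable)
      (tendsto_sub_trunc f) hf

end Lorentz

/-! ### Luxemburg norms -/

section Luxemburg

variable {μ : Measure ℝ} {M : ℝ → ℝ≥0∞ → ℝ≥0∞}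

theorem le_mul_luxemburg {g : ℝ → ℝ≥0∞} {a C : ℝ≥0∞} (hC : C ≠ 0) (hC' : C ≠ ∞)
    (h : ∀ l : ℝ≥0, 0 < l → ∫⁻ x, M x (g x / l) ∂μ ≤ 1 → a ≤ C * l) :
    a ≤ C * luxemburg μ M g := by
  simp_rw [luxemburg, ENNReal.mul_iInf_of_ne hC hC']
  exact le_iInf₂ fun l hl => h l hl.1 hl.2

theorem le_mul_add_of_le_add {c l : ℝ≥0} (hl : 0 < l) {x : ℝ} (hM : ∀ t, t ≤ c + M x t)
    (t : ℝ≥0∞) : t ≤ l * c + l * M x (t / l) := by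
  rw [← mul_add, ← ENNReal.div_le_iff' (by simpa using hl.ne') ENNReal.coe_ne_top]
  exact hM _

namespace IsModular

theorem luxemburg_mono_of_le (hM : IsModular μ M) {g h : ℝ → ℝ≥0∞} (hgh : ∀ᵐ x ∂μ, g x ≤ h x) :
    luxemburg μ M g ≤ luxemburg μ M h := by
  refine luxemburg_mono fun l _ => lintegral_mono_ae ?_
  filter_upwards [hM.mono, hgh] with x hmono hx
  exact hmono (ENNReal.div_le_div_right hx _)

theorem exists_excess_lt_top (hM : IsModular μ M) {c : ℝ≥0} (hc : ∀ᵐ x ∂μ, ∀ t, t ≤ c + M x t)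
    {f : ℝ →ₘ[μ] ℂ} (hf : hM.norm.rho f < ∞) : ∃ c : ℝ≥0, ∫⁻ x, (‖f x‖ₑ - c) ∂μ < ∞ := by
  obtain ⟨l, hl, hfin⟩ := (hM.luxemburg_lt_top_iff _).1 hf
  refine ⟨l * c, ?_⟩
  calc ∫⁻ x, (‖f x‖ₑ - (l * c : ℝ≥0)) ∂μ
    _ ≤ ∫⁻ x, l * M x (‖f x‖ₑ / l) ∂μ := by
        refine lintegral_mono_ae ?_
        filter_upwards [hc] with x hx
        rw [tsub_le_iff_left, ENNReal.coe_mul]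
        exact le_mul_add_of_le_add hl hx _
    _ = l * ∫⁻ x, M x (‖f x‖ₑ / l) ∂μ := lintegral_const_mul' _ _ ENNReal.coe_ne_top
    _ < ∞ := ENNReal.mul_lt_top ENNReal.coe_lt_top hfin

theorem rho_indicator_one_lt_top (hM : IsModular μ M) {s : Set ℝ} (hs : MeasurableSet s) {l : ℝ≥0}
    (hl : 0 < l) (hfin : ∫⁻ x in s, M x l ∂μ < ∞) {f : ℝ →ₘ[μ] ℂ} (hf : f =ᵐ[μ] s.indicator 1) :
    hM.norm.rho f < ∞ := by
  refine (hM.luxemburg_lt_top_iff _).2 ⟨l⁻¹, inv_pos.2 hl, ?_⟩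
  rw [← lintegral_indicator hs] at hfin
  refine (lintegral_congr_ae ?_).trans_lt hfin
  filter_upwards [hf, hM.zero] with x hx hzero
  by_cases hmem : x ∈ s <;> simp [hx, hmem, hzero, ENNReal.coe_inv hl.ne']

theorem tendsto_rho_zero (hM : IsModular μ M) {u : ℕ → ℝ →ₘ[μ] ℂ} {f : ℝ →ₘ[μ] ℂ}
    (hle : ∀ n, ∀ᵐ x ∂μ, ‖u n x‖ₑ ≤ ‖f x‖ₑ) (hzero : ∀ᵐ x ∂μ, ∀ᶠ n in atTop, u n x = 0)
    (hfin : ∀ l : ℝ≥0, 0 < l → ∫⁻ x, M x (‖f x‖ₑ / l) ∂μ < ∞) :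
    Tendsto (fun n => hM.norm.rho (u n)) atTop (𝓝 0) := by
  rw [ENNReal.tendsto_nhds_zero]
  intro ε hε
  obtain ⟨l, hl, hlε⟩ := ENNReal.lt_iff_exists_nnreal_btwn.1 hε
  rw [ENNReal.coe_pos] at hl
  have hlim : Tendsto (fun n => ∫⁻ x, M x (‖u n x‖ₑ / l) ∂μ) atTop (𝓝 0) := by
    rw [← lintegral_zero (μ := μ)]
    refine tendsto_lintegral_of_dominated_convergence' _
      (fun n => hM.meas _ ((u n).aestronglyMeasurable.enorm.div_const _)) (fun n => ?_)
      (hfin l hl).ne ?_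
    · filter_upwards [hM.mono, hle n] with x hmono hx
      exact hmono (ENNReal.div_le_div_right hx _)
    · filter_upwards [hM.zero, hzero] with x hM_zero hx
      refine EventuallyEq.tendsto (hx.mono fun n hn => ?_)
      simp [hn, hM_zero]
  filter_upwards [hlim.eventually (gt_mem_nhds zero_lt_one)] with n hn
  exact (luxemburg_le l hl hn.le).trans hlε.le

theorem lintegral_div_lt_top_of_doubling (hM : IsModular μ M)
    (hdoubling : ∀ c : ℝ≥0, ∃ C : ℝ≥0, ∀ᵐ x ∂μ, ∀ t, M x (c * t) ≤ C * M x t) {g : ℝ → ℝ≥0∞}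
    (hg : luxemburg μ M g < ∞) {l : ℝ≥0} (hl : 0 < l) : ∫⁻ x, M x (g x / l) ∂μ < ∞ := by
  obtain ⟨k, hk, hfin⟩ := (hM.luxemburg_lt_top_iff g).1 hg
  obtain ⟨C, hC⟩ := hdoubling (k / l)
  have hdiv (t : ℝ≥0∞) : t / l = (k / l : ℝ≥0) * (t / k) := by
    rw [ENNReal.coe_div hl.ne', ENNReal.div_eq_inv_mul, ENNReal.div_eq_inv_mul,
      ENNReal.div_eq_inv_mul, mul_assoc, ← mul_assoc (k : ℝ≥0∞),
      ENNReal.mul_inv_cancel (by simpa using hk.ne') ENNReal.coe_ne_top, one_mul]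
  calc ∫⁻ x, M x (g x / l) ∂μ
    _ ≤ ∫⁻ x, C * M x (g x / k) ∂μ := by
        refine lintegral_mono_ae ?_
        filter_upwards [hC] with x hx
        rw [hdiv]
        exact hx _
    _ = C * ∫⁻ x, M x (g x / k) ∂μ := lintegral_const_mul' _ _ ENNReal.coe_ne_top
    _ < ∞ := ENNReal.mul_lt_top ENNReal.coe_lt_top hfin

theorem dense_memLp_two_of_doubling (hM : IsModular volPos M)
    (hdoubling : ∀ c : ℝ≥0, ∃ C : ℝ≥0, ∀ᵐ x ∂volPos, ∀ t, M x (c * t) ≤ C * M x t) :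
    Dense {g : hM.norm.Space | MemLp (hM.norm.incl g) 2 volPos} :=
  dense_memLp_two_of_tendsto_trunc _ (fun f n => hM.luxemburg_mono_of_le (enorm_trunc_le f n))
    fun f hf => hM.tendsto_rho_zero (enorm_sub_trunc_le f) (eventually_sub_trunc_eq_zero f)
      fun _ hl => hM.lintegral_div_lt_top_of_doubling hdoubling hf hl

end IsModular

end Luxemburg

/-! ### Variable Lebesgue spaces -/

section Maximal

theorem lintegral_Icc_le_maximal (f : ℝ → ℂ) (x : ℝ) {s : ℝ} (hs : 0 < s) :
    ∫⁻ t in Icc (x - s) (x + s), ‖f t‖ₑ ≤ ENNReal.ofReal (2 * s) * maximal f x := by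
  have havg : (∫⁻ t in Icc (x - s) (x + s), ‖f t‖ₑ) / ENNReal.ofReal (x + s - (x - s)) ≤
      maximal f x :=
    le_iSup₂_of_le (x - s) (x + s) <| le_iSup₂_of_le (by linarith) ⟨by linarith, by linarith⟩ le_rfl
  rw [add_sub_sub_cancel, ← two_mul] at havg
  rwa [ENNReal.div_le_iff' (by simpa using hs) ENNReal.ofReal_ne_top] at havg

theorem lintegral_ofReal_neg_log_lt_top :
    ∫⁻ s in Ioi (0 : ℝ), ENNReal.ofReal (2 * -Real.log s) < ∞ := by
  have hlog : IntegrableOn (fun s => 2 * -Real.log s) (Ioc 0 1) :=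
    ((intervalIntegrable_iff_integrableOn_Ioc_of_le zero_le_one).1
      intervalIntegral.intervalIntegrable_log').neg.const_mul 2
  have hzero : ∫⁻ s in Ioi (1 : ℝ), ENNReal.ofReal (2 * -Real.log s) = 0 :=
    setLIntegral_eq_zero measurableSet_Ioi fun s (hs : 1 < s) =>
      ENNReal.ofReal_of_nonpos (by linarith [Real.log_pos hs])
  rw [← Ioc_union_Ioi_eq_Ioi (zero_le_one (α := ℝ)),
    lintegral_union measurableSet_Ioi (Ioc_disjoint_Ioi le_rfl), hzero, add_zero]
  exact hlog.lintegral_lt_top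

theorem exists_laplaceConv_le_mul_maximal :
    ∃ C : ℝ≥0, ∀ f : ℝ → ℂ, Measurable f → ∀ x, laplaceConv (‖f ·‖ₑ) x ≤ C * maximal f x := by
  lift ∫⁻ s in Ioi (0 : ℝ), ENNReal.ofReal (2 * -Real.log s) to ℝ≥0
    using lintegral_ofReal_neg_log_lt_top.ne with C hC
  refine ⟨C, fun f hf x => ?_⟩
  set ν := volume.withDensity (‖f ·‖ₑ)
  have hν (s : ℝ) (hs : 0 < s) :
      ν {t | s < Real.exp (-|x - t|)} ≤ ENNReal.ofReal (2 * -Real.log s) * maximal f x := by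
    obtain hs' | hs' := le_or_gt 1 s
    · have : {t | s < Real.exp (-|x - t|)} = ∅ := eq_empty_of_forall_notMem fun t (ht : s < _) =>
        (hs'.trans_lt ht).not_ge (by simp)
      simp [this]
    have hsub : {t | s < Real.exp (-|x - t|)} ⊆ Icc (x - -Real.log s) (x + -Real.log s) := by
      intro t (ht : s < _)
      rw [← Real.log_lt_iff_lt_exp hs, lt_neg, abs_lt] at ht
      exact ⟨by linarith, by linarith⟩
    calc ν {t | s < Real.exp (-|x - t|)}
      _ ≤ ν (Icc (x - -Real.log s) (x + -Real.log s)) := measure_mono hsub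
      _ = ∫⁻ t in Icc (x - -Real.log s) (x + -Real.log s), ‖f t‖ₑ :=
          withDensity_apply _ measurableSet_Icc
      _ ≤ ENNReal.ofReal (2 * -Real.log s) * maximal f x :=
          lintegral_Icc_le_maximal f x (neg_pos.2 (Real.log_neg hs hs'))
  calc laplaceConv (‖f ·‖ₑ) x
    _ = ∫⁻ t, laplaceKernel (x - t) ∂ν := by
        rw [lintegral_withDensity_eq_lintegral_mul _ hf.enorm (by fun_prop)]
        simp only [laplaceConv, Pi.mul_apply, mul_comm]
    _ = ∫⁻ s in Ioi (0 : ℝ), ν {t | s < Real.exp (-|x - t|)} :=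
        lintegral_eq_lintegral_meas_lt ν (ae_of_all _ fun t => (Real.exp_pos _).le) (by fun_prop)
    _ ≤ ∫⁻ s in Ioi (0 : ℝ), ENNReal.ofReal (2 * -Real.log s) * maximal f x :=
        setLIntegral_mono' measurableSet_Ioi hν
    _ = C * maximal f x := by rw [lintegral_mul_const _ (by fun_prop), hC]

end Maximal

section VariableLebesgue

variable {p : ℝ → ℝ≥0∞}

theorem IsExponent.le_one_add_powExp (hp : IsExponent p) :
    ∀ᵐ x, ∀ t, t ≤ (1 : ℝ≥0) + powExp p x t := by
  filter_upwards [hp.finite] with x hx t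
  have hone_le : 1 ≤ (p x).toReal := by simpa using ENNReal.toReal_mono hx.ne (hp.one_le x)
  obtain ht | ht := le_total t 1
  · exact ht.trans (by simp)
  · calc t
      _ = t ^ (1 : ℝ) := (ENNReal.rpow_one t).symm
      _ ≤ powExp p x t := ENNReal.rpow_le_rpow_of_exponent_le ht hone_le
      _ ≤ (1 : ℝ≥0) + powExp p x t := le_add_self

theorem powExp_mul_le_of_essSup_lt_top (hp : essSup p volume < ∞) (c : ℝ≥0) :
    ∃ C : ℝ≥0, ∀ᵐ x, ∀ t, powExp p x (c * t) ≤ C * powExp p x t := by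
  refine ⟨max 1 c ^ (essSup p volume).toReal, ?_⟩
  filter_upwards [ENNReal.ae_le_essSup p] with x hx t
  rw [ENNReal.coe_rpow_of_nonneg _ ENNReal.toReal_nonneg, powExp, powExp,
    ENNReal.mul_rpow_of_nonneg _ _ ENNReal.toReal_nonneg]
  gcongr
  calc (c : ℝ≥0∞) ^ (p x).toReal
    _ ≤ (max 1 c : ℝ≥0) ^ (p x).toReal := by gcongr; exact le_max_right 1 c
    _ ≤ (max 1 c : ℝ≥0) ^ (essSup p volume).toReal :=
        ENNReal.rpow_le_rpow_of_exponent_le (by exact_mod_cast le_max_left 1 c)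
          (ENNReal.toReal_mono hp.ne hx)

theorem isConvBounded_varLebesgue (hp : IsExponent p) (hM : IsBM p hp) :
    IsConvBounded (varLebesgue p hp).line where
  exists_excess_lt_top _ hf := hp.isModular.exists_excess_lt_top hp.le_one_add_powExp hf
  exists_bound := by
    obtain ⟨C, hC⟩ := exists_laplaceConv_le_mul_maximal
    obtain ⟨D, hD⟩ := hM.maximal_bounded
    refine ⟨C * D, fun f g hf hg => ?_⟩
    calc (varLebesgue p hp).line.rho g
      _ ≤ luxemburg volume (powExp p) fun x => C * maximal f x :=
          hp.isModular.luxemburg_mono_of_le (hg.mono fun x hx => hx.trans (hC f f.measurable x))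
      _ ≤ C * luxemburg volume (powExp p) (maximal f) := hp.isModular.luxemburg_smul C _
      _ ≤ C * (D * (varLebesgue p hp).line.rho f) := by
          gcongr
          exact hD ((varLebesgue p hp).line.toSpace f hf)
      _ = (C * D : ℝ≥0) * (varLebesgue p hp).line.rho f := by rw [ENNReal.coe_mul, mul_assoc]
  rho_indicator_lt_top _ hf :=
    hp.isModular.rho_indicator_one_lt_top measurableSet_Icc one_pos (by simp [powExp]) hf

theorem dense_memLp_two_varLebesgue (hp : IsExponent p) (hfin : essSup p volume < ∞) :
    Dense {g : (varLebesgue p hp).half.Space | MemLp ((varLebesgue p hp).half.incl g) 2 volPos} :=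
  hp.isModular.restrict.dense_memLp_two_of_doubling fun c =>
    (powExp_mul_le_of_essSup_lt_top hfin c).imp fun _ hC => ae_restrict_of_ae hC

end VariableLebesgue

/-! ### Orlicz spaces -/

section Orlicz

variable {φ : ℝ≥0 → ℝ≥0∞}

theorem volume_Ioc_coe_nnreal (s t : ℝ≥0) : volume (Ioc (s : ℝ) t) = t - s := by
  rw [Real.volume_Ioc, ENNReal.ofReal_sub _ s.coe_nonneg, ENNReal.ofReal_coe_nnreal,
    ENNReal.ofReal_coe_nnreal]

theorem young_le_of_forall_lt (φ : ℝ≥0 → ℝ≥0∞) {m a : ℝ≥0∞}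
    (h : ∀ s : ℝ≥0, s < m → young φ s ≤ a) : young φ m ≤ a := by
  obtain rfl | hm := eq_zero_or_pos m
  · rw [young_zero]
    exact zero_le
  obtain ⟨u, hu, hum, hlim⟩ := exists_seq_strictMono_tendsto' hm
  have hset : {t : ℝ | 0 < t ∧ ENNReal.ofReal t ≤ m} =ᵐ[volume]
      ⋃ n, {t : ℝ | 0 < t ∧ ENNReal.ofReal t ≤ u n} := by
    filter_upwards [compl_mem_ae_iff.2 (measure_singleton m.toReal)] with t (htm : t ≠ m.toReal)
    refine propext ⟨fun ⟨ht, hle⟩ => ?_, fun hmem => ?_⟩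
    · have hlt : ENNReal.ofReal t < m :=
        hle.lt_of_ne fun heq => htm (by rw [← heq, ENNReal.toReal_ofReal ht.le])
      obtain ⟨n, hn⟩ := (hlim.eventually (lt_mem_nhds hlt)).exists
      exact mem_iUnion.2 ⟨n, ht, hn.le⟩
    · obtain ⟨n, ht, hn⟩ := mem_iUnion.1 hmem
      exact ⟨ht, hn.trans (hum n).2.le⟩
  have hmono : Monotone fun n => {t : ℝ | 0 < t ∧ ENNReal.ofReal t ≤ u n} :=
    fun _ _ hkn _ ht => ⟨ht.1, ht.2.trans (hu.monotone hkn)⟩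
  rw [young, setLIntegral_congr hset, setLIntegral_iUnion_of_directed _ hmono.directed_le]
  refine iSup_le fun n => ?_
  have hn := h (u n).toNNReal
  rw [ENNReal.coe_toNNReal ((hum n).2.trans_le le_top).ne] at hn
  exact hn (hum n).2

namespace IsYoungDensity

theorem young_add_mul_sub_le (hφ : IsYoungDensity φ) {s : ℝ≥0} {t : ℝ≥0∞} (h : s ≤ t) :
    young φ s + φ s * (t - s) ≤ young φ t := by
  induction t with
  | top => simp [hφ.young_top]
  | coe t =>
    rw [young_coe_add φ (ENNReal.coe_le_coe.1 h), ← volume_Ioc_coe_nnreal, ← setLIntegral_const]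
    gcongr 1
    exact setLIntegral_mono' measurableSet_Ioc fun u hu =>
      hφ.mono (NNReal.le_toNNReal_of_coe_le hu.1.le)

theorem young_le_add_mul_sub (hφ : IsYoungDensity φ) {s t : ℝ≥0} (h : s ≤ t) :
    young φ t ≤ young φ s + φ t * (t - s) := by
  rw [young_coe_add φ h, ← volume_Ioc_coe_nnreal, ← setLIntegral_const]
  gcongr 1
  exact setLIntegral_mono' measurableSet_Ioc fun u hu =>
    hφ.mono (Real.toNNReal_le_iff_le_coe.2 hu.2)

theorem exists_le_add_young (hφ : IsYoungDensity φ) : ∃ c : ℝ≥0, ∀ t, t ≤ c + young φ t := by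
  obtain ⟨s, hs⟩ := (hφ.tendsto.eventually (lt_mem_nhds ENNReal.one_lt_top)).exists
  refine ⟨s, fun t => ?_⟩
  obtain hst | hts := le_total (s : ℝ≥0∞) t
  · calc t
      _ = s + 1 * (t - s) := by rw [one_mul, add_tsub_cancel_of_le hst]
      _ ≤ s + φ s * (t - s) := by gcongr
      _ ≤ s + young φ t := by
          gcongr
          exact le_add_self.trans (hφ.young_add_mul_sub_le hst)
  · exact hts.trans le_self_add

theorem young_add_mul_le_young_add_mul (hφ : IsYoungDensity φ) (s : ℝ≥0) (z : ℝ≥0∞) :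
    young φ s + φ s * z ≤ young φ z + φ s * s := by
  obtain hsz | hzs := le_total (s : ℝ≥0∞) z
  · calc young φ s + φ s * z
      _ = young φ s + φ s * (z - s) + φ s * s := by
          rw [add_assoc, ← mul_add, tsub_add_cancel_of_le hsz]
      _ ≤ young φ z + φ s * s := by grw [hφ.young_add_mul_sub_le hsz]
  · lift z to ℝ≥0 using (hzs.trans_lt ENNReal.coe_lt_top).ne
    calc young φ s + φ s * z
      _ ≤ young φ z + φ s * (s - z) + φ s * z := by
          grw [hφ.young_le_add_mul_sub (ENNReal.coe_le_coe.1 hzs)]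
      _ = young φ z + φ s * s := by rw [add_assoc, ← mul_add, tsub_add_cancel_of_le hzs]

theorem young_eq_top_of_lt (hφ : IsYoungDensity φ) {s : ℝ≥0} (hs : φ s = ∞) {z : ℝ≥0∞}
    (hsz : s < z) : young φ z = ∞ := by
  have hle := hφ.young_add_mul_sub_le hsz.le
  rwa [hs, ENNReal.top_mul (tsub_pos_of_lt hsz).ne', add_top, top_le_iff] at hle

/-- The supporting line at `s` proves Jensen's inequality only when `φ s` is finite. -/
theorem young_lintegral_le (hφ : IsYoungDensity φ) (ν : Measure ℝ) [IsProbabilityMeasure ν]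
    {u : ℝ → ℝ≥0∞} (hu : Measurable u) : young φ (∫⁻ t, u t ∂ν) ≤ ∫⁻ t, young φ (u t) ∂ν := by
  refine young_le_of_forall_lt φ fun s hs => ?_
  obtain hφs | hφs := eq_or_ne (φ s) ∞
  · by_contra! hlt
    have hle : ∀ᵐ t ∂ν, u t ≤ s := by
      filter_upwards [ae_lt_top ((young_mono φ).measurable.comp hu) (hlt.trans_le le_top).ne]
        with t ht
      exact not_lt.1 fun hst => ht.ne (hφ.young_eq_top_of_lt hφs hst)
    refine hs.not_ge ((lintegral_mono_ae hle).trans ?_)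
    simp
  · have hline : ∫⁻ t, (young φ s + φ s * u t) ∂ν ≤ ∫⁻ t, (young φ (u t) + φ s * s) ∂ν :=
      lintegral_mono fun t => hφ.young_add_mul_le_young_add_mul s (u t)
    rw [lintegral_add_left measurable_const, lintegral_const_mul _ hu,
      lintegral_add_right _ measurable_const, lintegral_const, lintegral_const, measure_univ,
      mul_one, mul_one] at hline
    refine (ENNReal.add_le_add_iff_right (ENNReal.mul_ne_top hφs ENNReal.coe_ne_top)).1
      (le_trans ?_ hline)
    gcongr

theorem young_laplaceConv_le (hφ : IsYoungDensity φ) {u : ℝ → ℝ≥0∞} (hu : Measurable u) (x : ℝ) :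
    young φ (2⁻¹ * laplaceConv u x) ≤ 2⁻¹ * laplaceConv (fun t => young φ (u t)) x := by
  have hmeas : Measurable fun t => 2⁻¹ * laplaceKernel (x - t) := by fun_prop
  set ν := volume.withDensity fun t => 2⁻¹ * laplaceKernel (x - t)
  have hν {h : ℝ → ℝ≥0∞} (hh : Measurable h) : ∫⁻ t, h t ∂ν = 2⁻¹ * laplaceConv h x := by
    rw [lintegral_withDensity_eq_lintegral_mul _ hmeas hh, laplaceConv,
      ← lintegral_const_mul' _ _ (by simp)]
    simp only [Pi.mul_apply, mul_assoc]
  have hprob : IsProbabilityMeasure ν := by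
    refine ⟨?_⟩
    rw [withDensity_apply _ MeasurableSet.univ, Measure.restrict_univ,
      lintegral_const_mul' _ _ (by simp), lintegral_laplaceKernel_sub_left,
      ENNReal.inv_mul_cancel two_ne_zero (by simp)]
  have hyoung : Measurable fun t => young φ (u t) := (young_mono φ).measurable.comp hu
  rw [← hν hu, ← hν hyoung]
  exact hφ.young_lintegral_le ν hu

theorem lintegral_young_div_le (hφ : IsYoungDensity φ) {f g : ℝ → ℝ≥0∞} (hf : Measurable f)
    (hg : ∀ᵐ x, g x ≤ laplaceConv f x) {l : ℝ≥0} (hl : l ≠ 0) :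
    ∫⁻ x, young φ (g x / (2 * l : ℝ≥0)) ≤ ∫⁻ x, young φ (f x / l) := by
  have hdiv (a : ℝ≥0∞) : a / (2 * l : ℝ≥0) = 2⁻¹ * (a / l) := by
    rw [ENNReal.coe_mul, div_eq_mul_inv, div_eq_mul_inv,
      ENNReal.mul_inv (Or.inl (by simp)) (Or.inl (by simp)), mul_left_comm, ENNReal.coe_ofNat]
  have hfl : Measurable fun t => f t / l := hf.div_const _
  have hyoung : Measurable fun t => young φ (f t / l) := (young_mono φ).measurable.comp hfl
  calc ∫⁻ x, young φ (g x / (2 * l : ℝ≥0))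
    _ ≤ ∫⁻ x, 2⁻¹ * laplaceConv (fun t => young φ (f t / l)) x := by
        refine lintegral_mono_ae ?_
        filter_upwards [hg] with x hx
        rw [hdiv]
        refine (young_mono φ ?_).trans (hφ.young_laplaceConv_le hfl x)
        rw [← laplaceConv_div _ hl]
        gcongr
    _ = ∫⁻ x, young φ (f x / l) := by
        rw [lintegral_const_mul' _ _ (by simp), lintegral_laplaceConv hyoung, ← mul_assoc,
          ENNReal.inv_mul_cancel two_ne_zero (by simp), one_mul]

end IsYoungDensity

theorem isConvBounded_orlicz (hφ : IsYoungDensity φ) : IsConvBounded (orlicz φ hφ).line where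
  exists_excess_lt_top f hf := by
    obtain ⟨c, hc⟩ := hφ.exists_le_add_young
    exact hφ.isModular.exists_excess_lt_top (ae_of_all _ fun _ => hc) hf
  exists_bound := by
    refine ⟨2, fun f g _ hg => le_mul_luxemburg (by simp) (by simp) fun l hl hfl => ?_⟩
    have h2l := (hφ.lintegral_young_div_le f.measurable.enorm hg hl.ne').trans hfl
    exact (luxemburg_le (2 * l) (by positivity) h2l).trans_eq (ENNReal.coe_mul _ _)
  rho_indicator_lt_top f hf := by
    obtain ⟨t, ht, hφt⟩ := hφ.finite
    refine hφ.isModular.rho_indicator_one_lt_top measurableSet_Icc ht ?_ hf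
    have hyoung : young φ t ≤ φ t * t := by
      simpa [young_zero] using hφ.young_le_add_mul_sub (zero_le (a := t))
    rw [setLIntegral_const, Real.volume_Icc, sub_zero, ENNReal.ofReal_one, mul_one]
    exact hyoung.trans_lt (ENNReal.mul_lt_top hφt ENNReal.coe_lt_top)

end Orlicz

/-! ### Density in reflexive spaces -/

section Reflexive

section WeakLimit

variable {E : Type*} [NormedAddCommGroup E] [NormedSpace ℂ E]

theorem IsReflexive.exists_forall_tendsto (hE : IsReflexive E) {ι : Type*} (U : Ultrafilter ι)
    {g : ι → E} {R : ℝ} (hR : ∀ i, ‖g i‖ ≤ R) :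
    ∃ y, ∀ ℓ : StrongDual ℂ E, Tendsto (fun i => ℓ (g i)) U (𝓝 (ℓ y)) := by
  set evalDual : ι → WeakDual ℂ (StrongDual ℂ E) := fun i =>
    StrongDual.toWeakDual (NormedSpace.inclusionInDoubleDual ℂ E (g i))
  have hmem (i : ι) : evalDual i ∈ WeakDual.toStrongDual ⁻¹' Metric.closedBall 0 R :=
    (dist_zero_right (E := StrongDual ℂ (StrongDual ℂ E)) _).le.trans
      ((NormedSpace.double_dual_bound ℂ E (g i)).trans (hR i))
  obtain ⟨Λ, -, hΛ⟩ := (WeakDual.isCompact_closedBall (0 : StrongDual ℂ (StrongDual ℂ E))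
    R).ultrafilter_le_nhds (U.map evalDual)
      (le_principal_iff.2 (Filter.mem_map.2 (Eventually.of_forall hmem)))
  obtain ⟨y, hy⟩ := hE (WeakDual.toStrongDual Λ)
  refine ⟨y, fun ℓ => ?_⟩
  have hΛy : Λ ℓ = ℓ y := (DFunLike.congr_fun hy ℓ).symm
  rw [← hΛy]
  exact ((WeakDual.eval_continuous ℓ).tendsto Λ).comp hΛ

theorem mem_closure_of_forall_tendsto {ι : Type*} {l : Filter ι} [l.NeBot] {s : Set E}
    (hs : Convex ℝ s) {g : ι → E} (hg : ∀ i, g i ∈ s) {y : E}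
    (hlim : ∀ ℓ : StrongDual ℂ E, Tendsto (fun i => ℓ (g i)) l (𝓝 (ℓ y))) : y ∈ closure s := by
  by_contra hy
  obtain ⟨ℓ, u, hlt, hult⟩ :=
    RCLike.geometric_hahn_banach_closed_point (𝕜 := ℂ) hs.closure isClosed_closure hy
  have hre : Tendsto (fun i => RCLike.re (ℓ (g i))) l (𝓝 (RCLike.re (ℓ y))) :=
    (RCLike.continuous_re.tendsto _).comp (hlim ℓ)
  exact hult.not_ge (le_of_tendsto' hre fun i => (hlt _ (subset_closure (hg i))).le)

end WeakLimit

namespace IsModular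

variable {μ : Measure ℝ} {M : ℝ → ℝ≥0∞ → ℝ≥0∞} {c : ℝ≥0} {s : Set ℝ}

theorem setLIntegral_enorm_le (hM : IsModular μ M) (hc : ∀ᵐ x ∂μ, ∀ t, t ≤ c + M x t)
    (hs : μ s ≠ ∞) (f : ℝ →ₘ[μ] ℂ) : ∫⁻ x in s, ‖f x‖ₑ ∂μ ≤ (c * μ s + 1) * hM.norm.rho f := by
  refine le_mul_luxemburg (by simp) (by finiteness) fun l hl hfl => ?_
  calc ∫⁻ x in s, ‖f x‖ₑ ∂μ
    _ ≤ ∫⁻ x in s, (l * c + l * M x (‖f x‖ₑ / l)) ∂μ := by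
        refine lintegral_mono_ae ?_
        filter_upwards [ae_restrict_of_ae hc] with x hx
        exact le_mul_add_of_le_add hl hx _
    _ = l * c * μ s + l * ∫⁻ x in s, M x (‖f x‖ₑ / l) ∂μ := by
        rw [lintegral_add_left measurable_const, setLIntegral_const,
          lintegral_const_mul' _ _ ENNReal.coe_ne_top]
    _ ≤ l * c * μ s + l * 1 := by
        gcongr
        exact (setLIntegral_le_lintegral _ _).trans hfl
    _ = (c * μ s + 1) * l := by ring

theorem integrableOn_incl (hM : IsModular μ M) (hc : ∀ᵐ x ∂μ, ∀ t, t ≤ c + M x t) (hs : μ s ≠ ∞)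
    (f : hM.norm.Space) : IntegrableOn (hM.norm.incl f) s μ :=
  ⟨(hM.norm.incl f).aestronglyMeasurable.restrict,
    (hM.setLIntegral_enorm_le hc hs _).trans_lt
      (ENNReal.mul_lt_top (by finiteness) (hM.norm.rho_incl_lt_top f))⟩

theorem exists_strongDual_eq_setIntegral (hM : IsModular μ M) (hc : ∀ᵐ x ∂μ, ∀ t, t ≤ c + M x t)
    (hs : μ s ≠ ∞) :
    ∃ ℓ : StrongDual ℂ hM.norm.Space, ∀ f, ℓ f = ∫ x in s, hM.norm.incl f x ∂μ := by
  refine ⟨LinearMap.mkContinuous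
    { toFun f := ∫ x in s, hM.norm.incl f x ∂μ
      map_add' f g := by
        rw [← integral_add (hM.integrableOn_incl hc hs f) (hM.integrableOn_incl hc hs g), map_add]
        exact integral_congr_ae (ae_restrict_of_ae (AEEqFun.coeFn_add _ _))
      map_smul' a f := by
        rw [RingHom.id_apply, smul_eq_mul, ← integral_const_mul, map_smul]
        exact integral_congr_ae (ae_restrict_of_ae (AEEqFun.coeFn_smul _ _)) }
    (c * μ s + 1).toReal fun f => ?_, fun f => rfl⟩
  have hle : ‖∫ x in s, hM.norm.incl f x ∂μ‖ₑ ≤ (c * μ s + 1) * hM.norm.rho (hM.norm.incl f) :=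
    (enorm_integral_le_lintegral_enorm _).trans (hM.setLIntegral_enorm_le hc hs _)
  have htoReal := ENNReal.toReal_mono
    (ENNReal.mul_ne_top (by finiteness) (hM.norm.rho_incl_lt_top f).ne) hle
  rwa [ENNReal.toReal_mul, toReal_enorm] at htoReal

end IsModular

theorem ae_eq_of_forall_ae_restrict_truncSet {f g : ℝ →ₘ[volPos] ℂ}
    (h : ∀ k, g =ᵐ[volPos.restrict (truncSet f k)] f) : g = f := by
  refine AEEqFun.ext ?_
  filter_upwards [ae_all_iff.2 fun k => (ae_restrict_iff' (measurableSet_truncSet f k)).1 (h k)]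
    with x hx
  obtain ⟨k, hk⟩ := (eventually_mem_truncSet f x).exists
  exact hx k hk

/-- The elements of `N.Space` lying in `L²`. -/
def FunNorm.memLpTwo (N : FunNorm volPos) : Submodule ℂ N.Space where
  carrier := {g | MemLp (N.incl g) 2 volPos}
  zero_mem' := by
    rw [mem_ofPred_eq, map_zero]
    exact MemLp.zero.ae_eq AEEqFun.coeFn_zero.symm
  add_mem' ha hb := by
    rw [mem_ofPred_eq, map_add]
    exact (ha.add hb).ae_eq (AEEqFun.coeFn_add _ _).symm
  smul_mem' z _ ha := by
    rw [mem_ofPred_eq, map_smul]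
    exact (ha.const_smul z).ae_eq (AEEqFun.coeFn_smul _ _).symm

namespace IsModular

variable {M : ℝ → ℝ≥0∞ → ℝ≥0∞} {c : ℝ≥0}

theorem eq_of_forall_tendsto_trunc (hM : IsModular volPos M)
    (hc : ∀ᵐ x ∂volPos, ∀ t, t ≤ c + M x t) {l : Filter ℕ} [l.NeBot] (hl : l ≤ atTop)
    {f y : hM.norm.Space} {g : ℕ → hM.norm.Space}
    (hg : ∀ n, hM.norm.incl (g n) = trunc (hM.norm.incl f) n)
    (hlim : ∀ ℓ : StrongDual ℂ hM.norm.Space, Tendsto (fun n => ℓ (g n)) l (𝓝 (ℓ y))) : y = f := by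
  set F := hM.norm.incl f
  refine hM.norm.incl_injective (ae_eq_of_forall_ae_restrict_truncSet fun k => ?_)
  have hfin := (volPos_truncSet_lt_top F k).ne
  refine Integrable.ae_eq_of_forall_setIntegral_eq _ _ (hM.integrableOn_incl hc hfin y)
    (hM.integrableOn_incl hc hfin f) fun s hs _ => ?_
  rw [Measure.restrict_restrict hs]
  obtain ⟨ℓ, hℓ⟩ := hM.exists_strongDual_eq_setIntegral hc
    (measure_ne_top_of_subset (inter_subset_right (s := s)) hfin)
  have hconst : ∀ᶠ n in l, ℓ f = ℓ (g n) := by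
    refine hl ?_
    filter_upwards [eventually_ge_atTop k] with n hn
    rw [hℓ, hℓ, hg]
    refine setIntegral_congr_ae (hs.inter (measurableSet_truncSet F k)) ?_
    filter_upwards [coeFn_trunc F n] with x hx hxs
    rw [hx, indicator_of_mem (truncSet_mono F hn hxs.2)]
  rw [← hℓ, ← hℓ]
  exact tendsto_nhds_unique (hlim ℓ) (tendsto_const_nhds.congr' hconst)

theorem dense_memLp_two_of_isReflexive (hM : IsModular volPos M)
    (hc : ∀ᵐ x ∂volPos, ∀ t, t ≤ c + M x t) (hr : IsReflexive hM.norm.Space) :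
    Dense {g : hM.norm.Space | MemLp (hM.norm.incl g) 2 volPos} := by
  intro f
  have hrho_le (n : ℕ) := hM.luxemburg_mono_of_le (enorm_trunc_le (hM.norm.incl f) n)
  have hf := hM.norm.rho_incl_lt_top f
  set g : ℕ → hM.norm.Space := fun n =>
    hM.norm.toSpace (trunc (hM.norm.incl f) n) ((hrho_le n).trans_lt hf)
  obtain ⟨y, hy⟩ := hr.exists_forall_tendsto (hyperfilter ℕ) (g := g)
    fun n => ENNReal.toReal_mono hf.ne (hrho_le n)
  have hyf : y = f :=
    hM.eq_of_forall_tendsto_trunc hc Nat.hyperfilter_le_atTop (fun n => rfl) hy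
  rw [← hyf]
  exact mem_closure_of_forall_tendsto (hM.norm.memLpTwo.restrictScalars ℝ).convex
    (fun n => memLp_trunc _ n) hy

end IsModular

theorem dense_memLp_two_orlicz {φ : ℝ≥0 → ℝ≥0∞} (hφ : IsYoungDensity φ)
    (hr : IsReflexive (orlicz φ hφ).half.Space) :
    Dense {g : (orlicz φ hφ).half.Space | MemLp ((orlicz φ hφ).half.incl g) 2 volPos} := by
  obtain ⟨c, hc⟩ := hφ.exists_le_add_young
  exact hφ.isModular.restrict.dense_memLp_two_of_isReflexive (ae_of_all _ fun _ => hc) hr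

end Reflexive

section Admissible

variable {X : SpacePair}

theorem IsAdmissible.isConvBounded (hX : IsAdmissible X) : IsConvBounded X.line := by
  cases hX with
  | lorentz p q hp hq => exact isConvBounded_lorentz hp hq
  | orlicz φ hφ hr => exact isConvBounded_orlicz hφ
  | varLebesgue p hp hM => exact isConvBounded_varLebesgue hp hM

theorem IsAdmissible.dense_memLp_two (hX : IsAdmissible X) :
    Dense {g : X.half.Space | MemLp (X.half.incl g) 2 volPos} := by
  cases hX with
  | lorentz p q hp hq => exact dense_memLp_two_lorentz hq
  | orlicz φ hφ hr => exact dense_memLp_two_orlicz hφ hr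
  | varLebesgue p hp hM => exact dense_memLp_two_varLebesgue hp hM.essSup_lt_top

end Admissible

end WH
end

theorem mainTheorem10_general (X : WH.SpacePair) (hN : WH.IsConvBounded X.line)
    (hd : Dense {g : X.half.Space | MemLp (X.half.incl g) 2 WH.volPos}) :
    (∀ k : ℤ, WH.IsFourierMultiplier X.line (WH.r k)) ∧
    ∃ psi0 : X.half.Space,
      (X.half.incl psi0 =ᵐ[volume.restrict (Ioi (0 : ℝ))]
        fun x : ℝ => ((Real.sqrt 2 * Real.exp (-x) : ℝ) : ℂ)) ∧
      ∀ n : ℕ, LinearMap.ker (WH.W X (WH.r (-(n : ℤ)))).toLinearMap =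
        Submodule.span ℂ (WH.psi X psi0 '' {k : ℕ | k < n}) := by
  obtain ⟨psi0, hpsi0⟩ := hN.exists_coeFn_eq_sqrt_two_mul_exp_neg
  refine ⟨hN.isFourierMultiplier_r, psi0, hpsi0, fun n => ?_⟩
  simp only [Complex.ofReal_mul] at hpsi0
  have hker : LinearMap.ker (X.compression (hN.shift (-1))).toLinearMap = Submodule.span ℂ {psi0} :=
    hN.ker_compression_shift_neg_one (by simp) hpsi0
  have hinv : (X.compression (hN.shift (-1))).toLinearMap *
      (X.compression (hN.shift 1)).toLinearMap = 1 :=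
    congrArg ContinuousLinearMap.toLinearMap
      (hN.compression_shift_neg_one_mul_compression_shift_one hd)
  rw [funext (hN.psi_eq_pow hd psi0), hN.W_r_neg_natCast hd,
    ContinuousLinearMap.toLinearMap_pow, WH.ker_pow_eq_span_of_mul_eq_one hinv hker]
  simp only [← ContinuousLinearMap.toLinearMap_pow, ContinuousLinearMap.coe_coe]

/-- Let `X` be one of the three spaces. The functions `r_k` are Fourier multipliers on `X(ℝ)`, the
function `ψ_0(x) = √2 e^{-x}` belongs to `X(ℝ₊)`, and for all `n` the kernel of `W(r_{-n})` on
`X(ℝ₊)` is the span of `ψ_0, …, ψ_{n-1}`, where `ψ_k = W(r_k) ψ_0`. -/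
theorem mainTheorem10 (X : WH.SpacePair) (hX : WH.IsAdmissible X) :
    (∀ k : ℤ, WH.IsFourierMultiplier X.line (WH.r k)) ∧
    ∃ psi0 : X.half.Space,
      (X.half.incl psi0 =ᵐ[volume.restrict (Ioi (0 : ℝ))]
        fun x : ℝ => ((Real.sqrt 2 * Real.exp (-x) : ℝ) : ℂ)) ∧
      ∀ n : ℕ, LinearMap.ker (WH.W X (WH.r (-(n : ℤ)))).toLinearMap =
        Submodule.span ℂ (WH.psi X psi0 '' {k : ℕ | k < n}) :=
  mainTheorem10_general X hX.isConvBounded hX.dense_memLp_two
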